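/- **Theorem 1.2.** Let $V$ be a finite-dimensional vector space over a finite field, equipped with a non-degenerate form that is symplectic (alternating bilinear), unitary (Hermitian with respect to a field automorphism of order $2$) or orthogonal (a quadratic form without nonzero singular vectors orthogonal to all of $V$); write $W$ for this formed space, $B$ for its sesquilinear form (the polar form of the quadratic form in the orthogonal case), and suppose that its Witt index $\omega$, the largest dimension of a totally singular subspace, is at least $2$. For $1\le k\le\omega$ let $\Gamma=PG_W(k)$ be the polar Grassmann graph: its vertices are the totally singular $k$-subspaces of $V$; for $k<\omega$, $u$ and $v$ are adjacent when $u+v$ is a totally singular $(k+1)$-subspace, and for $k=\omega$ when $\dim(u\cap v)=k-1$. A geodesic of length $\ell$ is a path $(X_0,\dots,X_\ell)$ with $d_\Gamma(X_0,X_\ell)=\ell$. A connected graph is geodesic-transitive if its automorphism group is transitive on the geodesics of each given length. A connected graph of diameter $d$ is distance-regular if there are positive integers $b_0,\dots,b_{d-1},c_1,\dots,c_d$ such that, for all vertices $X,Y$ at distance $i$, exactly $c_i$ (if $i\ge1$), respectively $b_i$ (if $i<d$), neighbours of $X$ are at distance $i-1$, respectively $i+1$, from $Y$. Then the following are equivalent: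 (i) $\Gamma$ is geodesic-transitive; (ii) $\Gamma$ is distance-regular; (iii) $k=1$ ($\Gamma$ is a polar graph) or $k=\omega$ ($\Gamma$ is a dual polar graph). Moreover, if $k<\omega$, the geodesics of $\Gamma$ and their orbits are as follows. Call distinct vertices $X,Y$ *opposite* if for every $y\in Y\setminus X$ there is $x\in X\setminus Y$ with $B(x,y)\ne0$. (a) For distinct vertices $X,Y$, $d_\Gamma(X,Y)=k-\dim(X\cap Y)$ if $X,Y$ are not opposite, and $d_\Gamma(X,Y)=k-\dim(X\cap Y)+1$ if they are. The diameter of $\Gamma$ is $k+1$. (b) Let $m\ge1$. A *pattern* is a partially defined injective map $i\mapsto i'$ on $\{1,\dots,m\}$ with $i'<i$ wherever it is defined. A sequence $(X_0,\dots,X_m)$ of vertices is a geodesic with non-opposite ends if and only if $m\le k$ and, for some pattern, there are linearly independent vectors $x_1,\dots,x_m,y_1,\dots,y_m,w_1,\dots,w_{k-m}$ with $X_i=\langle x_1,\dots,x_{m-i},y_{m-i+1},\dots,y_m,w_1,\dots,w_{k-m}\rangle$ for $0\le i\le m$, such that $B(x_i,y_j)=1$ if $i'$ is defined and $j=i'$,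 and $B(x_i,y_j)=0$ otherwise. (c) Let $m\ge1$. A sequence $(X,X_0,\dots,X_m)$ of vertices is a geodesic with opposite ends if and only if $m\le k$ and there are linearly independent vectors $x_0,\dots,x_m,y_1,\dots,y_m,w_1,\dots,w_{k-m}$ with $X=\langle x_1,\dots,x_m,w_1,\dots,w_{k-m}\rangle$ and $X_i=\langle x_0,\dots,x_{m-i-1},y_{m-i+1},\dots,y_m,w_1,\dots,w_{k-m}\rangle$ for $0\le i\le m$, such that $B(x_i,y_i)=1$ for $1\le i\le m$, $B(x_i,y_j)=0$ for $i\ne j$, and $B(x_i,x_j)=0$ for all $i,j$. (d) Let $H$ be the group of automorphisms of $\Gamma$ induced by the linear isometries of $W$, or, unless $W$ is orthogonal with $\dim V=8$, $\omega=4$ and $k=2$, let $H=\mathrm{Aut}\,\Gamma$. For $2\le\ell\le k+1$ the geodesics of length $\ell$ with opposite ends form one $H$-orbit. For $1\le m\le k$, two geodesics of length $m$ with non-opposite ends, having patterns $r$ and $r'$ as in (b), lie in the same $H$-orbit if and only if $r=r'$. The number of $H$-orbits on the geodesics of length $m$ with non-opposite ends is $$\mathcal L(m)=\sum_{(t_1,\dots,t_m)}\frac{t_1t_2\cdots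 t_m}{t_m!},$$ where the sum is over the integer sequences with $t_1=1$, $t_{i+1}\in\{t_i,t_i+1\}$ and $t_i\le\omega-k$; if $m\le\omega-k$, then $\mathcal L(m)$ is the Bell number $B(m)$. -/

import Mathlib

/-- A non-degenerate form of one of the three classical kinds on a vector space `V` over a
field `F`: an alternating bilinear form, a Hermitian form with respect to an automorphism `σ` of
order two of the field, or a quadratic form.  A quadratic form is called non-degenerate here if no
nonzero singular vector is orthogonal to all of `V`; if `V` has odd dimension and `F` is a finite
field of characteristic two, this is the usual notion, which allows the polar form to have a
one-dimensional, non-singular radical.  Over a finite field and with Witt index `ω`, these are, up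
to similarity, exactly `Sp(2ω,q)`, `U(2ω,√q)`, `U(2ω+1,√q)`, `Ω⁺(2ω,q)`, `Ω(2ω+1,q)` and
`Ω⁻(2ω+2,q)`. -/
inductive PolarForm (F V : Type*) [Field F] [AddCommGroup V] [Module F V] where
  | symplectic (B : V →ₗ[F] V →ₗ[F] F)
      (alt : ∀ x, B x x = 0)
      (nondeg : ∀ x, (∀ y, B x y = 0) → x = 0)
  | unitary (σ : F →+* F) (sigma_ne : σ ≠ RingHom.id F) (sigma_sigma : ∀ a, σ (σ a) = a)
      (B : V →ₗ[F] V →ₛₗ[σ] F)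
      (herm : ∀ x y, B y x = σ (B x y))
      (nondeg : ∀ x, (∀ y, B x y = 0) → x = 0)
  | orthogonal (Q : QuadraticForm F V)
      (nondeg : ∀ x, Q x = 0 → (∀ y, QuadraticMap.polar Q x y = 0) → x = 0)

namespace PolarForm

variable {F V : Type*} [Field F] [AddCommGroup V] [Module F V]

/-- The reflexive sesquilinear form `B` of the formed space (the polar form of `Q` in the
orthogonal case). -/
def form : PolarForm F V → V → V → F
  | symplectic B _ _ => fun x y => B x y
  | unitary _ _ _ B _ _ => fun x y => B x y
  | orthogonal Q _ => fun x y => QuadraticMap.polar Q x y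

/-- Totally singular subspaces (totally isotropic ones in the symplectic and unitary cases). -/
def IsTotallySingular : PolarForm F V → Submodule F V → Prop
  | symplectic B _ _ => fun U => ∀ x ∈ U, ∀ y ∈ U, B x y = 0
  | unitary _ _ _ B _ _ => fun U => ∀ x ∈ U, ∀ y ∈ U, B x y = 0
  | orthogonal Q _ => fun U => ∀ x ∈ U, Q x = 0

/-- The linear isometries of the formed space. -/
def IsIsometry : PolarForm F V → (V ≃ₗ[F] V) → Prop
  | symplectic B _ _ => fun g => ∀ x y, B (g x) (g y) = B x y
  | unitary _ _ _ B _ _ => fun g => ∀ x y, B (g x) (g y) = B x y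
  | orthogonal Q _ => fun g => ∀ x, Q (g x) = Q x

/-- The formed space is an orthogonal one. -/
def IsOrthogonal : PolarForm F V → Prop
  | symplectic _ _ _ => False
  | unitary _ _ _ _ _ _ => False
  | orthogonal _ _ => True

/-- The Witt index: the largest dimension of a totally singular subspace. -/
noncomputable def wittIndex (W : PolarForm F V) : ℕ :=
  sSup {d | ∃ U : Submodule F V, W.IsTotallySingular U ∧ Module.finrank F U = d}

/-- The totally singular subspaces of dimension `k`. -/
abbrev SingularSubspace (W : PolarForm F V) (k : ℕ) : Type _ :=
  {U : Submodule F V // W.IsTotallySingular U ∧ Module.finrank F U = k}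

/-- The polar Grassmann graph on the totally singular `k`-subspaces, for `k` at most the Witt
index `ω`.  If `k = ω`, then `u` and `v` are adjacent when `dim (u ∩ v) = k - 1`; if `k < ω`, they
are adjacent when `u + v` is a totally singular `(k+1)`-subspace. -/
def polarGrassmannGraph (W : PolarForm F V) (k : ℕ) : SimpleGraph (W.SingularSubspace k) where
  Adj u v :=
    (k = W.wittIndex ∧ Module.finrank F ↥(u.1 ⊓ v.1) + 1 = k) ∨
    (k < W.wittIndex ∧ W.IsTotallySingular (u.1 ⊔ v.1) ∧ Module.finrank F ↥(u.1 ⊔ v.1) = k + 1)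
  symm := ⟨fun u v h => by
    rw [inf_comm, sup_comm]
    exact h⟩
  loopless := ⟨fun u h => by
    have hu := u.2.2
    rcases h with ⟨-, h⟩ | ⟨-, -, h⟩
    · rw [inf_idem] at h; omega
    · rw [sup_idem] at h; omega⟩

/-- Opposite pairs: distinct subspaces such that every vector of `Y \ X` is non-orthogonal to some
vector of `X \ Y`. -/
def Opposite (W : PolarForm F V) (X Y : Submodule F V) : Prop :=
  X ≠ Y ∧ ∀ y ∈ Y, y ∉ X → ∃ x ∈ X, x ∉ Y ∧ W.form x y ≠ 0

/-- The automorphisms of the polar Grassmann graph that are induced by isometries. -/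
def isometryAut (W : PolarForm F V) (k : ℕ) :
    Subgroup (W.polarGrassmannGraph k ≃g W.polarGrassmannGraph k) where
  carrier := {φ | ∃ g : V ≃ₗ[F] V, W.IsIsometry g ∧
    ∀ U : W.SingularSubspace k, (φ U).1 = U.1.map (g : V →ₗ[F] V)}
  one_mem' := ⟨LinearEquiv.refl F V, by cases W <;> intro _ <;> simp, fun U => by simp⟩
  mul_mem' := by
    rintro φ ψ ⟨g, hg, hφ⟩ ⟨h, hh, hψ⟩
    refine ⟨h.trans g, ?_, fun U => ?_⟩
    · cases W
      · intro x y
        exact (hg (h x) (h y)).trans (hh x y)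
      · intro x y
        exact (hg (h x) (h y)).trans (hh x y)
      · intro x
        exact (hg (h x)).trans (hh x)
    · rw [RelIso.mul_apply, hφ, hψ, ← Submodule.map_comp]
      rfl
  inv_mem' := by
    rintro φ ⟨g, hg, hφ⟩
    refine ⟨g.symm, ?_, fun U => ?_⟩
    · cases W
      · intro x y
        simpa using (hg (g.symm x) (g.symm y)).symm
      · intro x y
        simpa using (hg (g.symm x) (g.symm y)).symm
      · intro x
        simpa using (hg (g.symm x)).symm
    · have h := hφ (φ⁻¹ U)
      rw [RelIso.apply_inv_self] at h
      rw [h, ← Submodule.map_comp]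
      simp

end PolarForm

namespace SimpleGraph

variable {α : Type*}

/-- A geodesic of length `ℓ`, as a sequence of `ℓ + 1` vertices: a path whose length is the
distance of its ends. -/
def IsGeodesic (G : SimpleGraph α) {l : ℕ} (p : Fin (l + 1) → α) : Prop :=
  (∀ i : Fin l, G.Adj (p i.castSucc) (p i.succ)) ∧ G.dist (p 0) (p (Fin.last l)) = l

/-- A connected graph is geodesic-transitive if its automorphism group is transitive on the
geodesics of each given length. -/
def IsGeodesicTransitive (G : SimpleGraph α) : Prop :=
  G.Connected ∧ ∀ (l : ℕ) (p p' : Fin (l + 1) → α), G.IsGeodesic p → G.IsGeodesic p' →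
    ∃ φ : G ≃g G, ∀ i, φ (p i) = p' i

/-- A connected graph of diameter `d` is distance-regular if there are positive integers
`b 0, …, b (d-1)` and `c 1, …, c d` such that, for any two vertices `x`, `y` at distance `i`,
there are precisely `c i` (respectively `b i`) neighbours of `x` at distance `i - 1`
(respectively `i + 1`) from `y`. -/
def IsDistanceRegular (G : SimpleGraph α) : Prop :=
  G.Connected ∧ ∃ b c : ℕ → ℕ,
    (∀ i, i < G.diam → 0 < b i ∧ ∀ x y, G.dist x y = i →
      {z | G.Adj x z ∧ G.dist z y = i + 1}.ncard = b i) ∧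
    (∀ i, 1 ≤ i → i ≤ G.diam → 0 < c i ∧ ∀ x y, G.dist x y = i →
      {z | G.Adj x z ∧ G.dist z y = i - 1}.ncard = c i)

end SimpleGraph

namespace PolarForm

variable {F V : Type*} [Field F] [AddCommGroup V] [Module F V]

/-- A pattern `i ↦ i'` for the nonzero products `B(x_i, y_{i'})`: a partially defined injective
map on the index set with `i' < i` wherever `i'` is defined. -/
def IsPattern {m : ℕ} (r : Fin m → Option (Fin m)) : Prop :=
  (∀ i j, r i = some j → j < i) ∧ ∀ i i' j, r i = some j → r i' = some j → i = i'

/-- The sequence `X_0, …, X_m` of `k`-subspaces is induced, with pattern `r`, by linearly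
independent vectors `x_1, …, x_m`, `y_1, …, y_m`, `w_1, …, w_{k-m}`: here
`X_i = ⟨x_1, …, x_{m-i}, y_{m-i+1}, …, y_m, w_1, …, w_{k-m}⟩` and
`B(x_i, y_j)` is `1` if `j = i'` and `0` otherwise. (Indices are shifted to start from `0`.) -/
def HasPattern (W : PolarForm F V) (k : ℕ) {m : ℕ} (r : Fin m → Option (Fin m))
    (X : Fin (m + 1) → W.SingularSubspace k) : Prop :=
  ∃ (x y : Fin m → V) (w : Fin (k - m) → V),
    LinearIndependent F (Sum.elim (Sum.elim x y) w) ∧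
    (∀ i : Fin (m + 1), (X i).1 = Submodule.span F
      (x '' {j | (j : ℕ) + i < m} ∪ y '' {j | m ≤ (j : ℕ) + i} ∪ Set.range w)) ∧
    ∀ i j, W.form (x i) (y j) = if r i = some j then 1 else 0

/-- The sequence `X, X_0, …, X_m` of `k`-subspaces is induced by linearly independent vectors
`x_0, …, x_m`, `y_1, …, y_m`, `w_1, …, w_{k-m}`: here `X = ⟨x_1, …, x_m, w_1, …, w_{k-m}⟩`,
`X_i = ⟨x_0, …, x_{m-i-1}, y_{m-i+1}, …, y_m, w_1, …, w_{k-m}⟩`, and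
`B(x_i, y_j)` is `1` if `i = j` and `0` otherwise, while `B(x_i, x_j) = 0`.
(The index of the `y_j` is shifted to start from `0`.) -/
def HasOppositeForm (W : PolarForm F V) (k : ℕ) {m : ℕ}
    (X : Fin (m + 2) → W.SingularSubspace k) : Prop :=
  ∃ (x : Fin (m + 1) → V) (y : Fin m → V) (w : Fin (k - m) → V),
    LinearIndependent F (Sum.elim (Sum.elim x y) w) ∧
    (X 0).1 = Submodule.span F (x '' {j | j ≠ 0} ∪ Set.range w) ∧
    (∀ i : Fin (m + 1), (X i.succ).1 = Submodule.span F
      (x '' {j | (j : ℕ) + i < m} ∪ y '' {j | m ≤ (j : ℕ) + i} ∪ Set.range w)) ∧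
    (∀ i j, W.form (x i) (y j) = if i = j.succ then 1 else 0) ∧
    ∀ i j, W.form (x i) (x j) = 0

/-- The types `(t_1, …, t_n)`, `n = m + 1`: sequences with `t_1 = 1`, with `t_{i+1} = t_i` or
`t_{i+1} = t_i + 1`, and with all `t_i ≤ N`. -/
def geodesicTypes (m N : ℕ) : Finset (Fin (m + 1) → ℕ) :=
  {t ∈ Fintype.piFinset fun _ => Finset.range (N + 1) |
    t 0 = 1 ∧ ∀ i : Fin m, t i.succ = t i.castSucc ∨ t i.succ = t i.castSucc + 1}

/-- The number `𝓛(n) = ∑ (t_1 ⋯ t_n) / t_n!`, `n = m + 1`, where `(t_1, …, t_n)` ranges over the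
types bounded by `N`. -/
def typeSum (m N : ℕ) : ℕ :=
  ∑ t ∈ geodesicTypes m N, (∏ i, t i) / (t (Fin.last m)).factorial

/-- The description of the orbits of a group `H` of automorphisms of the polar Grassmann graph on
the geodesics, `k` less than the Witt index. -/
def OrbitDescription (W : PolarForm F V) (k : ℕ)
    (H : Subgroup (W.polarGrassmannGraph k ≃g W.polarGrassmannGraph k)) : Prop :=
  -- The geodesics of length `l` with opposite ends form an orbit, `2 ≤ l ≤ k + 1`.
  (∀ l, 2 ≤ l → l ≤ k + 1 → ∃ X : Fin (l + 1) → W.SingularSubspace k,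
    MulAction.orbit H X = {Y | (W.polarGrassmannGraph k).IsGeodesic Y ∧
      W.Opposite (Y 0).1 (Y (Fin.last l)).1}) ∧
  -- Geodesics of length `m` with non-opposite ends are in one orbit exactly when their patterns
  -- agree, `1 ≤ m ≤ k`; in particular, a geodesic has only one pattern.
  (∀ m, 1 ≤ m → m ≤ k → ∀ r r' : Fin m → Option (Fin m), IsPattern r → IsPattern r' →
    ∀ X X' : Fin (m + 1) → W.SingularSubspace k, W.HasPattern k r X → W.HasPattern k r' X' →
      (X' ∈ MulAction.orbit H X ↔ r = r')) ∧
  -- The number of orbits on the geodesics of length `m + 1 ≤ k` with non-opposite ends.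
  (∀ m, m + 1 ≤ k →
    {O | ∃ X : Fin (m + 1 + 1) → W.SingularSubspace k, (W.polarGrassmannGraph k).IsGeodesic X ∧
      ¬ W.Opposite (X 0).1 (X (Fin.last (m + 1))).1 ∧ O = MulAction.orbit H X}.ncard =
        typeSum m (W.wittIndex - k) ∧
    (m + 1 ≤ W.wittIndex - k → typeSum m (W.wittIndex - k) = Nat.bell (m + 1)))

end PolarForm

/-!
The three kinds of forms are treated together: each has a reflexive sesquilinear form `B` and a set
of singular vectors, and the proof uses only their formal properties. Every transitivity statement
comes from Witt's theorem (`PolarForm.exists_isometry_of_gram`): singular vectors with the same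
products `B` are moved to each other by an isometry, provided that their spans avoid the radical.

*Distances.* If some `y ∈ Y` outside `X` is orthogonal to `X`, then replacing a suitable hyperplane
complement of `X` by `y` is a step towards `Y` that can be repeated, so that
`d(X, Y) = k - dim (X ∩ Y)`. For opposite vertices no first step can increase the intersection, so
that one more step is needed (`dist_of_not_opposite`, `Opposite.dist_eq`).

*Geodesics.* A path from `X` to `Y` of length `m = k - dim (X ∩ Y)` is determined by a flag of `X`
and a flag of `Y`, both from `X ∩ Y` upwards. By elimination, the bases of the two flags can be
chosen such that the matrix of products is a partial permutation matrix
(`exists_matching`, a form of the Bruhat decomposition). Adjacency of consecutive terms says that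
this partial permutation `r` satisfies `r i < i`, that is, it is a pattern (`exists_hasPattern`).
If the ends are opposite, then all but the first vertex form such a geodesic; a rank computation
leaves only the pattern `i ↦ i - 1`, and the first vertex supplies one further basis vector
(`exists_hasOppositeForm`). By Witt's theorem, geodesics with the same normal form lie in one orbit
of the isometry group.

*The pattern is invariant under all automorphisms of the graph.* For non-opposite `X` and `Y`, the
number of neighbours of `X` closer to `Y` grows strictly with the dimension of the space
`(Y ∩ X^⊥) / (X ∩ Y)`. For the terms `X_a`, `X_b` of a geodesic with pattern `r` this dimension is
the number of indices in an interval that `r` does not match there, and these numbers determine `r`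
(`HasPattern.pattern_eq`).

*Automorphisms preserve opposition.* It suffices to separate opposite from non-opposite pairs at
distance `k`, because other pairs can be extended (`exists_adj_not_opposite_of_dist_lt`). For a
non-opposite pair at distance `k` the closer neighbours behave like the squares of a rook's graph:
none has three pairwise non-adjacent neighbours among them, and any two non-adjacent ones have a
common neighbour among them. For opposite pairs this fails (`not_hasClawOrGap`,
`Opposite.hasClawOrGap`), except in the excluded orthogonal spaces, where a singular vector needed
for it does not exist.

*Counting.* A pattern occurs exactly if it leaves at most `ω - k` indices undefined. Extending a
pattern by one index gives the recursion of the Stirling numbers of the second kind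
(`card_patterns`), which the sum over the types satisfies as well (`sum_geodesicTypes`).

*The equivalence.* Geodesic-transitive finite graphs are distance-regular. If `1 < k < ω`, then
two vertices at distance two have a single common neighbour if they are non-opposite and `B` has
rank one between them, but at least two if they are opposite. If `k = 1`, the lengths and patterns
leave one orbit for each length. If `k = ω`, then maximality of the vertices forces the partial
permutation `r` of any geodesic to be the identity (`exists_dual_basis`).
-/

open Module

/-! ### The three kinds of forms treated uniformly -/

namespace PolarForm

variable {F V : Type*} [Field F] [AddCommGroup V] [Module F V]

/-- The field automorphism `σ` with respect to which the form is sesquilinear (the identity for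
symplectic and orthogonal forms). -/
def conj : PolarForm F V → F →+* F
  | symplectic _ _ _ => RingHom.id F
  | unitary σ _ _ _ _ _ => σ
  | orthogonal _ _ => RingHom.id F

/-- The sign `ε` in `B(y, x) = ε σ(B(x, y))`. -/
def sgn : PolarForm F V → F
  | symplectic _ _ _ => -1
  | unitary _ _ _ _ _ _ => 1
  | orthogonal _ _ => 1

/-- Singular vectors: all vectors in the symplectic case, isotropic ones in the unitary case and
zeros of the quadratic form in the orthogonal case. -/
def Sing : PolarForm F V → V → Prop
  | symplectic _ _ _ => fun _ => True
  | unitary _ _ _ B _ _ => fun x => B x x = 0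
  | orthogonal Q _ => fun x => Q x = 0

variable (W : PolarForm F V)

theorem form_add_left (x x' y : V) : W.form (x + x') y = W.form x y + W.form x' y := by
  cases W <;> simp [form]

theorem form_add_right (x y y' : V) : W.form x (y + y') = W.form x y + W.form x y' := by
  cases W <;> simp [form]

theorem form_smul_left (a : F) (x y : V) : W.form (a • x) y = a * W.form x y := by
  cases W <;> simp [form]

theorem form_smul_right (a : F) (x y : V) : W.form x (a • y) = W.conj a * W.form x y := by
  cases W <;> simp [form, conj]

theorem form_swap (x y : V) : W.form y x = W.sgn * W.conj (W.form x y) := by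
  cases W with
  | symplectic B alt _ =>
    have : B.IsAlt := alt
    simp [form, sgn, conj, ← this.neg x y]
  | unitary σ _ _ B herm _ => simp [form, sgn, conj, herm x y]
  | orthogonal Q _ => simp [form, sgn, conj, QuadraticMap.polar_comm Q y x]

theorem conj_conj (a : F) : W.conj (W.conj a) = a := by
  cases W with
  | symplectic B alt _ => simp [conj]
  | unitary σ _ h B herm _ => simp [conj, h]
  | orthogonal Q _ => simp [conj]

theorem sgn_ne_zero : W.sgn ≠ 0 := by
  cases W <;> simp [sgn]

theorem sgn_mul_conj_sgn_inv : W.sgn * W.conj W.sgn⁻¹ = 1 := by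
  cases W <;> simp [sgn, conj]

/-- The form as a linear functional in the first variable. -/
def formLeft (y : V) : V →ₗ[F] F where
  toFun x := W.form x y
  map_add' x x' := W.form_add_left x x' y
  map_smul' a x := W.form_smul_left a x y

@[simp]
theorem formLeft_apply (x y : V) : W.formLeft y x = W.form x y := rfl

@[simp]
theorem form_zero_left (y : V) : W.form 0 y = 0 := (W.formLeft y).map_zero

@[simp]
theorem form_zero_right (x : V) : W.form x 0 = 0 := by
  rw [W.form_swap, W.form_zero_left, map_zero, mul_zero]

theorem form_neg_left (x y : V) : W.form (-x) y = -W.form x y := (W.formLeft y).map_neg x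

theorem form_sub_left (x x' y : V) : W.form (x - x') y = W.form x y - W.form x' y :=
  (W.formLeft y).map_sub x x'

theorem form_neg_right (x y : V) : W.form x (-y) = -W.form x y := by
  rw [W.form_swap, W.form_swap y x, form_neg_left, map_neg, mul_neg]

theorem form_sub_right (x y y' : V) : W.form x (y - y') = W.form x y - W.form x y' := by
  rw [sub_eq_add_neg, form_add_right, form_neg_right, sub_eq_add_neg]

theorem form_eq_zero_comm {x y : V} : W.form x y = 0 ↔ W.form y x = 0 := by
  rw [W.form_swap x y]
  simp [sgn_ne_zero]

theorem isTotallySingular_iff {U : Submodule F V} :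
    W.IsTotallySingular U ↔ (∀ x ∈ U, W.Sing x) ∧ ∀ x ∈ U, ∀ y ∈ U, W.form x y = 0 := by
  cases W with
  | symplectic B alt _ => simp [IsTotallySingular, Sing, form]
  | unitary σ _ h B herm _ =>
    simp only [IsTotallySingular, Sing, form]
    exact ⟨fun h => ⟨fun x hx => h x hx x hx, h⟩, fun h => h.2⟩
  | orthogonal Q _ =>
    simp only [IsTotallySingular, Sing, form]
    refine ⟨fun h => ⟨h, fun x hx y hy => ?_⟩, fun h => h.1⟩
    simp [QuadraticMap.polar, h x hx, h y hy, h _ (U.add_mem hx hy)]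

theorem sing_zero : W.Sing 0 := by
  cases W <;> simp [Sing]

variable {W}

theorem Sing.form_self {x : V} (hx : W.Sing x) : W.form x x = 0 := by
  cases W with
  | symplectic B alt _ => exact alt x
  | unitary σ _ h B herm _ => exact hx
  | orthogonal Q _ =>
    have : Q x = 0 := hx
    simp [form, QuadraticMap.polar_self, this]

theorem Sing.smul {x : V} (hx : W.Sing x) (a : F) : W.Sing (a • x) := by
  cases W with
  | symplectic B alt _ => trivial
  | unitary σ _ h B herm _ =>
    have : B x x = 0 := hx
    simp [Sing, this]
  | orthogonal Q _ =>
    have : Q x = 0 := hx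
    simp [Sing, QuadraticMap.map_smul, this]

theorem Sing.add {x y : V} (hx : W.Sing x) (hy : W.Sing y) (h : W.form x y = 0) :
    W.Sing (x + y) := by
  have h' := W.form_eq_zero_comm.1 h
  cases W with
  | symplectic B alt _ => trivial
  | unitary σ _ _ B herm _ =>
    have h1 : B x x = 0 := hx
    have h2 : B y y = 0 := hy
    have h3 : B x y = 0 := h
    have h4 : B y x = 0 := h'
    simp [Sing, h1, h2, h3, h4]
  | orthogonal Q _ =>
    have h1 : Q x = 0 := hx
    have h2 : Q y = 0 := hy
    have h3 : QuadraticMap.polar Q x y = 0 := h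
    simpa [Sing, QuadraticMap.polar, h1, h2] using h3

theorem Sing.neg {x : V} (hx : W.Sing x) : W.Sing (-x) := by
  simpa using hx.smul (-1)

theorem Sing.eq_zero {x : V} (hx : W.Sing x) (h : ∀ y, W.form x y = 0) : x = 0 := by
  cases W with
  | symplectic B _ nondeg => exact nondeg x h
  | unitary σ _ _ B _ nondeg => exact nondeg x h
  | orthogonal Q nondeg => exact nondeg x hx h

/-- The trace map `z ↦ z + σ z` of a nontrivial involution `σ` reaches every fixed element. -/
theorem exists_add_conj_eq {σ : F →+* F} (hσ : σ ≠ RingHom.id F) (hσσ : ∀ a, σ (σ a) = a) {c : F}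
    (hc : σ c = c) : ∃ s, s + σ s = c := by
  obtain ⟨z, hz⟩ : ∃ z, z + σ z ≠ 0 := by
    by_contra! h
    have h1 : (1 : F) + 1 = 0 := by simpa using h 1
    refine hσ (RingHom.ext fun z => ?_)
    have h2 : z + z = 0 := by rw [← two_mul, ← one_add_one_eq_two, h1, zero_mul]
    exact add_left_cancel ((h z).trans h2.symm)
  refine ⟨c * z / (z + σ z), ?_⟩
  have : σ (z + σ z) = z + σ z := by rw [map_add, hσσ, add_comm]
  rw [map_div₀, map_mul, this, hc]
  field_simp

/-- A vector not orthogonal to a singular vector `x` becomes singular after adding a multiple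
of `x`. -/
theorem Sing.exists_add_smul {x y : V} (hx : W.Sing x) (h : W.form x y ≠ 0) :
    ∃ t : F, W.Sing (y + t • x) := by
  cases W with
  | symplectic B _ _ => exact ⟨0, trivial⟩
  | unitary σ hσ hσσ B herm _ =>
    have h1 : B x x = 0 := hx
    have h2 : B x y ≠ 0 := h
    obtain ⟨s, hs⟩ := exists_add_conj_eq hσ hσσ (c := -B y y) (by rw [map_neg, ← herm y y])
    refine ⟨s / B x y, ?_⟩
    have h3 : σ (B x y) ≠ 0 := by simpa using h2
    simp only [Sing, map_add, LinearMap.add_apply, map_smul, LinearMap.smul_apply,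
      LinearMap.map_smulₛₗ, smul_eq_mul, h1, herm x y, map_div₀]
    field_simp
    linear_combination (B x y * σ (B x y)) * hs
  | orthogonal Q _ =>
    have h1 : Q x = 0 := hx
    have h2 : QuadraticMap.polar Q x y ≠ 0 := h
    refine ⟨-Q y / QuadraticMap.polar Q x y, ?_⟩
    have h3 := QuadraticMap.map_add Q y ((-Q y / QuadraticMap.polar Q x y) • x)
    simp only [Sing]
    rw [h3, QuadraticMap.map_smul, h1, QuadraticMap.polar_smul_right,
      QuadraticMap.polar_comm Q y x, smul_eq_mul, smul_eq_mul]
    field_simp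
    ring

/-- A linear map preserving the form, and the quadratic form in the orthogonal case, is an
isometry. -/
theorem exists_isometry_of_linearMap [FiniteDimensional F V] (f : V →ₗ[F] V)
    (hf : ∀ x y, W.form (f x) (f y) = W.form x y) (hQ : ∀ x, W.Sing (f x) → W.Sing x)
    (hiso : ∀ g : V ≃ₗ[F] V, (∀ x, g x = f x) → W.IsIsometry g) :
    ∃ g : V ≃ₗ[F] V, W.IsIsometry g ∧ ∀ x, g x = f x := by
  have hinj : Function.Injective f := by
    rw [← LinearMap.ker_eq_bot, LinearMap.ker_eq_bot']
    intro x hx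
    refine (hQ x (hx ▸ W.sing_zero)).eq_zero fun y => ?_
    rw [← hf, hx, form_zero_left]
  exact ⟨LinearEquiv.ofInjectiveEndo f hinj, hiso _ fun x => rfl, fun x => rfl⟩

theorem IsIsometry.form_map {g : V ≃ₗ[F] V} (hg : W.IsIsometry g) (x y : V) :
    W.form (g x) (g y) = W.form x y := by
  cases W with
  | symplectic B _ _ => exact hg x y
  | unitary σ _ _ B _ _ => exact hg x y
  | orthogonal Q _ =>
    have h : ∀ x, Q (g x) = Q x := hg
    simp [form, QuadraticMap.polar, ← map_add, h]

theorem IsIsometry.sing_map {g : V ≃ₗ[F] V} (hg : W.IsIsometry g) {x : V} :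
    W.Sing (g x) ↔ W.Sing x := by
  cases W with
  | symplectic B _ _ => exact Iff.rfl
  | unitary σ _ _ B _ _ =>
    have h : ∀ x y, B (g x) (g y) = B x y := hg
    simp [Sing, h]
  | orthogonal Q _ =>
    have h : ∀ x, Q (g x) = Q x := hg
    simp [Sing, h]

theorem isIsometry_refl : W.IsIsometry (LinearEquiv.refl F V) := by
  cases W <;> simp [IsIsometry]

theorem IsIsometry.trans {g h : V ≃ₗ[F] V} (hg : W.IsIsometry g) (hh : W.IsIsometry h) :
    W.IsIsometry (g.trans h) := by
  cases W with
  | symplectic B _ _ => exact fun x y => (hh _ _).trans (hg x y)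
  | unitary σ _ _ B _ _ => exact fun x y => (hh _ _).trans (hg x y)
  | orthogonal Q _ => exact fun x => (hh _).trans (hg x)

theorem IsIsometry.symm {g : V ≃ₗ[F] V} (hg : W.IsIsometry g) : W.IsIsometry g.symm := by
  cases W with
  | symplectic B _ _ => exact fun x y => by simpa using (hg (g.symm x) (g.symm y)).symm
  | unitary σ _ _ B _ _ => exact fun x y => by simpa using (hg (g.symm x) (g.symm y)).symm
  | orthogonal Q _ => exact fun x => by simpa using (hg (g.symm x)).symm

/-- Singular vectors `u`, `v` with `B(u, v) ≠ 0` are interchanged by a reflection or transvection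
in the direction of `v - u`. It fixes every vector having equal products with `u` and `v`. -/
theorem exists_isometry_of_form_ne_zero [FiniteDimensional F V] {u v : V} (hu : W.Sing u)
    (hv : W.Sing v) (h : W.form u v ≠ 0) :
    ∃ g : V ≃ₗ[F] V, W.IsIsometry g ∧ g u = v ∧
      ∀ x, W.form x u = W.form x v → g x = x := by
  set d := v - u with hd
  let f : V →ₗ[F] V :=
    LinearMap.id + ((W.form u v)⁻¹ • W.formLeft d).smulRight d
  have hfx : ∀ x, f x = x + ((W.form u v)⁻¹ * W.form x d) • d := fun x => rfl
  suffices hsuff : ∃ g : V ≃ₗ[F] V, W.IsIsometry g ∧ ∀ x, g x = f x by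
    obtain ⟨g, hg, hgf⟩ := hsuff
    refine ⟨g, hg, ?_, fun x hx => ?_⟩
    · rw [hgf, hfx, hd, form_sub_right, hu.form_self, sub_zero, inv_mul_cancel₀ h]
      simp
    · rw [hgf, hfx, hd, form_sub_right, hx]
      simp
  clear_value f
  have hdd : W.form d d = -W.form u v - W.form v u := by
    simp only [hd, form_sub_left, form_sub_right, hu.form_self, hv.form_self]
    ring
  cases W with
  | symplectic B alt nondeg =>
    have halt : B.IsAlt := alt
    have key : ∀ x y, B (f x) (f y) = B x y := by
      intro x y
      rw [hfx, hfx]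
      have h1 : B d d = 0 := alt d
      have h2 : B d y = -B y d := (halt.neg y d).symm
      simp only [form, map_add, LinearMap.add_apply, map_smul, LinearMap.smul_apply, smul_eq_mul,
        h1, h2]
      ring
    exact exists_isometry_of_linearMap f key (fun _ _ => trivial)
      fun g hg x y => by rw [hg, hg]; exact key x y
  | unitary σ hσ hσσ B herm nondeg =>
    have h0 : B u v ≠ 0 := h
    have h0' : σ (B u v) ≠ 0 := by simpa using h0
    have h1 : B d d = -B u v - σ (B u v) := by rw [← herm]; exact hdd
    have key : ∀ x y, B (f x) (f y) = B x y := by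
      intro x y
      rw [hfx, hfx]
      simp only [form, map_add, LinearMap.add_apply, map_smul, LinearMap.smul_apply, smul_eq_mul,
        h1, LinearMap.map_smulₛₗ, map_mul, map_inv₀, herm y d]
      field_simp
      ring
    exact exists_isometry_of_linearMap f key (fun x hx => by simpa [Sing, key] using hx)
      fun g hg x y => by rw [hg, hg]; exact key x y
  | orthogonal Q nondeg =>
    have h0 : QuadraticMap.polar Q u v ≠ 0 := h
    have h1 : Q d = -QuadraticMap.polar Q u v := by
      have h3 := QuadraticMap.map_add Q v (-u)
      have hu' : Q u = 0 := hu
      have hv' : Q v = 0 := hv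
      rw [QuadraticMap.map_neg, hu', hv', QuadraticMap.polar_neg_right, QuadraticMap.polar_comm,
        ← sub_eq_add_neg] at h3
      rw [hd, h3]
      ring
    have key : ∀ x, Q (f x) = Q x := by
      intro x
      rw [hfx, QuadraticMap.map_add Q, QuadraticMap.map_smul, h1, QuadraticMap.polar_smul_right]
      simp only [form, smul_eq_mul]
      field_simp
      ring
    have key' : ∀ x y, QuadraticMap.polar Q (f x) (f y) = QuadraticMap.polar Q x y := by
      intro x y
      simp only [QuadraticMap.polar, ← map_add f, key]
    exact exists_isometry_of_linearMap f key' (fun x hx => by simpa [Sing, key] using hx)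
      fun g hg x => by rw [hg]; exact key x

/-- Siegel transformations: if `d` is singular and orthogonal to `a`, some isometry sends `x` to
`x + B(x, a) d` for all `x` orthogonal to `d`. -/
theorem exists_siegel_isometry [FiniteDimensional F V] {d a : V} (hd : W.Sing d)
    (had : W.form a d = 0) :
    ∃ g : V ≃ₗ[F] V, W.IsIsometry g ∧ ∀ x, W.form x d = 0 → g x = x + W.form x a • d := by
  have hdd := hd.form_self
  have hda := W.form_eq_zero_comm.1 had
  suffices hsuff : ∃ (c t : F) (g : V ≃ₗ[F] V), W.IsIsometry g ∧
      ∀ x, g x = x + W.form x a • d + W.form x d • (c • a + t • d) by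
    obtain ⟨c, t, g, hg, hgx⟩ := hsuff
    exact ⟨g, hg, fun x hx => by rw [hgx, hx, zero_smul, add_zero]⟩
  have hlin : ∀ c t : F, ∃ f : V →ₗ[F] V,
      ∀ x, f x = x + W.form x a • d + W.form x d • (c • a + t • d) := fun c t =>
    ⟨LinearMap.id + (W.formLeft a).smulRight d + (W.formLeft d).smulRight (c • a + t • d),
      fun x => rfl⟩
  cases W with
  | symplectic B alt nondeg =>
    obtain ⟨f, hfx⟩ := hlin 1 0
    have halt : B.IsAlt := alt
    have key : ∀ x y, B (f x) (f y) = B x y := by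
      intro x y
      rw [hfx, hfx]
      have h1 : B d d = 0 := alt d
      have h2 : B a a = 0 := alt a
      have h3 : B d a = 0 := hda
      have h4 : B a d = 0 := had
      have h5 : B d y = -B y d := (halt.neg y d).symm
      have h6 : B a y = -B y a := (halt.neg y a).symm
      simp only [form, map_add, LinearMap.add_apply, map_smul, LinearMap.smul_apply, smul_eq_mul,
        h1, h2, h3, h4, h5, h6]
      ring
    obtain ⟨g, hg⟩ := exists_isometry_of_linearMap (W := symplectic B alt nondeg) f key
      (fun _ _ => trivial) fun g hg x y => by rw [hg, hg]; exact key x y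
    exact ⟨1, 0, g, hg.1, fun x => (hg.2 x).trans (hfx x)⟩
  | unitary σ hσ hσσ B herm nondeg =>
    obtain ⟨t, ht⟩ := exists_add_conj_eq hσ hσσ (c := -B a a) (by rw [map_neg, ← herm a a])
    obtain ⟨f, hfx⟩ := hlin (-1) t
    have key : ∀ x y, B (f x) (f y) = B x y := by
      intro x y
      rw [hfx, hfx]
      have h1 : B d d = 0 := hdd
      have h3 : B d a = 0 := hda
      have h4 : B a d = 0 := had
      simp only [form, map_add, LinearMap.add_apply, map_smul, LinearMap.smul_apply, smul_eq_mul,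
        LinearMap.map_smulₛₗ, map_neg, map_one, h1, h3, h4, herm y d, herm y a]
      linear_combination (B x d * σ (B y d)) * ht
    obtain ⟨g, hg⟩ := exists_isometry_of_linearMap (W := unitary σ hσ hσσ B herm nondeg) f key
      (fun x hx => by simpa [Sing, key] using hx) fun g hg x y => by rw [hg, hg]; exact key x y
    exact ⟨-1, t, g, hg.1, fun x => (hg.2 x).trans (hfx x)⟩
  | orthogonal Q nondeg =>
    obtain ⟨f, hfx⟩ := hlin (-1) (-Q a)
    have h1 : Q d = 0 := hd
    have h2 : QuadraticMap.polar Q d a = 0 := hda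
    have h3 : QuadraticMap.polar Q d d = 0 := hdd
    have key : ∀ x, Q (f x) = Q x := by
      intro x
      rw [hfx]
      simp only [QuadraticMap.map_add Q, QuadraticMap.map_smul, QuadraticMap.polar_smul_right,
        QuadraticMap.polar_smul_left, QuadraticMap.polar_add_left, QuadraticMap.polar_add_right,
        h1, h2, h3, form, smul_eq_mul, QuadraticMap.polar_comm Q a d]
      ring
    have key' : ∀ x y, QuadraticMap.polar Q (f x) (f y) = QuadraticMap.polar Q x y := by
      intro x y
      simp only [QuadraticMap.polar, ← map_add f, key]
    obtain ⟨g, hg⟩ := exists_isometry_of_linearMap (W := orthogonal Q nondeg) f key'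
      (fun x hx => by simpa [Sing, key] using hx) fun g hg x => by rw [hg]; exact key x
    exact ⟨-1, -Q a, g, hg.1, fun x => (hg.2 x).trans (hfx x)⟩

end PolarForm

/-! ### Orthogonal complements -/

namespace PolarForm

variable {F V : Type*} [Field F] [AddCommGroup V] [Module F V] (W : PolarForm F V)

/-- The vectors orthogonal to all vectors of `U`. -/
def perp (U : Submodule F V) : Submodule F V where
  carrier := {v | ∀ u ∈ U, W.form v u = 0}
  add_mem' ha hb u hu := by rw [form_add_left, ha u hu, hb u hu, add_zero]
  zero_mem' u _ := W.form_zero_left u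
  smul_mem' a v hv u hu := by rw [form_smul_left, hv u hu, mul_zero]

variable {W}

theorem mem_perp {U : Submodule F V} {v : V} : v ∈ W.perp U ↔ ∀ u ∈ U, W.form v u = 0 := Iff.rfl

theorem mem_perp' {U : Submodule F V} {v : V} : v ∈ W.perp U ↔ ∀ u ∈ U, W.form u v = 0 :=
  forall₂_congr fun _ _ => W.form_eq_zero_comm

theorem le_perp_comm {U U' : Submodule F V} : U ≤ W.perp U' ↔ U' ≤ W.perp U :=
  ⟨fun h x hx => mem_perp'.2 fun _ hu => h hu x hx,
    fun h x hx => mem_perp'.2 fun _ hu => h hu x hx⟩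

theorem perp_anti {U U' : Submodule F V} (h : U ≤ U') : W.perp U' ≤ W.perp U :=
  fun _ hv u hu => hv u (h hu)

theorem perp_sup (U U' : Submodule F V) : W.perp (U ⊔ U') = W.perp U ⊓ W.perp U' := by
  refine le_antisymm (le_inf (perp_anti le_sup_left) (perp_anti le_sup_right)) ?_
  rintro v ⟨h, h'⟩ u hu
  obtain ⟨a, ha, b, hb, rfl⟩ := Submodule.mem_sup.1 hu
  rw [form_add_right, h a ha, h' b hb, add_zero]

theorem mem_perp_span {s : Set V} {v : V} :
    v ∈ W.perp (Submodule.span F s) ↔ ∀ u ∈ s, W.form v u = 0 := by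
  refine ⟨fun h u hu => h u (Submodule.subset_span hu), fun h u hu => ?_⟩
  induction hu using Submodule.span_induction with
  | mem x hx => exact h x hx
  | zero => exact W.form_zero_right v
  | add x y _ _ hx hy => rw [form_add_right, hx, hy, add_zero]
  | smul a x _ hx => rw [form_smul_right, hx, mul_zero]

theorem span_le_perp_span {s t : Set V} :
    Submodule.span F s ≤ W.perp (Submodule.span F t) ↔ ∀ u ∈ s, ∀ v ∈ t, W.form u v = 0 := by
  rw [Submodule.span_le]
  exact forall₂_congr fun u _ => mem_perp_span

theorem isTotallySingular_iff_le_perp {U : Submodule F V} :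
    W.IsTotallySingular U ↔ (∀ x ∈ U, W.Sing x) ∧ U ≤ W.perp U :=
  W.isTotallySingular_iff

theorem IsTotallySingular.sing {U : Submodule F V} (h : W.IsTotallySingular U) {x : V}
    (hx : x ∈ U) : W.Sing x :=
  (W.isTotallySingular_iff.1 h).1 x hx

theorem IsTotallySingular.form_eq_zero {U : Submodule F V} (h : W.IsTotallySingular U) {x y : V}
    (hx : x ∈ U) (hy : y ∈ U) : W.form x y = 0 :=
  (W.isTotallySingular_iff.1 h).2 x hx y hy

theorem IsTotallySingular.mono {U U' : Submodule F V} (h : W.IsTotallySingular U) (h' : U' ≤ U) :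
    W.IsTotallySingular U' :=
  W.isTotallySingular_iff.2 ⟨fun _ hx => h.sing (h' hx), fun _ hx _ hy =>
    h.form_eq_zero (h' hx) (h' hy)⟩

theorem isTotallySingular_bot : W.IsTotallySingular ⊥ := by
  simp [isTotallySingular_iff, sing_zero]

theorem isTotallySingular_sup_iff {U U' : Submodule F V} :
    W.IsTotallySingular (U ⊔ U') ↔
      W.IsTotallySingular U ∧ W.IsTotallySingular U' ∧ U ≤ W.perp U' := by
  refine ⟨fun h => ⟨h.mono le_sup_left, h.mono le_sup_right, fun x hx y hy =>
    h.form_eq_zero (Submodule.mem_sup_left hx) (Submodule.mem_sup_right hy)⟩, ?_⟩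
  rintro ⟨h, h', hp⟩
  refine isTotallySingular_iff_le_perp.2 ⟨fun x hx => ?_, ?_⟩
  · obtain ⟨a, ha, b, hb, rfl⟩ := Submodule.mem_sup.1 hx
    exact (h.sing ha).add (h'.sing hb) (hp ha b hb)
  · rw [perp_sup]
    exact le_inf (sup_le (isTotallySingular_iff_le_perp.1 h).2 (le_perp_comm.1 hp))
      (sup_le hp (isTotallySingular_iff_le_perp.1 h').2)

theorem isTotallySingular_span_singleton {v : V} (h : W.Sing v) :
    W.IsTotallySingular (Submodule.span F {v}) := by
  refine isTotallySingular_iff_le_perp.2 ⟨fun x hx => ?_, ?_⟩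
  · obtain ⟨a, rfl⟩ := Submodule.mem_span_singleton.1 hx
    exact h.smul a
  · simpa [span_le_perp_span] using h.form_self

theorem isTotallySingular_span_iff {s : Set V} :
    W.IsTotallySingular (Submodule.span F s) ↔
      (∀ x ∈ s, W.Sing x) ∧ ∀ x ∈ s, ∀ y ∈ s, W.form x y = 0 := by
  refine ⟨fun h => ⟨fun x hx => h.sing (Submodule.subset_span hx), fun x hx y hy =>
    h.form_eq_zero (Submodule.subset_span hx) (Submodule.subset_span hy)⟩, ?_⟩
  rintro ⟨h1, h2⟩
  have h3 := span_le_perp_span.2 h2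
  refine isTotallySingular_iff_le_perp.2 ⟨fun x hx => ?_, h3⟩
  induction hx using Submodule.span_induction with
  | mem x hx => exact h1 x hx
  | zero => exact W.sing_zero
  | add x y hx hy hx' hy' => exact hx'.add hy' (h3 hx y hy)
  | smul a x _ hx => exact hx.smul a

/-- The sum of two totally singular subspaces meets the radical of the form trivially. -/
theorem eq_zero_of_mem_sup {P Q : Submodule F V} (hP : W.IsTotallySingular P)
    (hQ : W.IsTotallySingular Q) {z : V} (hz : z ∈ P ⊔ Q) (h : ∀ y, W.form z y = 0) : z = 0 := by
  obtain ⟨p, hp, q, hq, rfl⟩ := Submodule.mem_sup.1 hz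
  have h1 := h q
  rw [form_add_left, hQ.form_eq_zero hq hq, add_zero] at h1
  exact ((hP.sing hp).add (hQ.sing hq) h1).eq_zero h

theorem mem_perp_top {z : V} : z ∈ W.perp ⊤ ↔ ∀ y, W.form z y = 0 := by
  simp [mem_perp]

theorem finrank_comap_subtype (X U : Submodule F V) :
    finrank F (Submodule.comap X.subtype U) = finrank F ↥(X ⊓ U) := by
  rw [← Submodule.map_comap_subtype]
  exact LinearEquiv.finrank_eq (Submodule.equivMapOfInjective _ X.injective_subtype _)

variable [FiniteDimensional F V]

/-- A functional vanishing on `X ⊓ Y^⊥` is represented on `X` by a vector of `Y`. -/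
theorem exists_form_eq {X Y : Submodule F V} (f : V →ₗ[F] F) (hf : ∀ x ∈ X ⊓ W.perp Y, f x = 0) :
    ∃ y ∈ Y, ∀ x ∈ X, W.form x y = f x := by
  let Φ : Submodule F (Dual F X) :=
    { carrier := {g | ∃ y ∈ Y, g = (W.formLeft y).comp X.subtype}
      add_mem' := by
        rintro _ _ ⟨y, hy, rfl⟩ ⟨y', hy', rfl⟩
        exact ⟨y + y', Y.add_mem hy hy', by ext x; simp [form_add_right]⟩
      zero_mem' := ⟨0, Y.zero_mem, by ext x; simp⟩
      smul_mem' := by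
        rintro a _ ⟨y, hy, rfl⟩
        exact ⟨W.conj a • y, Y.smul_mem _ hy, by ext x; simp [form_smul_right, conj_conj]⟩ }
  have h : f.comp X.subtype ∈ Φ.dualCoannihilator.dualAnnihilator := by
    rw [Submodule.mem_dualAnnihilator]
    intro x hx
    rw [Submodule.mem_dualCoannihilator] at hx
    exact hf x ⟨x.2, fun y hy => hx _ ⟨y, hy, rfl⟩⟩
  rw [Subspace.dualCoannihilator_dualAnnihilator_eq] at h
  obtain ⟨y, hy, hfy⟩ := h
  exact ⟨y, hy, fun x hx => (LinearMap.congr_fun hfy ⟨x, hx⟩).symm⟩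

/-- Separation: a vector outside `K` plus the radical has product `1` with some vector orthogonal
to `K`. -/
theorem exists_mem_perp_form_eq_one {K : Submodule F V} {u : V} (h : u ∉ K ⊔ W.perp ⊤) :
    ∃ a ∈ W.perp K, W.form u a = 1 := by
  obtain ⟨f, hf1, hf⟩ := Submodule.exists_le_ker_of_notMem h
  obtain ⟨a, -, ha⟩ := exists_form_eq (W := W) (X := ⊤) (Y := ⊤) ((f u)⁻¹ • f)
    fun x hx => by
      have : f x = 0 := hf (Submodule.mem_sup_right hx.2)
      simp [this]
  refine ⟨a, mem_perp'.2 fun x hx => ?_, ?_⟩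
  · have : f x = 0 := hf (Submodule.mem_sup_left hx)
    simp [ha, this]
  · simp [ha, hf1]

theorem finrank_add_finrank_inf_perp_le (X Y : Submodule F V) :
    finrank F ↥(Y ⊓ W.perp X) + finrank F X ≤ finrank F Y + finrank F ↥(X ⊓ W.perp Y) := by
  -- a complement `X'` of `X ⊓ Y^⊥` in `X`, with basis `e`, has a dual family in `Y`
  obtain ⟨X', hX'⟩ := (Submodule.comap X.subtype (W.perp Y)).exists_isCompl
  set r := finrank F X'
  let e := finBasis F X'
  have hr : finrank F ↥(X ⊓ W.perp Y) + r = finrank F X := by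
    rw [← Submodule.finrank_add_eq_of_isCompl hX']
    congr 1
    exact (finrank_comap_subtype _ _).symm
  let T : Y →ₗ[F] (Fin r → F) := LinearMap.pi fun i => (W.formLeft (e i : V)).comp Y.subtype
  have hT : LinearMap.range T = ⊤ := by
    rw [eq_top_iff, ← (Pi.basisFun F (Fin r)).span_eq, Submodule.span_le]
    rintro _ ⟨i, rfl⟩
    -- the functional on `X` that extends the `i`-th coordinate of `e`
    let f : X →ₗ[F] F := (e.coord i).comp (Submodule.projectionOnto X' _ hX'.symm)
    obtain ⟨f', hf'⟩ := LinearMap.exists_extend f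
    obtain ⟨y, hy, hfy⟩ := exists_form_eq (W := W) (X := X) (Y := Y) (W.sgn⁻¹ • f') fun x hx => by
      have h1 : f' x = f ⟨x, hx.1⟩ := LinearMap.congr_fun hf' ⟨x, hx.1⟩
      have h2 : Submodule.projectionOnto X' _ hX'.symm ⟨x, hx.1⟩ = 0 := by
        rw [Submodule.projectionOnto_apply_eq_zero_iff]
        exact hx.2
      simp [h1, f, h2]
    refine ⟨⟨y, hy⟩, funext fun j => ?_⟩
    have h1 : f' (e j : V) = f (e j) := LinearMap.congr_fun hf' (e j)
    have h2 := hfy (e j : V) (e j : X).2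
    have h3 : Submodule.projectionOnto X' _ hX'.symm (e j : X) = e j :=
      Submodule.projectionOnto_apply_left _ _
    simp only [T, LinearMap.pi_apply, LinearMap.comp_apply, Submodule.subtype_apply,
      formLeft_apply]
    rw [W.form_swap, h2, LinearMap.smul_apply, h1]
    simp only [f, LinearMap.comp_apply, h3]
    rw [Pi.basisFun_apply, Basis.coord_apply, Basis.repr_self, Finsupp.single_apply,
      Pi.single_apply]
    by_cases hij : j = i
    · rw [if_pos hij, smul_eq_mul, mul_one, sgn_mul_conj_sgn_inv]
    · simp [hij]
  have h1 := LinearMap.finrank_range_add_finrank_ker T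
  rw [hT, finrank_top, finrank_pi, Fintype.card_fin] at h1
  have h2 : finrank F ↥(Y ⊓ W.perp X) ≤ finrank F (LinearMap.ker T) := by
    have : (Submodule.comap Y.subtype (W.perp X)) ≤ LinearMap.ker T := by
      intro y hy
      exact funext fun i => hy _ (e i : X).2
    exact (finrank_comap_subtype _ _).symm.trans_le (Submodule.finrank_mono this)
  omega

/-- The pairing of `X` with `Y` has the same rank on both sides. -/
theorem finrank_inf_perp_comm (X Y : Submodule F V) :
    finrank F ↥(Y ⊓ W.perp X) + finrank F X = finrank F Y + finrank F ↥(X ⊓ W.perp Y) := by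
  have h1 := finrank_add_finrank_inf_perp_le (W := W) X Y
  have h2 := finrank_add_finrank_inf_perp_le (W := W) Y X
  omega

end PolarForm

/-! ### Witt's extension theorem -/

namespace PolarForm

variable {F V : Type*} [Field F] [AddCommGroup V] [Module F V] {W : PolarForm F V}

theorem Sing.exists_partner [FiniteDimensional F V] {K : Submodule F V} {d : V} (hd : W.Sing d)
    (hdK : d ∈ W.perp K) (h : d ∉ K ⊔ W.perp ⊤) :
    ∃ f ∈ W.perp K, W.Sing f ∧ W.form d f = 1 := by
  obtain ⟨f, hf, hdf⟩ := exists_mem_perp_form_eq_one h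
  obtain ⟨t, ht⟩ := hd.exists_add_smul (y := f) (by rw [hdf]; exact one_ne_zero)
  refine ⟨f + t • d, (W.perp K).add_mem hf ((W.perp K).smul_mem t hdK), ht, ?_⟩
  rw [form_add_right, form_smul_right, hd.form_self, hdf, mul_zero, add_zero]

/-- One step of Witt's theorem: a singular vector `u` can be moved to a singular vector `v` by an
isometry fixing `K` pointwise, provided `u` and `v` have the same products with `K` and lie
outside of `K` plus the radical. -/
theorem exists_isometry_fixing [FiniteDimensional F V] {K : Submodule F V} {u v : V}
    (hu : W.Sing u) (hv : W.Sing v) (huv : v - u ∈ W.perp K) (huK : u ∉ K ⊔ W.perp ⊤)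
    (hvK : v ∉ K ⊔ W.perp ⊤) :
    ∃ g : V ≃ₗ[F] V, W.IsIsometry g ∧ g u = v ∧ ∀ x ∈ K, g x = x := by
  by_cases h : W.form u v = 0
  · have h' := W.form_eq_zero_comm.1 h
    set d := v - u with hd
    have hds : W.Sing d := by
      rw [hd, sub_eq_add_neg]
      exact hv.add hu.neg (by rw [form_neg_right, h', neg_zero])
    have hud : W.form u d = 0 := by rw [hd, form_sub_right, h, hu.form_self, sub_zero]
    have hvd : v = u + d := by rw [hd]; abel
    by_cases hK : u ∈ (K ⊔ Submodule.span F {d}) ⊔ W.perp ⊤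
    · -- Modulo `K` and the radical, `u` and `v` are multiples of `d`: rescale `d`.
      obtain ⟨x, hx, r, hr, hxr⟩ := Submodule.mem_sup.1 hK
      obtain ⟨k, hk, y, hy, rfl⟩ := Submodule.mem_sup.1 hx
      obtain ⟨l, rfl⟩ := Submodule.mem_span_singleton.1 hy
      have hkr : k + r ∈ K ⊔ W.perp ⊤ :=
        add_mem (Submodule.mem_sup_left hk) (Submodule.mem_sup_right hr)
      have hl : l ≠ 0 := by
        rintro rfl
        rw [zero_smul, add_zero] at hxr
        exact huK (hxr ▸ hkr)
      have hv' : v = k + (l + 1) • d + r := by rw [hvd, ← hxr, add_smul, one_smul]; abel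
      have hl' : l + 1 ≠ 0 := by
        intro h0
        rw [h0, zero_smul, add_zero] at hv'
        exact hvK (hv' ▸ hkr)
      have hdK : d ∉ K ⊔ W.perp ⊤ := by
        intro hdK
        refine huK (hxr ▸ ?_)
        rw [add_right_comm]
        exact add_mem hkr (Submodule.smul_mem _ _ hdK)
      obtain ⟨f, hfK, hf, hdf⟩ := hds.exists_partner huv hdK
      have hm : (l + 1) / l ≠ 0 := div_ne_zero hl' hl
      have hdf0 : W.form d f ≠ 0 := by rw [hdf]; exact one_ne_zero
      obtain ⟨g, hg, hgd, hgx⟩ := exists_isometry_of_form_ne_zero hds hf hdf0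
      obtain ⟨g', hg', hgd', hgx'⟩ := exists_isometry_of_form_ne_zero hf
        (hds.smul ((l + 1) / l)) (by
          rw [form_smul_right]
          exact mul_ne_zero ((map_ne_zero _).2 hm) fun h0 => hdf0 (W.form_eq_zero_comm.1 h0))
      have hfix : ∀ x, W.form x d = 0 → W.form x f = 0 → g' (g x) = x := by
        intro x h1 h2
        rw [hgx x (h1.trans h2.symm), hgx' x]
        rw [form_smul_right, h1, h2, mul_zero]
      refine ⟨g.trans g', hg.trans hg', ?_, fun x hx => ?_⟩
      · simp only [LinearEquiv.trans_apply]
        rw [hv', ← hxr, map_add, map_add, map_add, map_add, map_smul, map_smul, hgd, hgd',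
          hfix k (mem_perp'.1 huv k hk) (mem_perp'.1 hfK k hk),
          hfix r (hr d trivial) (hr f trivial), smul_smul, mul_div_cancel₀ _ hl]
      · exact hfix x (mem_perp'.1 huv x hx) (mem_perp'.1 hfK x hx)
    · obtain ⟨a, ha, hua⟩ := exists_mem_perp_form_eq_one hK
      rw [perp_sup] at ha
      obtain ⟨g, hg, hgx⟩ := exists_siegel_isometry hds
        (ha.2 d (Submodule.mem_span_singleton_self d))
      refine ⟨g, hg, ?_, fun x hx => ?_⟩
      · rw [hgx u hud, hua, one_smul, hvd]
      · rw [hgx x (mem_perp'.1 huv x hx), mem_perp'.1 ha.1 x hx, zero_smul, add_zero]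
  · obtain ⟨g, hg, hgu, hgx⟩ := exists_isometry_of_form_ne_zero hu hv h
    refine ⟨g, hg, hgu, fun x hx => hgx x ?_⟩
    have := mem_perp'.1 huv x hx
    rw [form_sub_right, sub_eq_zero] at this
    exact this.symm

/-- Witt's extension theorem for families of singular vectors whose span meets the radical of the
form trivially. -/
theorem exists_isometry_of_gram [FiniteDimensional F V] {ι : Type*} [Finite ι] {u v : ι → V}
    (hu : LinearIndependent F u) (hv : LinearIndependent F v)
    (hus : ∀ i, W.Sing (u i)) (hvs : ∀ i, W.Sing (v i))
    (h : ∀ i j, W.form (u i) (u j) = W.form (v i) (v j))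
    (hur : ∀ z ∈ Submodule.span F (Set.range u), (∀ y, W.form z y = 0) → z = 0)
    (hvr : ∀ z ∈ Submodule.span F (Set.range v), (∀ y, W.form z y = 0) → z = 0) :
    ∃ g : V ≃ₗ[F] V, W.IsIsometry g ∧ ∀ i, g (u i) = v i := by
  classical
  have := Fintype.ofFinite ι
  have key : ∀ (w : ι → V), LinearIndependent F w →
      (∀ z ∈ Submodule.span F (Set.range w), (∀ y, W.form z y = 0) → z = 0) →
      ∀ (s : Finset ι) (i : ι), i ∉ s → w i ∉ Submodule.span F (w '' s) ⊔ W.perp ⊤ := by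
    intro w hw hwr s i hi hmem
    obtain ⟨k, hk, r, hr, hkr⟩ := Submodule.mem_sup.1 hmem
    have hr0 : r = 0 := by
      refine hwr r ?_ (mem_perp_top.1 hr)
      rw [← eq_sub_iff_add_eq'] at hkr
      rw [hkr]
      exact sub_mem (Submodule.subset_span ⟨i, rfl⟩)
        (Submodule.span_mono (Set.image_subset_range _ _) hk)
    rw [hr0, add_zero] at hkr
    rw [hkr] at hk
    exact hw.notMem_span_image (by simpa using hi) hk
  suffices hs : ∀ s : Finset ι, ∃ g : V ≃ₗ[F] V, W.IsIsometry g ∧ ∀ i ∈ s, g (u i) = v i by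
    obtain ⟨g, hg, hgu⟩ := hs Finset.univ
    exact ⟨g, hg, fun i => hgu i (Finset.mem_univ i)⟩
  intro s
  induction s using Finset.induction_on with
  | empty => exact ⟨LinearEquiv.refl F V, isIsometry_refl, by simp⟩
  | insert i s hi ih =>
    obtain ⟨g, hg, hgu⟩ := ih
    have himg : (fun j => g (u j)) '' s = v '' s := Set.image_congr fun j hj => hgu j hj
    have h1 : g (u i) ∉ Submodule.span F (v '' s) ⊔ W.perp ⊤ := by
      rw [← himg]
      refine key (fun j => g (u j)) (hu.map' (g : V →ₗ[F] V) g.ker) ?_ s i hi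
      intro z hz hzr
      have hz' : g.symm z ∈ Submodule.span F (Set.range u) := by
        have : Set.range (fun j => g (u j)) = (g : V →ₗ[F] V) '' Set.range u := by
          ext; simp
        rw [this, Submodule.span_image] at hz
        obtain ⟨z', hz', rfl⟩ := hz
        simpa using hz'
      have := hur _ hz' fun y => by
        rw [← hg.form_map, LinearEquiv.apply_symm_apply]
        exact hzr _
      simpa using this
    obtain ⟨g', hg', hgi, hgx⟩ := exists_isometry_fixing (W := W) (hg.sing_map.2 (hus i)) (hvs i)
      (K := Submodule.span F (v '' s)) (by
        rw [mem_perp_span]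
        rintro _ ⟨j, hj, rfl⟩
        rw [form_sub_left, ← h, sub_eq_zero]
        exact (hg.form_map (u i) (u j)).symm.trans (by rw [hgu j hj])) h1 (key v hv hvr s i hi)
    refine ⟨g.trans g', hg.trans hg', fun j hj => ?_⟩
    rw [LinearEquiv.trans_apply]
    rcases Finset.mem_insert.1 hj with rfl | hj
    · exact hgi
    · rw [hgu j hj, hgx _ (Submodule.subset_span ⟨j, hj, rfl⟩)]

/-! ### Hyperbolic systems and the Witt index -/

/-- Singular vectors `a i`, `b i` forming mutually orthogonal hyperbolic pairs. -/
structure IsHyperbolic (W : PolarForm F V) {N : ℕ} (a b : Fin N → V) : Prop where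
  sing_left : ∀ i, W.Sing (a i)
  sing_right : ∀ i, W.Sing (b i)
  form_left : ∀ i j, W.form (a i) (a j) = 0
  form_right : ∀ i j, W.form (b i) (b j) = 0
  form_eq : ∀ i j, W.form (a i) (b j) = if i = j then 1 else 0

theorem IsHyperbolic.form_eq' {N : ℕ} {a b : Fin N → V} (h : W.IsHyperbolic a b) (i j : Fin N) :
    W.form (b i) (a j) = if i = j then W.sgn else 0 := by
  rw [form_swap, h.form_eq]
  by_cases hij : j = i <;> simp [hij, eq_comm (a := i)]

theorem IsHyperbolic.linearIndependent {N : ℕ} {a b : Fin N → V} (h : W.IsHyperbolic a b) :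
    LinearIndependent F (Sum.elim a b) := by
  rw [Fintype.linearIndependent_iff]
  intro c hc
  rw [Fintype.sum_sum_type] at hc
  simp only [Sum.elim_inl, Sum.elim_inr] at hc
  have h1 : ∀ y, ∑ i, c (Sum.inl i) * W.form (a i) y + ∑ i, c (Sum.inr i) * W.form (b i) y = 0 := by
    intro y
    have := congrArg (W.formLeft y) hc
    simpa only [map_add, map_sum, map_smul, formLeft_apply, smul_eq_mul, map_zero] using this
  rintro (i | i)
  · simpa [h.form_right, h.form_eq] using h1 (b i)
  · have := h1 (a i)
    simpa [h.form_left, h.form_eq', sgn_ne_zero] using this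

/-- A basis of a totally singular subspace is one half of a hyperbolic system. -/
theorem exists_isHyperbolic [FiniteDimensional F V] {N : ℕ} {a : Fin N → V}
    (ha : LinearIndependent F a) (hts : W.IsTotallySingular (Submodule.span F (Set.range a))) :
    ∃ b, W.IsHyperbolic a b := by
  classical
  obtain ⟨has, haf⟩ := isTotallySingular_span_iff.1 hts
  replace has : ∀ i, W.Sing (a i) := fun i => has _ ⟨i, rfl⟩
  replace haf : ∀ i j, W.form (a i) (a j) = 0 := fun i j => haf _ ⟨i, rfl⟩ _ ⟨j, rfl⟩
  have hdual : ∀ j, ∃ c, ∀ i, W.form (a i) c = if i = j then 1 else 0 := by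
    intro j
    have hj : a j ∉ Submodule.span F (a '' {i | i ≠ j}) ⊔ W.perp ⊤ := by
      intro hmem
      obtain ⟨k, hk, r, hr, hkr⟩ := Submodule.mem_sup.1 hmem
      have hr' : r = a j - k := (sub_eq_of_eq_add' hkr.symm).symm
      have hr0 : r = 0 := by
        refine (hts.sing ?_).eq_zero (mem_perp_top.1 hr)
        rw [hr']
        exact sub_mem (Submodule.subset_span ⟨j, rfl⟩)
          (Submodule.span_mono (Set.image_subset_range _ _) hk)
      rw [hr0, add_zero] at hkr
      rw [hkr] at hk
      exact ha.notMem_span_image (by simp) hk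
    obtain ⟨c, hc, hc1⟩ := exists_mem_perp_form_eq_one hj
    refine ⟨c, fun i => ?_⟩
    split_ifs with hij
    · rw [hij, hc1]
    · exact mem_perp'.1 hc _ (Submodule.subset_span ⟨i, hij, rfl⟩)
  suffices hs : ∀ s : Finset (Fin N), ∃ b : Fin N → V, (∀ j ∈ s, W.Sing (b j)) ∧
      (∀ i, ∀ j ∈ s, W.form (a i) (b j) = if i = j then 1 else 0) ∧
      ∀ i ∈ s, ∀ j ∈ s, W.form (b i) (b j) = 0 by
    obtain ⟨b, h1, h2, h3⟩ := hs Finset.univ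
    exact ⟨b, has, fun i => h1 i (Finset.mem_univ i), haf,
      fun i j => h3 i (Finset.mem_univ i) j (Finset.mem_univ j),
      fun i j => h2 i j (Finset.mem_univ j)⟩
  intro s
  induction s using Finset.induction_on with
  | empty => exact ⟨0, by simp⟩
  | insert j s hj ih =>
    obtain ⟨b, h1, h2, h3⟩ := ih
    obtain ⟨c, hc⟩ := hdual j
    -- make `c` orthogonal to the vectors `b i`, then singular
    set c' := c - ∑ i ∈ s, W.conj (W.sgn⁻¹ * W.form (b i) c) • a i with hc'
    have ha_sum : ∀ (f : Fin N → F) (i : Fin N), W.form (a i) (∑ l ∈ s, f l • a l) = 0 := by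
      intro f i
      refine mem_perp'.1 (?_ : _ ∈ W.perp (Submodule.span F (Set.range a))) (a i)
        (Submodule.subset_span ⟨i, rfl⟩)
      refine (isTotallySingular_iff_le_perp.1 hts).2 ?_
      exact Submodule.sum_smul_mem _ _ fun l _ => Submodule.subset_span ⟨l, rfl⟩
    have hac : ∀ i, W.form (a i) c' = if i = j then 1 else 0 := by
      intro i
      rw [hc', form_sub_right, ha_sum, sub_zero, hc]
    have h2' : ∀ i ∈ s, ∀ l, W.form (b i) (a l) = if i = l then W.sgn else 0 := by
      intro i hi l
      rw [form_swap, h2 l i hi]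
      by_cases hil : l = i <;> simp [hil, eq_comm (a := i)]
    have hb_sum : ∀ (f : Fin N → F), ∀ i ∈ s,
        W.form (b i) (∑ l ∈ s, f l • a l) = W.conj (f i) * W.sgn := by
      intro f i hi
      rw [W.form_swap, ← formLeft_apply, map_sum, map_sum, Finset.mul_sum,
        Finset.sum_eq_single_of_mem i hi]
      · rw [map_smul, formLeft_apply, smul_eq_mul, map_mul, mul_left_comm, ← form_swap,
          h2' i hi, if_pos rfl]
      · intro l _ hli
        rw [map_smul, formLeft_apply, h2 l i hi, if_neg hli, smul_zero, map_zero, mul_zero]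
    have hbc : ∀ i ∈ s, W.form (b i) c' = 0 := by
      intro i hi
      rw [hc', form_sub_right, hb_sum _ i hi, conj_conj, mul_right_comm,
        inv_mul_cancel₀ W.sgn_ne_zero, one_mul, sub_self]
    obtain ⟨t, ht⟩ := (has j).exists_add_smul (y := c') (by rw [hac, if_pos rfl]; exact one_ne_zero)
    have hbj : ∀ i ∈ s, W.form (b i) (c' + t • a j) = 0 := by
      intro i hi
      have : i ≠ j := fun h => hj (h ▸ hi)
      rw [form_add_right, hbc i hi, form_smul_right, h2' i hi, if_neg this, mul_zero, add_zero]
    have hne : ∀ i ∈ s, i ≠ j := fun i hi h => hj (h ▸ hi)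
    refine ⟨Function.update b j (c' + t • a j), ?_, ?_, ?_⟩
    · intro i hi
      rcases Finset.mem_insert.1 hi with rfl | hi
      · rwa [Function.update_self]
      · rw [Function.update_of_ne (hne i hi)]
        exact h1 i hi
    · intro l i hi
      rcases Finset.mem_insert.1 hi with rfl | hi
      · rw [Function.update_self, form_add_right, hac, form_smul_right, haf, mul_zero, add_zero]
      · rw [Function.update_of_ne (hne i hi)]
        exact h2 l i hi
    · intro i hi l hl
      rcases Finset.mem_insert.1 hi with hi | hi <;> rcases Finset.mem_insert.1 hl with hl | hl
      · rw [hi, hl, Function.update_self]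
        exact ht.form_self
      · rw [hi, Function.update_self, Function.update_of_ne (hne l hl), form_eq_zero_comm]
        exact hbj l hl
      · rw [hl, Function.update_self, Function.update_of_ne (hne i hi)]
        exact hbj i hi
      · rw [Function.update_of_ne (hne l hl), Function.update_of_ne (hne i hi)]
        exact h3 i hi l hl

theorem bddAbove_finrank_isTotallySingular [FiniteDimensional F V] (W : PolarForm F V) :
    BddAbove {d | ∃ U : Submodule F V, W.IsTotallySingular U ∧ finrank F U = d} := by
  refine ⟨finrank F V, ?_⟩
  rintro _ ⟨U, -, rfl⟩
  exact U.finrank_le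

theorem IsTotallySingular.finrank_le [FiniteDimensional F V] {U : Submodule F V}
    (h : W.IsTotallySingular U) : finrank F U ≤ W.wittIndex :=
  le_csSup W.bddAbove_finrank_isTotallySingular ⟨U, h, rfl⟩

theorem exists_finrank_eq_wittIndex [FiniteDimensional F V] (W : PolarForm F V) :
    ∃ U : Submodule F V, W.IsTotallySingular U ∧ finrank F U = W.wittIndex :=
  Nat.sSup_mem (s := {d | ∃ U : Submodule F V, W.IsTotallySingular U ∧ finrank F U = d})
    ⟨0, ⊥, isTotallySingular_bot, finrank_bot F V⟩ W.bddAbove_finrank_isTotallySingular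

theorem exists_isHyperbolic_wittIndex [FiniteDimensional F V] (W : PolarForm F V) :
    ∃ a b : Fin W.wittIndex → V, W.IsHyperbolic a b := by
  obtain ⟨U, hU, hd⟩ := W.exists_finrank_eq_wittIndex
  rw [← hd]
  let e := finBasis F U
  refine ⟨fun i => e i, exists_isHyperbolic (e.linearIndependent.map' U.subtype U.ker_subtype) ?_⟩
  refine hU.mono (Submodule.span_le.2 ?_)
  rintro _ ⟨i, rfl⟩
  exact (e i).2

/-- A totally singular subspace of dimension less than the Witt index can be enlarged. -/
theorem IsTotallySingular.exists_sing_mem_perp [FiniteDimensional F V] {X : Submodule F V}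
    (h : finrank F X < W.wittIndex) :
    ∃ v ∈ W.perp X, W.Sing v ∧ v ∉ X := by
  obtain ⟨M, hM, hd⟩ := W.exists_finrank_eq_wittIndex
  have h1 := finrank_inf_perp_comm (W := W) X M
  have h2 : finrank F ↥(X ⊓ M) ≤ finrank F ↥(X ⊓ W.perp M) :=
    Submodule.finrank_mono (inf_le_inf_left _ (isTotallySingular_iff_le_perp.1 hM).2)
  by_contra! hcon
  have h3 : M ⊓ W.perp X ≤ X ⊓ M := fun v hv => ⟨hcon v hv.2 (hM.sing hv.1), hv.1⟩
  have h4 := Submodule.finrank_mono h3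
  omega

end PolarForm

/-! ### Elimination along two flags -/

namespace PolarForm

variable {F V : Type*} [Field F] [AddCommGroup V] [Module F V]

/-- A triangular change of a family of vectors does not change the spans of its initial
segments. -/
theorem span_image_eq_of_triangular {ι : Type*} [LinearOrder ι] [WellFoundedLT ι] {x x' : ι → V}
    (h : ∀ a, ∃ t : F, t ≠ 0 ∧ x' a - t • x a ∈ Submodule.span F (x '' Set.Iio a)) {s : Set ι}
    (hs : IsLowerSet s) : Submodule.span F (x' '' s) = Submodule.span F (x '' s) := by
  have h1 : ∀ a, x' a ∈ Submodule.span F (x '' Set.Iic a) := by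
    intro a
    obtain ⟨t, -, ht⟩ := h a
    have := add_mem (Submodule.span_mono (Set.image_mono Set.Iio_subset_Iic_self) ht)
      (Submodule.smul_mem _ t (Submodule.subset_span ⟨a, Set.mem_Iic.2 le_rfl, rfl⟩))
    simpa using this
  have h2 : ∀ a, x a ∈ Submodule.span F (x' '' Set.Iic a) := by
    intro a
    induction a using WellFoundedLT.induction with
    | ind a ih =>
      obtain ⟨t, ht0, ht⟩ := h a
      have h3 : Submodule.span F (x '' Set.Iio a) ≤ Submodule.span F (x' '' Set.Iic a) := by
        rw [Submodule.span_le]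
        rintro _ ⟨b, hb, rfl⟩
        exact Submodule.span_mono (Set.image_mono (Set.Iic_subset_Iic.2 hb.le)) (ih b hb)
      have h4 := sub_mem (Submodule.subset_span ⟨a, Set.mem_Iic.2 le_rfl, rfl⟩ :
        x' a ∈ Submodule.span F (x' '' Set.Iic a)) (h3 ht)
      rw [sub_sub_cancel] at h4
      simpa [smul_smul, ht0] using Submodule.smul_mem _ t⁻¹ h4
  refine le_antisymm ?_ ?_ <;> rw [Submodule.span_le] <;> rintro _ ⟨a, ha, rfl⟩
  · exact Submodule.span_mono (Set.image_mono (hs.Iic_subset ha)) (h1 a)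
  · exact Submodule.span_mono (Set.image_mono (hs.Iic_subset ha)) (h2 a)

theorem span_image_eq_of_triangular' {ι : Type*} [LinearOrder ι] [WellFoundedGT ι] {x x' : ι → V}
    (h : ∀ a, ∃ t : F, t ≠ 0 ∧ x' a - t • x a ∈ Submodule.span F (x '' Set.Ioi a)) {s : Set ι}
    (hs : IsUpperSet s) : Submodule.span F (x' '' s) = Submodule.span F (x '' s) :=
  span_image_eq_of_triangular (ι := ιᵒᵈ) h hs.toDual

variable {W : PolarForm F V}

/-- Bruhat decomposition of the matrix `B(x i, y j)`: changing `x` and `y` without changing the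
spans of the initial segments of `x` and of the final segments of `y`, it becomes a partial
permutation matrix. -/
theorem exists_matching (W : PolarForm F V) {m n : ℕ} (x : Fin m → V) (y : Fin n → V) :
    ∃ (x' : Fin m → V) (y' : Fin n → V) (r : Fin m → Option (Fin n)),
      (∀ s, IsLowerSet s → Submodule.span F (x' '' s) = Submodule.span F (x '' s)) ∧
      (∀ s, IsUpperSet s → Submodule.span F (y' '' s) = Submodule.span F (y '' s)) ∧
      (∀ i i' j, r i = some j → r i' = some j → i = i') ∧
      ∀ i j, W.form (x' i) (y' j) = if r i = some j then 1 else 0 := by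
  suffices hp : ∀ p : ℕ, p ≤ m → ∃ (x' : Fin m → V) (y' : Fin n → V) (r : Fin m → Option (Fin n)),
      (∀ s, IsLowerSet s → Submodule.span F (x' '' s) = Submodule.span F (x '' s)) ∧
      (∀ s, IsUpperSet s → Submodule.span F (y' '' s) = Submodule.span F (y '' s)) ∧
      (∀ i i' j, r i = some j → r i' = some j → i = i') ∧
      (∀ i : Fin m, p ≤ i → r i = none) ∧
      ∀ (i : Fin m) (j : Fin n), (i : ℕ) < p →
        W.form (x' i) (y' j) = if r i = some j then 1 else 0 by
    obtain ⟨x', y', r, h1, h2, h3, -, h4⟩ := hp m le_rfl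
    exact ⟨x', y', r, h1, h2, h3, fun i j => h4 i j i.2⟩
  intro p
  induction p with
  | zero =>
    exact fun _ => ⟨x, y, fun _ => none, fun _ _ => rfl, fun _ _ => rfl, by simp, by simp, by simp⟩
  | succ p ih =>
    intro hpm
    obtain ⟨x₁, y₁, r, hx, hy, hinj, hnone, hform⟩ := ih (by omega)
    let a : Fin m := ⟨p, hpm⟩
    have hlt : ∀ i j, r i = some j → i < a := by
      intro i j hij
      by_contra hle
      rw [hnone i (not_lt.1 hle)] at hij
      cases hij
    -- clear the columns that already have a pivot
    let cf : Fin m → F := fun i => (r i).elim 0 fun j => W.form (x₁ a) (y₁ j)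
    set u := ∑ i, cf i • x₁ i with hu
    have hu_mem : u ∈ Submodule.span F (x₁ '' Set.Iio a) := by
      refine Submodule.sum_mem _ fun i _ => ?_
      rcases hri : r i with _ | j
      · simp [cf, hri]
      · exact Submodule.smul_mem _ _ (Submodule.subset_span ⟨i, hlt i j hri, rfl⟩)
    set z := x₁ a - u with hz
    have hpivot : ∀ i j, r i = some j → W.form z (y₁ j) = 0 := by
      intro i j hij
      rw [hz, form_sub_left, sub_eq_zero, hu, ← formLeft_apply _ (∑ i, cf i • x₁ i), map_sum,
        Finset.sum_eq_single_of_mem i (Finset.mem_univ i)]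
      · rw [map_smul, formLeft_apply, hform i j (hlt i j hij), if_pos hij, smul_eq_mul, mul_one]
        simp [cf, hij]
      · intro l _ hli
        rcases hrl : r l with _ | j'
        · simp [cf, hrl]
        · have : r l ≠ some j := fun h => hli (hinj _ _ _ h hij)
          rw [map_smul, formLeft_apply, hform l j (hlt l j' hrl), if_neg this, smul_zero]
    have hflag : ∀ t : F, t ≠ 0 → ∀ s, IsLowerSet s →
        Submodule.span F (Function.update x₁ a (t • z) '' s) = Submodule.span F (x '' s) := by
      intro t ht s hs
      rw [← hx s hs]
      refine span_image_eq_of_triangular (fun i => ?_) hs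
      by_cases hia : i = a
      · subst hia
        refine ⟨t, ht, ?_⟩
        rw [Function.update_self, hz, ← smul_sub, sub_sub_cancel_left]
        exact Submodule.smul_mem _ _ (Submodule.neg_mem _ hu_mem)
      · refine ⟨1, one_ne_zero, ?_⟩
        rw [Function.update_of_ne hia, one_smul, sub_self]
        exact zero_mem _
    have hcase : ∀ i : Fin m, (i : ℕ) < p + 1 → i = a ∨ (i ≠ a ∧ (i : ℕ) < p) := by
      intro i hi
      by_cases hia : i = a
      · exact Or.inl hia
      · refine Or.inr ⟨hia, ?_⟩
        have : (i : ℕ) ≠ p := fun h => hia (Fin.ext h)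
        omega
    by_cases hv : ∀ j, W.form z (y₁ j) = 0
    · refine ⟨Function.update x₁ a ((1 : F) • z), y₁, r, hflag 1 one_ne_zero, hy, hinj,
        fun i hi => hnone i (by omega), fun i j hi => ?_⟩
      rcases hcase i hi with rfl | ⟨hia, hi⟩
      · rw [Function.update_self, one_smul, hv, if_neg]
        rw [hnone a le_rfl]
        simp
      · rw [Function.update_of_ne hia, hform i j hi]
    · push Not at hv
      -- the last nonzero entry of the row is the pivot
      obtain ⟨j, hj, hjmax⟩ : ∃ j, W.form z (y₁ j) ≠ 0 ∧ ∀ b, j < b → W.form z (y₁ b) = 0 := by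
        classical
        obtain ⟨j₀, hj₀⟩ := hv
        obtain ⟨j, hj, hmax⟩ := Finset.exists_max_image
          (Finset.univ.filter fun j => W.form z (y₁ j) ≠ 0) id ⟨j₀, by simpa using hj₀⟩
        refine ⟨j, by simpa using hj, fun b hb => ?_⟩
        by_contra hb0
        exact (hmax b (by simpa using hb0)).not_gt hb
      have hrj : ∀ i, r i ≠ some j := fun i hij => hj (hpivot i j hij)
      refine ⟨Function.update x₁ a ((W.form z (y₁ j))⁻¹ • z),
        fun b => if b = j then y₁ j else
          y₁ b - W.conj (W.form z (y₁ b) / W.form z (y₁ j)) • y₁ j,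
        Function.update r a (some j), hflag _ (inv_ne_zero hj), ?_, ?_, ?_, ?_⟩
      · intro s hs
        rw [← hy s hs]
        refine span_image_eq_of_triangular' (fun b => ⟨1, one_ne_zero, ?_⟩) hs
        simp only [one_smul]
        split_ifs with hbj
        · simp [hbj]
        · rw [sub_sub_cancel_left]
          refine Submodule.neg_mem _ ?_
          rcases lt_or_gt_of_ne hbj with hlt | hgt
          · exact Submodule.smul_mem _ _ (Submodule.subset_span ⟨j, hlt, rfl⟩)
          · simp [hjmax b hgt]
      · intro i i' b hi hi'
        by_cases hia : i = a <;> by_cases hia' : i' = a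
        · rw [hia, hia']
        · rw [hia, Function.update_self, Option.some_inj] at hi
          rw [Function.update_of_ne hia', ← hi] at hi'
          exact absurd hi' (hrj i')
        · rw [hia', Function.update_self, Option.some_inj] at hi'
          rw [Function.update_of_ne hia, ← hi'] at hi
          exact absurd hi (hrj i)
        · rw [Function.update_of_ne hia] at hi
          rw [Function.update_of_ne hia'] at hi'
          exact hinj _ _ _ hi hi'
      · intro i hi
        rw [Function.update_of_ne]
        · exact hnone i (by omega)
        · rintro rfl
          simp [a] at hi
      · intro i b hi
        beta_reduce
        rcases hcase i hi with rfl | ⟨hia, hi⟩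
        · rw [Function.update_self, Function.update_self, form_smul_left]
          by_cases hbj : b = j
          · simp [hbj, hj]
          · rw [if_neg hbj, if_neg (by simpa using Ne.symm hbj), form_sub_right, form_smul_right,
              conj_conj, div_mul_cancel₀ _ hj, sub_self, mul_zero]
        · rw [Function.update_of_ne hia, Function.update_of_ne hia]
          by_cases hbj : b = j
          · rw [if_pos hbj, hbj, hform i j hi]
          · rw [if_neg hbj, form_sub_right, form_smul_right, hform i b hi, hform i j hi,
              if_neg (hrj i), mul_zero, sub_zero]

/-! ### Bases adapted to a sequence of subspaces -/

theorem finrank_inf_add_finrank_inf_le [FiniteDimensional F V] (A B Z : Submodule F V) :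
    finrank F ↥(A ⊓ Z) + finrank F ↥(Z ⊓ B) ≤ finrank F Z + finrank F ↥(A ⊓ Z ⊓ B) := by
  have h1 := Submodule.finrank_sup_add_finrank_inf_eq (A ⊓ Z) (Z ⊓ B)
  have h2 : finrank F ↥((A ⊓ Z) ⊔ (Z ⊓ B)) ≤ finrank F Z :=
    Submodule.finrank_mono (sup_le inf_le_right inf_le_left)
  have h3 : (A ⊓ Z) ⊓ (Z ⊓ B) = A ⊓ Z ⊓ B := by
    rw [inf_assoc, ← inf_assoc Z Z B, inf_idem, inf_assoc]
  rw [h3] at h1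
  omega

/-- `X 0, …, X m` is a sequence of `k`-subspaces, consecutive ones meeting in at least a
hyperplane, such that `X 0 ⊓ X m` has the least possible dimension `k - m`. -/
structure IsFlagPath (X : ℕ → Submodule F V) (k m : ℕ) : Prop where
  finrank_eq : ∀ i ≤ m, finrank F (X i) = k
  step : ∀ i < m, k ≤ finrank F ↥(X i ⊓ X (i + 1)) + 1
  ends : finrank F ↥(X 0 ⊓ X m) + m ≤ k

namespace IsFlagPath

variable {X : ℕ → Submodule F V} {k m : ℕ}

theorem reverse (h : IsFlagPath X k m) : IsFlagPath (fun i => X (m - i)) k m where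
  finrank_eq i _ := h.finrank_eq _ (by omega)
  step i hi := by
    have := h.step (m - (i + 1)) (by omega)
    rw [show m - (i + 1) + 1 = m - i by omega] at this
    rwa [inf_comm]
  ends := by
    rw [Nat.sub_zero, Nat.sub_self, inf_comm]
    exact h.ends

variable [FiniteDimensional F V]

theorem le_finrank_inf (h : IsFlagPath X k m) {a b : ℕ} (hab : a ≤ b) (hb : b ≤ m) :
    k ≤ finrank F ↥(X a ⊓ X b) + (b - a) := by
  induction b, hab using Nat.le_induction with
  | base => rw [inf_idem, h.finrank_eq a hb]; omega
  | succ b hab ih =>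
    have h1 := ih (by omega)
    have h2 := h.step b (by omega)
    have h3 := finrank_inf_add_finrank_inf_le (X a) (X (b + 1)) (X b)
    rw [h.finrank_eq b (by omega)] at h3
    have h4 : finrank F ↥(X a ⊓ X b ⊓ X (b + 1)) ≤ finrank F ↥(X a ⊓ X (b + 1)) :=
      Submodule.finrank_mono (inf_le_inf_right _ inf_le_left)
    omega

theorem finrank_inf (h : IsFlagPath X k m) {a b : ℕ} (hab : a ≤ b) (hb : b ≤ m) :
    finrank F ↥(X a ⊓ X b) + (b - a) = k := by
  refine le_antisymm ?_ (h.le_finrank_inf hab hb)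
  have h1 := h.le_finrank_inf (Nat.zero_le a) (hab.trans hb)
  have h2 := h.le_finrank_inf hb le_rfl
  have h3 := finrank_inf_add_finrank_inf_le (X 0) (X b) (X a)
  have h4 := finrank_inf_add_finrank_inf_le (X 0) (X m) (X b)
  rw [h.finrank_eq a (hab.trans hb)] at h3
  rw [h.finrank_eq b hb] at h4
  have h5 : finrank F ↥(X 0 ⊓ X a ⊓ X b) ≤ finrank F ↥(X 0 ⊓ X b) :=
    Submodule.finrank_mono (inf_le_inf_right _ inf_le_left)
  have h6 : finrank F ↥(X 0 ⊓ X b ⊓ X m) ≤ finrank F ↥(X 0 ⊓ X m) :=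
    Submodule.finrank_mono (inf_le_inf_right _ inf_le_left)
  have h7 := h.ends
  omega

theorem inf_le (h : IsFlagPath X k m) {a i b : ℕ} (hai : a ≤ i) (hib : i ≤ b) (hb : b ≤ m) :
    X a ⊓ X b ≤ X i := by
  have h1 := h.finrank_inf hai (hib.trans hb)
  have h2 := h.finrank_inf hib hb
  have h3 := h.finrank_inf (hai.trans hib) hb
  have h4 := finrank_inf_add_finrank_inf_le (X a) (X b) (X i)
  rw [h.finrank_eq i (hib.trans hb)] at h4
  have h5 : X a ⊓ X i ⊓ X b = X a ⊓ X b :=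
    Submodule.eq_of_le_of_finrank_le (inf_le_inf_right _ inf_le_left) (by omega)
  rw [← h5]
  exact inf_le_left.trans inf_le_right

/-- The traces `X 0 ⊓ X i` form a flag of `X 0`, and `x` is a basis of it over `X 0 ⊓ X m`. -/
theorem exists_half_basis (h : IsFlagPath X k m) : ∃ x : Fin m → V, ∀ i ≤ m,
    Submodule.span F (x '' {j | (j : ℕ) + i < m}) ⊔ (X 0 ⊓ X m) = X 0 ⊓ X i := by
  have hex : ∀ j : Fin m, ∃ v, v ∈ X 0 ⊓ X (m - 1 - j) ∧ v ∉ X (m - j) := by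
    intro j
    have h1 := h.finrank_inf (Nat.zero_le (m - 1 - j)) (by omega)
    have h2 := h.finrank_inf (Nat.zero_le (m - j)) (by omega)
    by_contra! hcon
    have h3 := Submodule.finrank_mono
      (show X 0 ⊓ X (m - 1 - j) ≤ X 0 ⊓ X (m - j) from fun v hv => ⟨hv.1, hcon v hv⟩)
    omega
  choose x hx hx' using hex
  refine ⟨x, fun i hi => ?_⟩
  have hle : ∀ i ≤ m,
      Submodule.span F (x '' {j | (j : ℕ) + i < m}) ⊔ (X 0 ⊓ X m) ≤ X 0 ⊓ X i := by
    intro i hi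
    refine sup_le ?_ (le_inf inf_le_left (h.inf_le (Nat.zero_le i) hi le_rfl))
    rw [Submodule.span_le]
    rintro _ ⟨j, hj, rfl⟩
    refine ⟨(hx j).1, ?_⟩
    have hj' : (j : ℕ) + i < m := hj
    exact h.inf_le (Nat.zero_le i) (by omega) (by omega) (hx j)
  refine Submodule.eq_of_le_of_finrank_le (hle i hi) ?_
  induction hd : m - i generalizing i with
  | zero =>
    obtain rfl : i = m := by omega
    exact Submodule.finrank_mono le_sup_right
  | succ d ih =>
    replace ih := ih (i + 1) (by omega) (by omega)
    let j : Fin m := ⟨m - 1 - i, by omega⟩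
    have h1 := h.finrank_inf (Nat.zero_le i) (by omega)
    have h2 := h.finrank_inf (Nat.zero_le (i + 1)) (by omega)
    have h3 : Submodule.span F (x '' {j | (j : ℕ) + (i + 1) < m}) ⊔ (X 0 ⊓ X m) <
        Submodule.span F (x '' {j | (j : ℕ) + i < m}) ⊔ (X 0 ⊓ X m) := by
      have hsub : {j : Fin m | (j : ℕ) + (i + 1) < m} ⊆ {j : Fin m | (j : ℕ) + i < m} := by
        intro l hl
        simp only [Set.mem_ofPred_eq] at hl ⊢
        omega
      have hsub' := Submodule.span_mono (R := F) (Set.image_mono (f := x) hsub)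
      refine lt_of_le_of_ne (sup_le_sup_right hsub' (X 0 ⊓ X m)) fun heq => ?_
      have h4 : x j ∈ Submodule.span F (x '' {j | (j : ℕ) + i < m}) ⊔ (X 0 ⊓ X m) :=
        Submodule.mem_sup_left (Submodule.subset_span
          ⟨j, (by simp only [Set.mem_ofPred_eq, j]; omega), rfl⟩)
      rw [← heq] at h4
      have h5 := (hle (i + 1) (by omega) h4).2
      refine hx' j ?_
      rwa [show m - (j : ℕ) = i + 1 by simp only [j]; omega]
    have h4 := Submodule.finrank_lt_finrank_of_lt h3
    omega

/-- A basis of `X 0 ⊔ X m` adapted to all the `X i`. -/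
theorem exists_basis (h : IsFlagPath X k m) : ∃ (x y : Fin m → V) (w : Fin (k - m) → V),
    LinearIndependent F (Sum.elim (Sum.elim x y) w) ∧ ∀ i ≤ m, X i = Submodule.span F
      (x '' {j | (j : ℕ) + i < m} ∪ y '' {j | m ≤ (j : ℕ) + i} ∪ Set.range w) := by
  obtain ⟨x, hx⟩ := h.exists_half_basis
  obtain ⟨y', hy'⟩ := h.reverse.exists_half_basis
  have hends := h.finrank_inf (Nat.zero_le m) le_rfl
  have hC : finrank F ↥(X 0 ⊓ X m) = k - m := by omega
  let e := finBasisOfFinrankEq F ↥(X 0 ⊓ X m) hC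
  let w : Fin (k - m) → V := fun i => e i
  have hw : Submodule.span F (Set.range w) = X 0 ⊓ X m := by
    have : Set.range w = (X 0 ⊓ X m).subtype '' Set.range e := by
      rw [← Set.range_comp]; rfl
    rw [this, Submodule.span_image, e.span_eq, Submodule.map_top, Submodule.range_subtype]
  let y : Fin m → V := fun j => y' j.rev
  have hy : ∀ i ≤ m, Submodule.span F (y '' {j | m ≤ (j : ℕ) + i}) ⊔ (X 0 ⊓ X m) = X i ⊓ X m := by
    intro i hi
    have h1 := hy' (m - i) (by omega)
    simp only [Nat.sub_self, Nat.sub_zero, Nat.sub_sub_self hi] at h1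
    rw [inf_comm (X i), ← h1, inf_comm (X 0)]
    congr 2
    ext v
    constructor
    · rintro ⟨j, hj, rfl⟩
      refine ⟨j.rev, ?_, rfl⟩
      simp only [Set.mem_ofPred_eq, Fin.val_rev] at hj ⊢
      omega
    · rintro ⟨j, hj, rfl⟩
      refine ⟨j.rev, ?_, by simp [y]⟩
      simp only [Set.mem_ofPred_eq, Fin.val_rev] at hj ⊢
      omega
  have hspan : ∀ s t : Set (Fin m), Submodule.span F (x '' s ∪ y '' t ∪ Set.range w) =
      (Submodule.span F (x '' s) ⊔ (X 0 ⊓ X m)) ⊔ (Submodule.span F (y '' t) ⊔ (X 0 ⊓ X m)) := by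
    intro s t
    rw [Submodule.span_union, Submodule.span_union, hw, sup_sup_sup_comm, sup_idem]
  refine ⟨x, y, w, ?_, fun i hi => ?_⟩
  · rw [linearIndependent_iff_card_eq_finrank_span, Set.finrank, Set.Sum.elim_range,
      Set.Sum.elim_range, ← Set.image_univ, ← Set.image_univ (f := y), hspan]
    have h1 := hx 0 (Nat.zero_le m)
    have h2 := hy m le_rfl
    have h3 : {j : Fin m | (j : ℕ) + 0 < m} = Set.univ := by ext j; simp
    have h4 : {j : Fin m | m ≤ (j : ℕ) + m} = Set.univ := by ext j; simp
    rw [h3, inf_idem] at h1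
    rw [h4, inf_idem] at h2
    rw [h1, h2]
    have h5 := Submodule.finrank_sup_add_finrank_inf_eq (X 0) (X m)
    rw [h.finrank_eq 0 (Nat.zero_le m), h.finrank_eq m le_rfl] at h5
    simp only [Fintype.card_sum, Fintype.card_fin]
    omega
  · rw [hspan, hx i hi, hy i hi]
    symm
    refine Submodule.eq_of_le_of_finrank_le (sup_le inf_le_right inf_le_left) ?_
    have h1 := Submodule.finrank_sup_add_finrank_inf_eq (X 0 ⊓ X i) (X i ⊓ X m)
    have h2 := h.finrank_inf (Nat.zero_le i) hi
    have h3 := h.finrank_inf hi le_rfl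
    have h4 : finrank F ↥((X 0 ⊓ X i) ⊓ (X i ⊓ X m)) ≤ finrank F ↥(X 0 ⊓ X m) :=
      Submodule.finrank_mono (inf_le_inf inf_le_left inf_le_right)
    rw [h.finrank_eq i hi]
    omega

end IsFlagPath

end PolarForm

/-! ### Distances in polar Grassmann graphs -/

namespace PolarForm

variable {F V : Type*} [Field F] [AddCommGroup V] [Module F V]

theorem inf_sup_span_singleton {H X : Submodule F V} (hH : H ≤ X) {v : V} (hv : v ∉ X) :
    X ⊓ (H ⊔ Submodule.span F {v}) = H := by
  have h := Submodule.disjoint_span_singleton_of_notMem hv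
  rw [inf_comm, sup_inf_assoc_of_le _ hH, h.symm.eq_bot, sup_bot_eq]

variable {W : PolarForm F V} {k : ℕ}

theorem opposite_iff {X Y : W.SingularSubspace k} :
    W.Opposite X.1 Y.1 ↔ X ≠ Y ∧ Y.1 ⊓ W.perp X.1 ≤ X.1 := by
  unfold Opposite
  refine and_congr (not_congr Subtype.ext_iff.symm) ⟨fun h y hy => ?_, fun h y hy hyX => ?_⟩
  · by_contra hyX
    obtain ⟨x, hx, -, hxy⟩ := h y hy.1 hyX
    exact hxy (mem_perp'.1 hy.2 x hx)
  · by_contra! hcon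
    refine hyX (h ⟨hy, mem_perp'.2 fun x hx => ?_⟩)
    by_cases hxY : x ∈ Y.1
    · exact Y.2.1.form_eq_zero hxY hy
    · exact hcon x hx hxY

theorem not_opposite_iff {X Y : W.SingularSubspace k} :
    ¬ W.Opposite X.1 Y.1 ↔ X = Y ∨ ∃ y ∈ Y.1, y ∈ W.perp X.1 ∧ y ∉ X.1 := by
  rw [opposite_iff, not_and_or, not_not, SetLike.not_le_iff_exists]
  simp only [Submodule.mem_inf, and_assoc]

theorem inf_le_inf_perp (X Y : W.SingularSubspace k) : X.1 ⊓ Y.1 ≤ Y.1 ⊓ W.perp X.1 :=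
  le_inf inf_le_right (inf_le_left.trans (isTotallySingular_iff_le_perp.1 X.2.1).2)

theorem IsTotallySingular.sup_span_singleton {H : Submodule F V} (hH : W.IsTotallySingular H)
    {v : V} (hv : W.Sing v) (hvH : v ∈ W.perp H) :
    W.IsTotallySingular (H ⊔ Submodule.span F {v}) :=
  isTotallySingular_sup_iff.2 ⟨hH, isTotallySingular_span_singleton hv,
    le_perp_comm.1 (by simpa using hvH)⟩

theorem adj_iff_of_eq (hk : k = W.wittIndex) {X Y : W.SingularSubspace k} :
    (W.polarGrassmannGraph k).Adj X Y ↔ finrank F ↥(X.1 ⊓ Y.1) + 1 = k := by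
  simp only [polarGrassmannGraph]
  exact ⟨fun h => h.elim (fun h => h.2) fun h => absurd hk h.1.ne, fun h => Or.inl ⟨hk, h⟩⟩

variable [FiniteDimensional F V]

theorem exists_hyperplane {A X : Submodule F V} (hAX : A ≤ X) {v : V} (hv : v ∈ X) (hvA : v ∉ A) :
    ∃ H, A ≤ H ∧ H ≤ X ∧ v ∉ H ∧ finrank F H + 1 = finrank F X := by
  obtain ⟨f, hf1, hf⟩ := Submodule.exists_le_ker_of_notMem hvA
  have hvH : v ∉ X ⊓ LinearMap.ker f := fun h => hf1 h.2
  refine ⟨X ⊓ LinearMap.ker f, le_inf hAX hf, inf_le_left, hvH, ?_⟩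
  have hsup : X ⊓ LinearMap.ker f ⊔ Submodule.span F {v} = X := by
    refine le_antisymm (sup_le inf_le_left ((Submodule.span_singleton_le_iff_mem _ _).2 hv))
      fun x hx => ?_
    have h1 : x - (f x / f v) • v ∈ X ⊓ LinearMap.ker f := by
      refine Submodule.mem_inf.2 ⟨sub_mem hx (X.smul_mem _ hv), ?_⟩
      rw [LinearMap.mem_ker, map_sub, map_smul, smul_eq_mul, div_mul_cancel₀ _ hf1, sub_self]
    have h2 := add_mem (Submodule.mem_sup_left h1) (Submodule.mem_sup_right
      (Submodule.smul_mem _ (f x / f v) (Submodule.mem_span_singleton_self v)))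
    rwa [sub_add_cancel] at h2
  rw [← Submodule.finrank_sup_span_singleton hvH, hsup]

theorem exists_mem_notMem_of_finrank_lt {A X : Submodule F V} (h : finrank F A < finrank F X) :
    ∃ v ∈ X, v ∉ A := by
  by_contra! hcon
  exact absurd (Submodule.finrank_mono (show X ≤ A from hcon)) (by omega)

theorem opposite_iff_finrank {X Y : W.SingularSubspace k} :
    W.Opposite X.1 Y.1 ↔ X ≠ Y ∧ finrank F ↥(Y.1 ⊓ W.perp X.1) = finrank F ↥(X.1 ⊓ Y.1) := by
  rw [opposite_iff]
  refine and_congr_right fun _ => ⟨fun h => ?_, fun h => ?_⟩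
  · rw [le_antisymm (le_inf h inf_le_left) (inf_le_inf_perp X Y)]
  · rw [← Submodule.eq_of_le_of_finrank_eq (inf_le_inf_perp X Y) h.symm]
    exact inf_le_left

theorem finrank_inf_perp_comm' (X Y : W.SingularSubspace k) :
    finrank F ↥(Y.1 ⊓ W.perp X.1) = finrank F ↥(X.1 ⊓ W.perp Y.1) := by
  have h := finrank_inf_perp_comm (W := W) X.1 Y.1
  rw [X.2.2, Y.2.2] at h
  omega

theorem opposite_comm {X Y : W.SingularSubspace k} :
    W.Opposite X.1 Y.1 ↔ W.Opposite Y.1 X.1 := by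
  rw [opposite_iff_finrank, opposite_iff_finrank, ne_comm, finrank_inf_perp_comm',
    inf_comm X.1 Y.1]

/-- The vertex spanned by a hyperplane `H` of a vertex `X` and a further singular vector `v`. -/
theorem exists_vertex {X : W.SingularSubspace k} {H : Submodule F V} (hH : H ≤ X.1)
    (hHk : finrank F H + 1 = k) {v : V} (hv : W.Sing v) (hvH : v ∈ W.perp H) (hvX : v ∉ X.1) :
    ∃ Z : W.SingularSubspace k, Z.1 = H ⊔ Submodule.span F {v} ∧ X.1 ⊓ Z.1 = H :=
  ⟨⟨H ⊔ Submodule.span F {v}, (X.2.1.mono hH).sup_span_singleton hv hvH,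
    (Submodule.finrank_sup_span_singleton fun h => hvX (hH h)).trans hHk⟩, rfl,
    inf_sup_span_singleton hH hvX⟩

theorem adj_iff (hk : k < W.wittIndex) {X Y : W.SingularSubspace k} :
    (W.polarGrassmannGraph k).Adj X Y ↔
      finrank F ↥(X.1 ⊓ Y.1) + 1 = k ∧ X.1 ≤ W.perp Y.1 := by
  have h := Submodule.finrank_sup_add_finrank_inf_eq X.1 Y.1
  rw [X.2.2, Y.2.2] at h
  simp only [polarGrassmannGraph, hk.ne, hk, isTotallySingular_sup_iff, X.2.1, Y.2.1, false_and,
    true_and, false_or]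
  constructor
  · rintro ⟨h1, h2⟩
    exact ⟨by omega, h1⟩
  · rintro ⟨h1, h2⟩
    exact ⟨h2, by omega⟩

theorem Adj.finrank_inf {X Y : W.SingularSubspace k} (h : (W.polarGrassmannGraph k).Adj X Y) :
    finrank F ↥(X.1 ⊓ Y.1) + 1 = k := by
  rcases h with h | h
  · exact h.2
  · have h1 := Submodule.finrank_sup_add_finrank_inf_eq X.1 Y.1
    rw [X.2.2, Y.2.2] at h1
    omega

theorem le_finrank_inf_add_length {X Y : W.SingularSubspace k}
    (p : (W.polarGrassmannGraph k).Walk X Y) : k ≤ finrank F ↥(X.1 ⊓ Y.1) + p.length := by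
  induction p with
  | @nil X => rw [inf_idem, X.2.2]; omega
  | @cons X Z Y hXZ p ih =>
    have h1 := Adj.finrank_inf hXZ
    have h2 := finrank_inf_add_finrank_inf_le X.1 Y.1 Z.1
    rw [Z.2.2] at h2
    have h4 : finrank F ↥(X.1 ⊓ Z.1 ⊓ Y.1) ≤ finrank F ↥(X.1 ⊓ Y.1) :=
      Submodule.finrank_mono (inf_le_inf_right _ inf_le_left)
    rw [SimpleGraph.Walk.length_cons]
    omega

/-- A neighbour of `X` contains no vector of an opposite vertex `Y` outside of `X`. -/
theorem Opposite.inf_le_of_adj (hk : k < W.wittIndex) {X Y Z : W.SingularSubspace k}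
    (h : W.Opposite X.1 Y.1) (hXZ : (W.polarGrassmannGraph k).Adj X Z) : Z.1 ⊓ Y.1 ≤ X.1 :=
  fun _ hz => (opposite_iff.1 h).2 ⟨hz.2, le_perp_comm.1 ((adj_iff hk).1 hXZ).2 hz.1⟩

theorem Opposite.lt_finrank_inf_add_length (hk : k < W.wittIndex) {X Y : W.SingularSubspace k}
    (h : W.Opposite X.1 Y.1) (p : (W.polarGrassmannGraph k).Walk X Y) :
    k < finrank F ↥(X.1 ⊓ Y.1) + p.length := by
  cases p with
  | nil => exact absurd rfl h.1
  | @cons X Z Y hXZ p =>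
    have h1 := le_finrank_inf_add_length p
    have h2 : finrank F ↥(Z.1 ⊓ Y.1) ≤ finrank F ↥(X.1 ⊓ Y.1) :=
      Submodule.finrank_mono (le_inf (h.inf_le_of_adj hk hXZ) inf_le_right)
    rw [SimpleGraph.Walk.length_cons]
    omega

theorem exists_adj_vertex (hk : k < W.wittIndex) {X : W.SingularSubspace k} {H : Submodule F V}
    (hH : H ≤ X.1) (hHk : finrank F H + 1 = k) {v : V} (hv : W.Sing v) (hvX : v ∈ W.perp X.1)
    (hvX' : v ∉ X.1) :
    ∃ Z : W.SingularSubspace k, Z.1 = H ⊔ Submodule.span F {v} ∧ X.1 ⊓ Z.1 = H ∧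
      (W.polarGrassmannGraph k).Adj X Z := by
  obtain ⟨Z, hZ, hXZ⟩ := exists_vertex hH hHk hv (perp_anti hH hvX) hvX'
  refine ⟨Z, hZ, hXZ, (adj_iff hk).2 ⟨by rwa [hXZ], ?_⟩⟩
  rw [hZ, perp_sup]
  refine le_inf ((isTotallySingular_iff_le_perp.1 X.2.1).2.trans (perp_anti hH))
    (le_perp_comm.1 (by simpa using hvX))

theorem eq_of_le_finrank_inf {X Y : W.SingularSubspace k} (h : k ≤ finrank F ↥(X.1 ⊓ Y.1)) :
    X = Y := by
  have h1 := Submodule.eq_of_le_of_finrank_le (inf_le_left : X.1 ⊓ Y.1 ≤ X.1) (by rwa [X.2.2])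
  have h2 := Submodule.eq_of_le_of_finrank_le (inf_le_right : X.1 ⊓ Y.1 ≤ Y.1) (by rwa [Y.2.2])
  exact Subtype.ext (h1.symm.trans h2)

theorem finrank_inf_lt {X Y : W.SingularSubspace k} (h : X ≠ Y) : finrank F ↥(X.1 ⊓ Y.1) < k := by
  by_contra hcon
  exact h (eq_of_le_finrank_inf (not_lt.1 hcon))

/-- A vector `y` of `Y` orthogonal to `X` replaces a vector of `X`; by keeping in `X` a vector
orthogonal to `Y`, the new vertex is again not opposite to `Y`. -/
theorem exists_walk_of_not_opposite (hk : k < W.wittIndex) {X Y : W.SingularSubspace k}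
    (h : ¬ W.Opposite X.1 Y.1) (n : ℕ) (hn : k ≤ finrank F ↥(X.1 ⊓ Y.1) + n) :
    ∃ p : (W.polarGrassmannGraph k).Walk X Y, p.length ≤ n := by
  induction n generalizing X with
  | zero =>
    obtain rfl := eq_of_le_finrank_inf hn
    exact ⟨SimpleGraph.Walk.nil, le_rfl⟩
  | succ n ih =>
    rcases eq_or_ne X Y with rfl | hXY
    · exact ⟨SimpleGraph.Walk.nil, Nat.zero_le _⟩
    obtain ⟨y, hyY, hyp, hyX⟩ := (not_opposite_iff.1 h).resolve_left hXY
    obtain ⟨x, hxX, hxp, hxY⟩ :=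
      (not_opposite_iff.1 (mt opposite_comm.2 h)).resolve_left hXY.symm
    have hlt := finrank_inf_lt hXY
    -- `A` is `X ⊓ Y` together with `x` if there is enough room
    obtain ⟨H, hAH, hHX, hHk, hxH⟩ : ∃ H, X.1 ⊓ Y.1 ≤ H ∧ H ≤ X.1 ∧ finrank F H + 1 = k ∧
        (x ∈ H ∨ finrank F ↥(X.1 ⊓ Y.1) + 1 = k) := by
      by_cases hc : finrank F ↥(X.1 ⊓ Y.1) + 1 = k
      · exact ⟨_, le_rfl, inf_le_left, hc, Or.inr hc⟩
      · have hxA : x ∉ X.1 ⊓ Y.1 := fun h => hxY h.2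
        obtain ⟨v, hv, hvA⟩ := exists_mem_notMem_of_finrank_lt
          (A := X.1 ⊓ Y.1 ⊔ Submodule.span F {x}) (X := X.1) (by
            rw [Submodule.finrank_sup_span_singleton hxA, X.2.2]; omega)
        obtain ⟨H, h1, h2, -, h3⟩ := exists_hyperplane (A := X.1 ⊓ Y.1 ⊔ Submodule.span F {x})
          (sup_le inf_le_left (by simpa using hxX)) hv hvA
        rw [X.2.2] at h3
        exact ⟨H, le_sup_left.trans h1, h2, h3, Or.inl (h1 (Submodule.mem_sup_right
          (Submodule.mem_span_singleton_self x)))⟩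
    obtain ⟨Z, hZ, hXZ, hadj⟩ := exists_adj_vertex hk hHX hHk (Y.2.1.sing hyY) hyp hyX
    have hle : X.1 ⊓ Y.1 ⊔ Submodule.span F {y} ≤ Z.1 ⊓ Y.1 := by
      rw [hZ]
      exact le_inf (sup_le_sup_right hAH _) (sup_le inf_le_right (by simpa using hyY))
    have hle' := Submodule.finrank_mono hle
    rw [Submodule.finrank_sup_span_singleton fun h : y ∈ X.1 ⊓ Y.1 => hyX h.1] at hle'
    have hZY : ¬ W.Opposite Z.1 Y.1 := by
      rcases hxH with hxH | hc
      · refine mt opposite_comm.1 (not_opposite_iff.2 (Or.inr ⟨x, ?_, hxp, hxY⟩))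
        rw [hZ]
        exact Submodule.mem_sup_left hxH
      · exact not_opposite_iff.2 (Or.inl (eq_of_le_finrank_inf (by omega)))
    obtain ⟨p, hp⟩ := ih hZY (by omega)
    exact ⟨SimpleGraph.Walk.cons hadj p, by rw [SimpleGraph.Walk.length_cons]; omega⟩

/-- If `H` is a hyperplane of `X` orthogonal to a vector `y` of the opposite vertex `Y`, then
`H` and a further vector `v` orthogonal to `X` and `y` span a neighbour of `X` that is not
opposite to `Y`. -/
theorem Opposite.exists_adj_not_opposite (hk : k < W.wittIndex) {X Y : W.SingularSubspace k}
    (h : W.Opposite X.1 Y.1) {H : Submodule F V} (hXYH : X.1 ⊓ Y.1 ≤ H) (hHX : H ≤ X.1)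
    (hHk : finrank F H + 1 = k) {y v : V} (hyY : y ∈ Y.1) (hyX : y ∉ X.1) (hyH : y ∈ W.perp H)
    (hv : W.Sing v) (hvX : v ∈ W.perp X.1) (hvX' : v ∉ X.1) (hyv : W.form y v = 0) :
    ∃ Z : W.SingularSubspace k, Z.1 = H ⊔ Submodule.span F {v} ∧ X.1 ⊓ Z.1 = H ∧
      (W.polarGrassmannGraph k).Adj X Z ∧ ¬ W.Opposite Z.1 Y.1 ∧ Z.1 ⊓ Y.1 = X.1 ⊓ Y.1 := by
  obtain ⟨Z, hZ, hXZ, hadj⟩ := exists_adj_vertex hk hHX hHk hv hvX hvX'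
  have hle := h.inf_le_of_adj hk hadj
  refine ⟨Z, hZ, hXZ, hadj, not_opposite_iff.2
    (Or.inr ⟨y, hyY, ?_, fun hyZ => hyX (hle ⟨hyZ, hyY⟩)⟩),
    le_antisymm (le_inf hle inf_le_right) (le_inf ?_ inf_le_right)⟩
  · rw [hZ, perp_sup]
    refine ⟨hyH, mem_perp_span.2 ?_⟩
    simpa using hyv
  · rw [hZ]
    exact hXYH.trans le_sup_left

theorem Opposite.exists_hyperplane {X Y : W.SingularSubspace k} (h : W.Opposite X.1 Y.1) :
    ∃ H, X.1 ⊓ Y.1 ≤ H ∧ H ≤ X.1 ∧ finrank F H + 1 = k ∧ ∃ y ∈ Y.1, y ∉ X.1 ∧ y ∈ W.perp H := by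
  have hlt := finrank_inf_lt (opposite_iff.1 h).1
  obtain ⟨x, hx, hxY⟩ := exists_mem_notMem_of_finrank_lt (A := X.1 ⊓ Y.1) (X := X.1)
    (by rwa [X.2.2])
  obtain ⟨H, h1, h2, -, h3⟩ := PolarForm.exists_hyperplane inf_le_left hx hxY
  rw [X.2.2] at h3
  refine ⟨H, h1, h2, h3, ?_⟩
  have h4 := finrank_inf_perp_comm (W := W) H Y.1
  have h5 : finrank F ↥(X.1 ⊓ Y.1) ≤ finrank F ↥(H ⊓ W.perp Y.1) :=
    Submodule.finrank_mono (le_inf h1 (inf_le_right.trans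
      (isTotallySingular_iff_le_perp.1 Y.2.1).2))
  rw [Y.2.2] at h4
  obtain ⟨y, hy, hyX⟩ := exists_mem_notMem_of_finrank_lt (A := X.1 ⊓ Y.1) (X := Y.1 ⊓ W.perp H)
    (by omega)
  exact ⟨y, hy.1, fun h => hyX ⟨h, hy.1⟩, hy.2⟩

/-- There is a singular vector orthogonal to `X` and `y` outside of `X`. -/
theorem Opposite.exists_sing_mem_perp (hk : k < W.wittIndex) {X Y : W.SingularSubspace k}
    (h : W.Opposite X.1 Y.1) {y : V} (hyY : y ∈ Y.1) (hyX : y ∉ X.1) :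
    ∃ v ∈ W.perp X.1, W.Sing v ∧ v ∉ X.1 ∧ W.form y v = 0 := by
  obtain ⟨v, hv, hvs, hvX⟩ := IsTotallySingular.exists_sing_mem_perp (W := W) (X := X.1)
    (by rwa [X.2.2])
  obtain ⟨x, hx, -, hxy⟩ := h.2 y hyY hyX
  have hXX := (isTotallySingular_iff_le_perp.1 X.2.1).2
  have hyx : W.form y x ≠ 0 := fun h0 => hxy (W.form_eq_zero_comm.1 h0)
  let t := W.conj (-(W.form y v) / W.form y x)
  refine ⟨v + t • x, add_mem hv (Submodule.smul_mem _ _ (hXX hx)), hvs.add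
    ((X.2.1.sing hx).smul t) (by rw [form_smul_right, hv x hx, mul_zero]), fun hmem => hvX ?_, ?_⟩
  · simpa using sub_mem hmem (Submodule.smul_mem _ t hx)
  · rw [form_add_right, form_smul_right, conj_conj, div_mul_cancel₀ _ hyx, add_neg_cancel]

/-- One step that keeps the intersection with `Y` leads to a vertex not opposite to `Y`. -/
theorem Opposite.exists_walk (hk : k < W.wittIndex) {X Y : W.SingularSubspace k}
    (h : W.Opposite X.1 Y.1) (n : ℕ) (hn : k ≤ finrank F ↥(X.1 ⊓ Y.1) + n) :
    ∃ p : (W.polarGrassmannGraph k).Walk X Y, p.length ≤ n + 1 := by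
  obtain ⟨H, h1, h2, h3, y, hyY, hyX, hyH⟩ := h.exists_hyperplane
  obtain ⟨v, hv, hvs, hvX, hyv⟩ := h.exists_sing_mem_perp hk hyY hyX
  obtain ⟨Z, -, -, hadj, hZY, hinf⟩ :=
    h.exists_adj_not_opposite hk h1 h2 h3 hyY hyX hyH hvs hv hvX hyv
  obtain ⟨p, hp⟩ := exists_walk_of_not_opposite hk hZY n (by rwa [hinf])
  exact ⟨SimpleGraph.Walk.cons hadj p, by rw [SimpleGraph.Walk.length_cons]; omega⟩

theorem dist_of_not_opposite (hk : k < W.wittIndex) {X Y : W.SingularSubspace k}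
    (h : ¬ W.Opposite X.1 Y.1) :
    finrank F ↥(X.1 ⊓ Y.1) + (W.polarGrassmannGraph k).dist X Y = k := by
  have h0 : finrank F ↥(X.1 ⊓ Y.1) ≤ k := (Submodule.finrank_mono inf_le_left).trans_eq X.2.2
  obtain ⟨p, hp⟩ := exists_walk_of_not_opposite hk h (k - finrank F ↥(X.1 ⊓ Y.1)) (by omega)
  obtain ⟨q, hq⟩ := p.reachable.exists_walk_length_eq_dist
  have h1 := le_finrank_inf_add_length q
  have h2 := SimpleGraph.dist_le p
  omega

theorem Opposite.dist_eq (hk : k < W.wittIndex) {X Y : W.SingularSubspace k}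
    (h : W.Opposite X.1 Y.1) :
    finrank F ↥(X.1 ⊓ Y.1) + (W.polarGrassmannGraph k).dist X Y = k + 1 := by
  have h0 : finrank F ↥(X.1 ⊓ Y.1) ≤ k := (Submodule.finrank_mono inf_le_left).trans_eq X.2.2
  obtain ⟨p, hp⟩ := h.exists_walk hk (k - finrank F ↥(X.1 ⊓ Y.1)) (by omega)
  obtain ⟨q, hq⟩ := p.reachable.exists_walk_length_eq_dist
  have h1 := h.lt_finrank_inf_add_length hk q
  have h2 := SimpleGraph.dist_le p
  omega

theorem preconnected (hk : k < W.wittIndex) : (W.polarGrassmannGraph k).Preconnected := by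
  intro X Y
  have h0 : finrank F ↥(X.1 ⊓ Y.1) ≤ k := (Submodule.finrank_mono inf_le_left).trans_eq X.2.2
  by_cases h : W.Opposite X.1 Y.1
  · exact (h.exists_walk hk (k - finrank F ↥(X.1 ⊓ Y.1)) (by omega)).choose.reachable
  · exact (exists_walk_of_not_opposite hk h (k - finrank F ↥(X.1 ⊓ Y.1))
      (by omega)).choose.reachable

theorem nonempty_singularSubspace (hk : k ≤ W.wittIndex) : Nonempty (W.SingularSubspace k) := by
  obtain ⟨a, b, h⟩ := W.exists_isHyperbolic_wittIndex
  have hli : LinearIndependent F (a ∘ Fin.castLE hk) :=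
    (h.linearIndependent.comp Sum.inl Sum.inl_injective).comp _ (Fin.castLE_injective hk)
  refine ⟨Submodule.span F (Set.range (a ∘ Fin.castLE hk)), isTotallySingular_span_iff.2 ⟨?_, ?_⟩,
    by rw [finrank_span_eq_card hli, Fintype.card_fin]⟩
  · rintro _ ⟨i, rfl⟩
    exact h.sing_left _
  · rintro _ ⟨i, rfl⟩ _ ⟨j, rfl⟩
    exact h.form_left _ _

theorem connected (hk : k < W.wittIndex) : (W.polarGrassmannGraph k).Connected :=
  haveI := nonempty_singularSubspace hk.le
  ⟨preconnected hk⟩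

/-! ### Distances in dual polar graphs -/

/-- In a dual polar graph, a vector `y` of `Y` outside `X` is adjoined to its orthogonal complement in
`X`, which is a hyperplane of `X`. -/
theorem exists_walk_of_eq (hk : k = W.wittIndex) {X Y : W.SingularSubspace k}
    (n : ℕ) (hn : k ≤ finrank F ↥(X.1 ⊓ Y.1) + n) :
    ∃ p : (W.polarGrassmannGraph k).Walk X Y, p.length ≤ n := by
  induction n generalizing X with
  | zero =>
    obtain rfl := eq_of_le_finrank_inf hn
    exact ⟨SimpleGraph.Walk.nil, le_rfl⟩
  | succ n ih =>
    rcases eq_or_ne X Y with rfl | hXY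
    · exact ⟨SimpleGraph.Walk.nil, Nat.zero_le _⟩
    have hlt := finrank_inf_lt hXY
    obtain ⟨y, hyY, hyX⟩ := exists_mem_notMem_of_finrank_lt (A := X.1 ⊓ Y.1) (X := Y.1)
      (by rwa [Y.2.2])
    replace hyX : y ∉ X.1 := fun h => hyX ⟨h, hyY⟩
    have hys := Y.2.1.sing hyY
    have h1 := finrank_inf_perp_comm (W := W) X.1 (Submodule.span F {y})
    have hyp : y ∉ W.perp X.1 := by
      intro hyp
      have h2 := (X.2.1.sup_span_singleton hys hyp).finrank_le
      rw [Submodule.finrank_sup_span_singleton hyX, X.2.2] at h2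
      omega
    have h2 : Submodule.span F {y} ⊓ W.perp X.1 = ⊥ := by
      rw [inf_comm]
      exact (Submodule.disjoint_span_singleton_of_notMem hyp).eq_bot
    rw [h2, finrank_bot, finrank_span_singleton (by rintro rfl; exact hyX X.1.zero_mem),
      X.2.2] at h1
    obtain ⟨Z, hZ, hXZ⟩ := exists_vertex (X := X) (H := X.1 ⊓ W.perp (Submodule.span F {y}))
      inf_le_left (by omega) hys
      (mem_perp'.2 fun u hu => hu.2 y (Submodule.mem_span_singleton_self y)) hyX
    have hadj : (W.polarGrassmannGraph k).Adj X Z :=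
      (adj_iff_of_eq hk).2 (by rw [hXZ]; omega)
    have hle : X.1 ⊓ Y.1 ⊔ Submodule.span F {y} ≤ Z.1 ⊓ Y.1 := by
      rw [hZ]
      refine le_inf (sup_le_sup_right (le_inf inf_le_left ?_) _)
        (sup_le inf_le_right (by simpa using hyY))
      intro u hu
      rw [mem_perp_span]
      simpa using Y.2.1.form_eq_zero hu.2 hyY
    have hle' := Submodule.finrank_mono hle
    rw [Submodule.finrank_sup_span_singleton fun h : y ∈ X.1 ⊓ Y.1 => hyX h.1] at hle'
    obtain ⟨p, hp⟩ := ih (X := Z) (by omega)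
    exact ⟨SimpleGraph.Walk.cons hadj p, by rw [SimpleGraph.Walk.length_cons]; omega⟩

theorem dist_of_eq (hk : k = W.wittIndex) (X Y : W.SingularSubspace k) :
    finrank F ↥(X.1 ⊓ Y.1) + (W.polarGrassmannGraph k).dist X Y = k := by
  have h0 : finrank F ↥(X.1 ⊓ Y.1) ≤ k := (Submodule.finrank_mono inf_le_left).trans_eq X.2.2
  obtain ⟨p, hp⟩ := exists_walk_of_eq hk (X := X) (Y := Y) (k - finrank F ↥(X.1 ⊓ Y.1)) (by omega)
  obtain ⟨q, hq⟩ := p.reachable.exists_walk_length_eq_dist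
  have h1 := le_finrank_inf_add_length q
  have h2 := SimpleGraph.dist_le p
  omega

theorem connected_of_eq (hk : k = W.wittIndex) : (W.polarGrassmannGraph k).Connected :=
  haveI := nonempty_singularSubspace hk.le
  ⟨fun _ _ => (exists_walk_of_eq hk k (by omega)).choose.reachable⟩

end PolarForm

/-! ### Normal forms of geodesics -/

namespace PolarForm

variable {F V : Type*} [Field F] [AddCommGroup V] [Module F V]

section Frames

variable {a b c : ℕ} {x : Fin a → V} {y : Fin b → V} {w : Fin c → V}

theorem notMem_span_of_left (h : LinearIndependent F (Sum.elim (Sum.elim x y) w))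
    {s : Set (Fin a)} {i : Fin a} (hi : i ∉ s) :
    x i ∉ Submodule.span F (x '' s ∪ Set.range y ∪ Set.range w) := by
  have h1 := h.notMem_span_image
    (s := Sum.inl '' (Sum.inl '' s ∪ Set.range Sum.inr) ∪ Set.range Sum.inr)
    (x := Sum.inl (Sum.inl i)) (by simpa using hi)
  simpa [Set.image_union, Set.image_image, ← Set.range_comp, Function.comp_def] using h1

theorem notMem_span_of_right (h : LinearIndependent F (Sum.elim (Sum.elim x y) w))
    {t : Set (Fin b)} {j : Fin b} (hj : j ∉ t) :
    y j ∉ Submodule.span F (Set.range x ∪ y '' t ∪ Set.range w) := by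
  have h1 := h.notMem_span_image
    (s := Sum.inl '' (Set.range Sum.inl ∪ Sum.inr '' t) ∪ Set.range Sum.inr)
    (x := Sum.inl (Sum.inr j)) (by simpa using hj)
  simpa [Set.image_union, Set.image_image, ← Set.range_comp, Function.comp_def] using h1

theorem finrank_span_frame (h : LinearIndependent F (Sum.elim (Sum.elim x y) w)) :
    finrank F (Submodule.span F (Set.range x ∪ Set.range y ∪ Set.range w)) = a + b + c := by
  rw [← Set.Sum.elim_range x y, ← Set.Sum.elim_range, finrank_span_eq_card h]
  simp

theorem finrank_span_left (h : LinearIndependent F (Sum.elim (Sum.elim x y) w)) :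
    finrank F (Submodule.span F (Set.range x ∪ Set.range w)) = a + c := by
  have h1 : LinearIndependent F (Sum.elim x w) := by
    have := h.comp (Sum.map Sum.inl id) (Sum.map_injective.2 ⟨Sum.inl_injective, fun _ _ => id⟩)
    convert this using 1
    ext (i | i) <;> rfl
  rw [← Set.Sum.elim_range, finrank_span_eq_card h1]
  simp

theorem linearIndependent_frame_iff :
    LinearIndependent F (Sum.elim (Sum.elim x y) w) ↔
      finrank F (Submodule.span F (Set.range x ∪ Set.range y ∪ Set.range w)) = a + b + c := by
  rw [linearIndependent_iff_card_eq_finrank_span, Set.finrank, Set.Sum.elim_range,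
    Set.Sum.elim_range, eq_comm]
  simp

end Frames

variable {W : PolarForm F V} {k m : ℕ}

/-- A sequence of vertices as a sequence of subspaces indexed by `ℕ`. -/
def toSubmodules (X : Fin (m + 1) → W.SingularSubspace k) (i : ℕ) : Submodule F V :=
  if h : i < m + 1 then (X ⟨i, h⟩).1 else ⊥

theorem toSubmodules_val (X : Fin (m + 1) → W.SingularSubspace k) (i : Fin (m + 1)) :
    toSubmodules X i = (X i).1 := by
  exact dif_pos i.2

/-- Membership of the basis vectors in the members of a sequence in normal form. -/
theorem mem_of_eq_span {x y : Fin m → V} {w : Fin (k - m) → V}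
    {X : Fin (m + 1) → W.SingularSubspace k}
    (hX : ∀ i : Fin (m + 1), (X i).1 = Submodule.span F
      (x '' {j | (j : ℕ) + i < m} ∪ y '' {j | m ≤ (j : ℕ) + i} ∪ Set.range w)) :
    (∀ (i : Fin (m + 1)) (j : Fin m), (j : ℕ) + i < m → x j ∈ (X i).1) ∧
    (∀ (i : Fin (m + 1)) (j : Fin m), m ≤ (j : ℕ) + i → y j ∈ (X i).1) ∧
    ∀ i j, w j ∈ (X i).1 := by
  refine ⟨fun i j h => ?_, fun i j h => ?_, fun i j => ?_⟩ <;> rw [hX] <;>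
    refine Submodule.subset_span ?_
  · exact Or.inl (Or.inl ⟨j, h, rfl⟩)
  · exact Or.inl (Or.inr ⟨j, h, rfl⟩)
  · exact Or.inr ⟨j, rfl⟩

theorem ends_eq_span {x y : Fin m → V} {w : Fin (k - m) → V}
    {X : Fin (m + 1) → W.SingularSubspace k}
    (hX : ∀ i : Fin (m + 1), (X i).1 = Submodule.span F
      (x '' {j | (j : ℕ) + i < m} ∪ y '' {j | m ≤ (j : ℕ) + i} ∪ Set.range w)) :
    (X 0).1 = Submodule.span F (Set.range x ∪ Set.range w) ∧
      (X (Fin.last m)).1 = Submodule.span F (Set.range y ∪ Set.range w) := by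
  rw [hX, hX]
  have h1 : {j : Fin m | (j : ℕ) + ((0 : Fin (m + 1)) : ℕ) < m} = Set.univ := by ext; simp
  have h2 : {j : Fin m | m ≤ (j : ℕ) + ((0 : Fin (m + 1)) : ℕ)} = ∅ := by ext; simp
  have h3 : {j : Fin m | (j : ℕ) + (Fin.last m : ℕ) < m} = ∅ := by ext; simp
  have h4 : {j : Fin m | m ≤ (j : ℕ) + (Fin.last m : ℕ)} = Set.univ := by ext; simp
  rw [h1, h2, h3, h4]
  simp

theorem dist_le_of_adj {α : Type*} {G : SimpleGraph α} {l : ℕ} {p : Fin (l + 1) → α}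
    (h : ∀ i : Fin l, G.Adj (p i.castSucc) (p i.succ)) :
    ∃ q : G.Walk (p 0) (p (Fin.last l)), q.length = l := by
  induction l with
  | zero => exact ⟨SimpleGraph.Walk.nil, rfl⟩
  | succ l ih =>
    obtain ⟨q, hq⟩ := ih (p := fun i => p i.succ) fun i => by simpa using h i.succ
    exact ⟨SimpleGraph.Walk.cons (h 0) q, congrArg (· + 1) hq⟩

variable [FiniteDimensional F V]

theorem IsFlagPath.exists_matched_basis {X : ℕ → Submodule F V} (h : IsFlagPath X k m)
    (W : PolarForm F V) :
    ∃ (x y : Fin m → V) (w : Fin (k - m) → V) (r : Fin m → Option (Fin m)),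
      LinearIndependent F (Sum.elim (Sum.elim x y) w) ∧
      (∀ i ≤ m, X i = Submodule.span F
        (x '' {j | (j : ℕ) + i < m} ∪ y '' {j | m ≤ (j : ℕ) + i} ∪ Set.range w)) ∧
      (∀ i i' j, r i = some j → r i' = some j → i = i') ∧
      ∀ i j, W.form (x i) (y j) = if r i = some j then 1 else 0 := by
  obtain ⟨x, y, w, hli, hX⟩ := h.exists_basis
  obtain ⟨x', y', r, hx, hy, hinj, hform⟩ := W.exists_matching x y
  have hspan : ∀ s t, IsLowerSet s → IsUpperSet t →
      Submodule.span F (x' '' s ∪ y' '' t ∪ Set.range w) =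
        Submodule.span F (x '' s ∪ y '' t ∪ Set.range w) := by
    intro s t hs ht
    simp only [Submodule.span_union, hx s hs, hy t ht]
  refine ⟨x', y', w, r, ?_, fun i hi => ?_, hinj, hform⟩
  · rw [linearIndependent_frame_iff] at hli ⊢
    rw [← Set.image_univ, ← Set.image_univ (f := y'), hspan _ _ isLowerSet_univ isUpperSet_univ,
      Set.image_univ, Set.image_univ, hli]
  · rw [hX i hi, hspan]
    · intro j l hlj hj
      simp only [Set.mem_ofPred_eq] at hj ⊢
      have : (l : ℕ) ≤ j := hlj
      omega
    · intro j l hlj hj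
      simp only [Set.mem_ofPred_eq] at hj ⊢
      have : (j : ℕ) ≤ l := hlj
      omega

theorem isFlagPath_toSubmodules {X : Fin (m + 1) → W.SingularSubspace k}
    (hadj : ∀ i : Fin m, (W.polarGrassmannGraph k).Adj (X i.castSucc) (X i.succ))
    (hends : finrank F ↥((X 0).1 ⊓ (X (Fin.last m)).1) + m ≤ k) :
    IsFlagPath (toSubmodules X) k m where
  finrank_eq i hi := by
    rw [show i = ((⟨i, by omega⟩ : Fin (m + 1)) : ℕ) from rfl, toSubmodules_val]
    exact (X _).2.2
  step i hi := by
    have h1 := toSubmodules_val X (Fin.castSucc ⟨i, hi⟩)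
    have h2 := toSubmodules_val X (Fin.succ ⟨i, hi⟩)
    simp only [Fin.val_castSucc, Fin.val_succ] at h1 h2
    rw [h1, h2]
    exact (Adj.finrank_inf (hadj ⟨i, hi⟩)).ge
  ends := by
    have h1 := toSubmodules_val X 0
    have h2 := toSubmodules_val X (Fin.last m)
    simp only [Fin.val_zero, Fin.val_last] at h1 h2
    rwa [h1, h2]

/-- The normal form of a sequence of vertices that moves straight from its first to its last
member. -/
theorem exists_matched_basis {X : Fin (m + 1) → W.SingularSubspace k}
    (hadj : ∀ i : Fin m, (W.polarGrassmannGraph k).Adj (X i.castSucc) (X i.succ))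
    (hends : finrank F ↥((X 0).1 ⊓ (X (Fin.last m)).1) + m ≤ k) :
    ∃ (x y : Fin m → V) (w : Fin (k - m) → V) (r : Fin m → Option (Fin m)),
      LinearIndependent F (Sum.elim (Sum.elim x y) w) ∧
      (∀ i : Fin (m + 1), (X i).1 = Submodule.span F
        (x '' {j | (j : ℕ) + i < m} ∪ y '' {j | m ≤ (j : ℕ) + i} ∪ Set.range w)) ∧
      (∀ i i' j, r i = some j → r i' = some j → i = i') ∧
      ∀ i j, W.form (x i) (y j) = if r i = some j then 1 else 0 := by
  obtain ⟨x, y, w, r, h1, h2, h3, h4⟩ := (isFlagPath_toSubmodules hadj hends).exists_matched_basis W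
  exact ⟨x, y, w, r, h1, fun i => by rw [← toSubmodules_val, h2 i (by omega)], h3, h4⟩

theorem finrank_inf_of_eq_span {x y : Fin m → V} {w : Fin (k - m) → V}
    {X Y : W.SingularSubspace k} (hli : LinearIndependent F (Sum.elim (Sum.elim x y) w))
    (hX : X.1 = Submodule.span F (Set.range x ∪ Set.range w))
    (hY : Y.1 = Submodule.span F (Set.range y ∪ Set.range w)) :
    finrank F ↥(X.1 ⊓ Y.1) + m = k := by
  have h1 := Submodule.finrank_sup_add_finrank_inf_eq X.1 Y.1
  have h2 : X.1 ⊔ Y.1 = Submodule.span F (Set.range x ∪ Set.range y ∪ Set.range w) := by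
    rw [hX, hY, ← Submodule.span_union, ← Set.union_union_distrib_right]
  have h3 := finrank_span_left hli
  rw [← hX, X.2.2] at h3
  rw [h2, finrank_span_frame hli, X.2.2, Y.2.2] at h1
  omega

/-- The inequality `r i < i` makes consecutive terms orthogonal, and it makes the last vector `y`
orthogonal to the first term. -/
theorem HasPattern.isGeodesic (hk : k < W.wittIndex) {r : Fin m → Option (Fin m)}
    (hr : IsPattern r) {X : Fin (m + 1) → W.SingularSubspace k} (h : W.HasPattern k r X) :
    (W.polarGrassmannGraph k).IsGeodesic X ∧ ¬ W.Opposite (X 0).1 (X (Fin.last m)).1 := by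
  obtain ⟨x, y, w, hli, hX, hform⟩ := h
  obtain ⟨hxX, hyX, hwX⟩ := mem_of_eq_span hX
  obtain ⟨h0, hl⟩ := ends_eq_span hX
  have hform0 : ∀ a b, a ≤ b → W.form (x a) (y b) = 0 := by
    intro a b hab
    rw [hform, if_neg]
    exact fun h => absurd (hr.1 a b h) (not_lt.2 hab)
  have hopp : ¬ W.Opposite (X 0).1 (X (Fin.last m)).1 := by
    rcases m with _ | m
    · exact fun h => h.1 rfl
    · refine not_opposite_iff.2 (Or.inr ⟨y (Fin.last m), hyX _ _ (by simp), ?_, ?_⟩)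
      · rw [h0, mem_perp_span]
        rintro _ (⟨i, rfl⟩ | ⟨i, rfl⟩)
        · exact W.form_eq_zero_comm.1 (hform0 i _ (Fin.le_last i))
        · exact (X (Fin.last (m + 1))).2.1.form_eq_zero (hyX _ _ (by simp)) (hwX _ _)
      · intro hmem
        rw [h0] at hmem
        refine notMem_span_of_right hli (Set.notMem_empty (Fin.last m)) ?_
        simpa using hmem
  refine ⟨⟨fun i => (adj_iff hk).2 ⟨?_, ?_⟩, ?_⟩, hopp⟩
  · let j : Fin m := ⟨m - 1 - i, by omega⟩
    have hle : (X i.succ).1 ≤ (X i.castSucc).1 ⊔ Submodule.span F {y j} := by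
      rw [hX i.succ, Submodule.span_le]
      rintro _ ((⟨l, hl, rfl⟩ | ⟨l, hl, rfl⟩) | ⟨l, rfl⟩)
      · refine Submodule.mem_sup_left (hxX _ _ ?_)
        simp only [Set.mem_ofPred_eq, Fin.val_succ, Fin.val_castSucc] at hl ⊢
        omega
      · by_cases hlj : l = j
        · rw [hlj]
          exact Submodule.mem_sup_right (Submodule.mem_span_singleton_self _)
        · refine Submodule.mem_sup_left (hyX _ _ ?_)
          have : (l : ℕ) ≠ m - 1 - i := fun h => hlj (Fin.ext h)
          simp only [Set.mem_ofPred_eq, Fin.val_succ, Fin.val_castSucc] at hl ⊢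
          omega
      · exact Submodule.mem_sup_left (hwX _ _)
    have hyj : y j ∉ (X i.castSucc).1 := by
      intro hmem
      have h1 : j ∉ {l : Fin m | m ≤ (l : ℕ) + (i.castSucc : ℕ)} := by
        simp only [Set.mem_ofPred_eq, Fin.val_castSucc, j]
        omega
      refine notMem_span_of_right hli h1 ?_
      rw [hX] at hmem
      refine Submodule.span_mono ?_ hmem
      exact Set.union_subset_union_left _
        (Set.union_subset_union_left _ (Set.image_subset_range _ _))
    have hne : X i.castSucc ≠ X i.succ := by
      intro heq
      refine hyj (heq ▸ hyX _ _ ?_)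
      simp only [Fin.val_succ, j]
      omega
    have h1 := Submodule.finrank_mono (sup_le le_sup_left hle)
    rw [Submodule.finrank_sup_span_singleton hyj, (X i.castSucc).2.2] at h1
    have h2 := Submodule.finrank_sup_add_finrank_inf_eq (X i.castSucc).1 (X i.succ).1
    rw [(X i.castSucc).2.2, (X i.succ).2.2] at h2
    have h3 := finrank_inf_lt hne
    omega
  · rw [hX i.castSucc, hX i.succ, span_le_perp_span]
    have h1 := fun u hu v hv => (X i.castSucc).2.1.form_eq_zero (x := u) (y := v) hu hv
    have h2 := fun u hu v hv => (X i.succ).2.1.form_eq_zero (x := u) (y := v) hu hv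
    rintro _ ((⟨a, ha, rfl⟩ | ⟨a, ha, rfl⟩) | ⟨a, rfl⟩) v hv
    · rcases hv with (⟨b, hb, rfl⟩ | ⟨b, hb, rfl⟩) | ⟨b, rfl⟩
      · refine h1 _ (hxX _ _ ha) _ (hxX _ _ ?_)
        simp only [Set.mem_ofPred_eq, Fin.val_succ, Fin.val_castSucc] at hb ⊢
        omega
      · refine hform0 a b ?_
        simp only [Set.mem_ofPred_eq, Fin.val_succ, Fin.val_castSucc] at ha hb
        rw [Fin.le_def]
        omega
      · exact h1 _ (hxX _ _ ha) _ (hwX _ _)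
    · refine h2 _ (hyX _ _ ?_) v (by rw [hX]; exact Submodule.subset_span hv)
      simp only [Set.mem_ofPred_eq, Fin.val_succ, Fin.val_castSucc] at ha ⊢
      omega
    · exact h2 _ (hwX _ _) v (by rw [hX]; exact Submodule.subset_span hv)
  · have h1 := dist_of_not_opposite hk hopp
    have h2 := finrank_inf_of_eq_span hli h0 hl
    omega

/-- If `r a = some b` with `a ≤ b`, then the non-orthogonal vectors `x a` and `y b` would lie in
consecutive terms of the geodesic. -/
theorem exists_hasPattern (hk : k < W.wittIndex) {X : Fin (m + 1) → W.SingularSubspace k}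
    (h : (W.polarGrassmannGraph k).IsGeodesic X)
    (hopp : ¬ W.Opposite (X 0).1 (X (Fin.last m)).1) :
    ∃ r, IsPattern r ∧ W.HasPattern k r X := by
  have h1 := dist_of_not_opposite hk hopp
  rw [h.2] at h1
  obtain ⟨x, y, w, r, hli, hX, hinj, hform⟩ := exists_matched_basis h.1 h1.le
  obtain ⟨hxX, hyX, hwX⟩ := mem_of_eq_span hX
  refine ⟨r, ⟨fun a b hab => ?_, hinj⟩, x, y, w, hli, hX, hform⟩
  by_contra hle
  rw [not_lt, Fin.le_def] at hle
  let i : Fin m := ⟨m - 1 - b, by omega⟩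
  have h2 := ((adj_iff hk).1 (h.1 i)).2 (hxX i.castSucc a (by simp [i]; omega)) (y b)
    (hyX i.succ b (by simp [i]; omega))
  rw [hform, if_pos hab] at h2
  exact one_ne_zero h2

theorem isGeodesic_not_opposite_iff (hk : k < W.wittIndex)
    {X : Fin (m + 1) → W.SingularSubspace k} :
    (W.polarGrassmannGraph k).IsGeodesic X ∧ ¬ W.Opposite (X 0).1 (X (Fin.last m)).1 ↔
      ∃ r, IsPattern r ∧ W.HasPattern k r X :=
  ⟨fun h => exists_hasPattern hk h.1 h.2, fun ⟨_, hr, h⟩ => h.isGeodesic hk hr⟩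

end PolarForm

/-! ### Geodesics with opposite ends -/

namespace PolarForm

variable {F V : Type*} [Field F] [AddCommGroup V] [Module F V]

variable {W : PolarForm F V} {k m : ℕ}

theorem HasOppositeForm.ends {X : Fin (m + 2) → W.SingularSubspace k}
    (h : W.HasOppositeForm k X) : m ≤ k ∧ ∃ (x y : Fin m → V) (w : Fin (k - m) → V),
      LinearIndependent F (Sum.elim (Sum.elim x y) w) ∧
      (X 0).1 = Submodule.span F (Set.range x ∪ Set.range w) ∧
      (X (Fin.last (m + 1))).1 = Submodule.span F (Set.range y ∪ Set.range w) ∧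
      ∀ i j, W.form (x i) (y j) = if i = j then 1 else 0 := by
  obtain ⟨x, y, w, hli, h0, hX, hform, -⟩ := h
  have hli' : LinearIndependent F (Sum.elim (Sum.elim (x ∘ Fin.succ) y) w) := by
    have := hli.comp (Sum.map (Sum.map Fin.succ id) id)
      (Sum.map_injective.2 ⟨Sum.map_injective.2 ⟨Fin.succ_injective m, fun _ _ => id⟩,
        fun _ _ => id⟩)
    convert this using 1
    ext ((i | i) | i) <;> rfl
  have h0' : (X 0).1 = Submodule.span F (Set.range (x ∘ Fin.succ) ∪ Set.range w) := by
    rw [h0, Set.range_comp, Fin.range_succ]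
    rfl
  have hfin := finrank_span_left hli'
  rw [← h0', (X 0).2.2] at hfin
  refine ⟨by omega, x ∘ Fin.succ, y, w, hli', h0', ?_, fun i j => ?_⟩
  · have h1 : {j : Fin (m + 1) | (j : ℕ) + (Fin.last m : ℕ) < m} = ∅ := by ext; simp
    have h2 : {j : Fin m | m ≤ (j : ℕ) + (Fin.last m : ℕ)} = Set.univ := by ext; simp
    rw [← Fin.succ_last, hX, h1, h2]
    simp
  · simp only [Function.comp_apply, hform, Fin.succ_inj]

variable [FiniteDimensional F V]

theorem finrank_inf_add_one_of_hyperplane {H X U : Submodule F V} (hHX : H ≤ X)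
    (h : finrank F H + 1 = finrank F X) :
    finrank F ↥(X ⊓ U) ≤ finrank F ↥(H ⊓ U) + 1 := by
  have h1 := Submodule.finrank_sup_add_finrank_inf_eq H (X ⊓ U)
  have h2 : finrank F ↥(H ⊔ (X ⊓ U)) ≤ finrank F X :=
    Submodule.finrank_mono (sup_le hHX inf_le_left)
  have h3 : H ⊓ (X ⊓ U) = H ⊓ U := by rw [← inf_assoc, inf_eq_left.2 hHX]
  rw [h3] at h1
  omega

/-- A vertex `X` dual to a vertex `Y` modulo their intersection is opposite to `Y`. -/
theorem opposite_of_dual {x y : Fin m → V} {w : Fin (k - m) → V} (hm : 0 < m)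
    {X Y : W.SingularSubspace k} (hli : LinearIndependent F (Sum.elim (Sum.elim x y) w))
    (hX : X.1 = Submodule.span F (Set.range x ∪ Set.range w))
    (hY : Y.1 = Submodule.span F (Set.range y ∪ Set.range w))
    (h : ∀ i j, W.form (x i) (y j) = if i = j then 1 else 0) : W.Opposite X.1 Y.1 := by
  refine opposite_iff.2 ⟨fun h0 => ?_, fun z hz => ?_⟩
  · have h1 := finrank_inf_of_eq_span hli hX hY
    rw [h0, inf_idem, Y.2.2] at h1
    omega
  · have hz1 := hz.1
    rw [hY, Submodule.span_union] at hz1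
    obtain ⟨z₁, hz₁, z₂, hz₂, rfl⟩ := Submodule.mem_sup.1 hz1
    have hwX : Submodule.span F (Set.range w) ≤ X.1 := by
      rw [hX]
      exact Submodule.span_mono Set.subset_union_right
    obtain ⟨c, rfl⟩ := (Submodule.mem_span_range_iff_exists_fun F).1 hz₁
    suffices hc : ∀ i, c i = 0 by
      simpa [hc] using hwX hz₂
    intro i
    have hxi : x i ∈ X.1 := by
      rw [hX]
      exact Submodule.subset_span (Or.inl ⟨i, rfl⟩)
    have h1 := hz.2 (x i) hxi
    rw [form_add_left, X.2.1.form_eq_zero (hwX hz₂) hxi, add_zero, ← formLeft_apply, map_sum,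
      Finset.sum_eq_single_of_mem i (Finset.mem_univ i)] at h1
    · rw [map_smul, formLeft_apply, form_swap, h, if_pos rfl, map_one, mul_one, smul_eq_mul,
        mul_eq_zero] at h1
      exact h1.resolve_right W.sgn_ne_zero
    · intro j _ hji
      rw [map_smul, formLeft_apply, form_swap, h, if_neg hji.symm, map_zero, mul_zero, smul_zero]

/-- The terms after the first one have the pattern `i ↦ i - 1`, and the ends are dual modulo their
intersection. -/
theorem HasOppositeForm.isGeodesic (hk : k < W.wittIndex) (hm : 1 ≤ m)
    {X : Fin (m + 2) → W.SingularSubspace k} (h : W.HasOppositeForm k X) :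
    (W.polarGrassmannGraph k).IsGeodesic X ∧
      W.Opposite (X 0).1 (X (Fin.last (m + 1))).1 := by
  obtain ⟨hmk, x', y', w', hli', h0', hl', hdual'⟩ := h.ends
  have hopp := opposite_of_dual hm hli' h0' hl' hdual'
  have hdist := hopp.dist_eq hk
  have hinf := finrank_inf_of_eq_span hli' h0' hl'
  obtain ⟨x, y, w, hli, h0, hX, hform, hxx⟩ := h
  -- the tail is a geodesic with pattern `i ↦ i - 1`
  let r : Fin m → Option (Fin m) := fun i =>
    if h : 0 < (i : ℕ) then some ⟨i - 1, by omega⟩ else none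
  have hr : ∀ i j, r i = some j ↔ i.castSucc = j.succ := by
    intro i j
    simp only [r]
    split_ifs with hi
    · simp only [Option.some_inj, Fin.ext_iff, Fin.val_castSucc, Fin.val_succ]
      omega
    · simp only [Fin.ext_iff, Fin.val_castSucc, Fin.val_succ, false_iff]
      omega
  have hpat : IsPattern r := by
    refine ⟨fun i j hij => ?_, fun i i' j hi hi' => ?_⟩
    · have := congrArg Fin.val ((hr i j).1 hij)
      rw [Fin.val_castSucc, Fin.val_succ] at this
      rw [Fin.lt_def]
      omega
    · exact Fin.castSucc_injective _ (((hr i j).1 hi).trans ((hr i' j).1 hi').symm)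
  have htail : W.HasPattern k r fun i => X i.succ := by
    refine ⟨x ∘ Fin.castSucc, y, w, ?_, fun i => ?_, fun i j => ?_⟩
    · have := hli.comp (Sum.map (Sum.map Fin.castSucc id) id)
        (Sum.map_injective.2 ⟨Sum.map_injective.2 ⟨Fin.castSucc_injective m, fun _ _ => id⟩,
          fun _ _ => id⟩)
      convert this using 1
      ext ((i | i) | i) <;> rfl
    · rw [hX]
      congr 3
      ext v
      constructor
      · rintro ⟨j, hj, rfl⟩
        have hj' : (j : ℕ) + i < m := hj
        exact ⟨⟨j, by omega⟩, hj, rfl⟩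
      · rintro ⟨j, hj, rfl⟩
        exact ⟨j.castSucc, hj, rfl⟩
    · simp only [Function.comp_apply, hform, hr]
  have htail' := htail.isGeodesic hk hpat
  refine ⟨⟨Fin.cases ?_ fun i => by simpa using htail'.1.1 i, by omega⟩, hopp⟩
  -- the first two vertices differ by exchanging `x m` for `x 0`
  have hx0 : x 0 ∉ (X 0).1 := by
    intro hmem
    rw [h0] at hmem
    refine notMem_span_of_left hli (s := {j | j ≠ 0}) (i := 0) (by simp) ?_
    exact Submodule.span_mono (Set.union_subset_union_left _ Set.subset_union_left) hmem
  have hx1 : x 0 ∈ (X 1).1 := by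
    rw [show (1 : Fin (m + 2)) = Fin.succ 0 from rfl, hX]
    refine Submodule.subset_span (Or.inl (Or.inl ⟨0, ?_, rfl⟩))
    simp only [Set.mem_ofPred_eq, Fin.val_zero]
    omega
  have hperp : ∀ i, x i ∈ W.perp (X 0).1 := by
    intro i
    rw [h0, mem_perp_span]
    rintro _ (⟨j, -, rfl⟩ | ⟨j, rfl⟩)
    · exact hxx i j
    · by_cases hi : i = 0
      · refine (X 1).2.1.form_eq_zero (hi ▸ hx1) ?_
        rw [show (1 : Fin (m + 2)) = Fin.succ 0 from rfl, hX]
        exact Submodule.subset_span (Or.inr ⟨j, rfl⟩)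
      · refine (X 0).2.1.form_eq_zero ?_ ?_ <;> rw [h0] <;> refine Submodule.subset_span ?_
        · exact Or.inl ⟨i, hi, rfl⟩
        · exact Or.inr ⟨j, rfl⟩
  have hle : (X 1).1 ≤ (X 0).1 ⊔ Submodule.span F {x 0} := by
    rw [show (1 : Fin (m + 2)) = Fin.succ 0 from rfl, hX, Submodule.span_le]
    rintro _ ((⟨j, -, rfl⟩ | ⟨j, hj, rfl⟩) | ⟨j, rfl⟩)
    · by_cases hj : j = 0
      · rw [hj]
        exact Submodule.mem_sup_right (Submodule.mem_span_singleton_self _)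
      · refine Submodule.mem_sup_left ?_
        rw [h0]
        exact Submodule.subset_span (Or.inl ⟨j, hj, rfl⟩)
    · simp at hj
      omega
    · refine Submodule.mem_sup_left ?_
      rw [h0]
      exact Submodule.subset_span (Or.inr ⟨j, rfl⟩)
  refine (adj_iff hk).2 ⟨?_, le_perp_comm.1 ?_⟩
  · have h1 := Submodule.finrank_mono (sup_le le_sup_left hle)
    rw [Submodule.finrank_sup_span_singleton hx0, (X 0).2.2] at h1
    have h2 := Submodule.finrank_sup_add_finrank_inf_eq (X 0).1 (X 1).1
    rw [(X 0).2.2, (X 1).2.2] at h2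
    have h3 := finrank_inf_lt (X := X 0) (Y := X 1) (by rintro h; exact hx0 (h ▸ hx1))
    change finrank F ↥((X 0).1 ⊓ (X 1).1) + 1 = k
    omega
  · change (X 1).1 ≤ W.perp (X 0).1
    refine hle.trans (sup_le (isTotallySingular_iff_le_perp.1 (X 0).2.1).2 ?_)
    simpa using hperp 0

/-- The terms after the first one form a geodesic with non-opposite ends. Its pattern is
`i ↦ i - 1`: the first term is orthogonal to no vector of the last one outside their intersection
and meets the second term in a hyperplane, so only one index can be undefined. The vectors `x i`,
`i ≠ 0`, are then moved into the first term along `x 0`, and the first term contributes a further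
vector dual to the last `y`. -/
theorem exists_hasOppositeForm (hk : k < W.wittIndex) (hm : 1 ≤ m)
    {X : Fin (m + 2) → W.SingularSubspace k} (h : (W.polarGrassmannGraph k).IsGeodesic X)
    (hopp : W.Opposite (X 0).1 (X (Fin.last (m + 1))).1) : W.HasOppositeForm k X := by
  set L := X (Fin.last (m + 1)) with hL
  have hdist := hopp.dist_eq hk
  rw [h.2] at hdist
  have hadj01 : (W.polarGrassmannGraph k).Adj (X 0) (X 1) := h.1 0
  have h01 := (adj_iff hk).1 hadj01
  have hadj : ∀ i : Fin m, (W.polarGrassmannGraph k).Adj (X i.castSucc.succ) (X i.succ.succ) :=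
    fun i => by simpa using h.1 i.succ
  -- the tail is a geodesic, its ends are not opposite and meet in `X 0 ⊓ L`
  have hC_le : (X 1).1 ⊓ L.1 ≤ (X 0).1 ⊓ L.1 :=
    le_inf (hopp.inf_le_of_adj hk hadj01) inf_le_right
  have hC_fin := Submodule.finrank_mono hC_le
  have hnot : ¬ W.Opposite (X 1).1 L.1 := by
    intro hopp1
    have h1 := hopp1.dist_eq hk
    obtain ⟨q, hq⟩ := dist_le_of_adj (p := fun i : Fin (m + 1) => X i.succ) hadj
    have h2 := SimpleGraph.dist_le q
    rw [hq] at h2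
    have h3 : (W.polarGrassmannGraph k).dist (X 1) L ≤ m := h2
    omega
  have hC : (X 1).1 ⊓ L.1 = (X 0).1 ⊓ L.1 := by
    refine Submodule.eq_of_le_of_finrank_le hC_le ?_
    have h1 := dist_of_not_opposite hk hnot
    obtain ⟨q, hq⟩ := dist_le_of_adj (p := fun i : Fin (m + 1) => X i.succ) hadj
    have h2 := SimpleGraph.dist_le q
    rw [hq] at h2
    have h3 : (W.polarGrassmannGraph k).dist (X 1) L ≤ m := h2
    omega
  have hends : finrank F ↥((X (Fin.succ 0)).1 ⊓ (X (Fin.last m).succ).1) + m ≤ k := by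
    rw [Fin.succ_last, Fin.succ_zero_eq_one, ← hL, hC]
    omega
  obtain ⟨x, y, w, r, hli, hX, hinj, hform⟩ :=
    exists_matched_basis (X := fun i => X i.succ) hadj hends
  obtain ⟨hxX, hyX, hwX⟩ := mem_of_eq_span hX
  obtain ⟨h1eq, hLeq⟩ := ends_eq_span hX
  simp only [Fin.succ_zero_eq_one, Fin.succ_last, ← hL] at h1eq hLeq
  have hw_mem : ∀ j, w j ∈ (X 0).1 ⊓ L.1 := fun j => by
    rw [← hC]
    exact ⟨hwX 0 j, hwX (Fin.last m) j⟩
  have hx_mem : ∀ j, x j ∈ (X 1).1 := fun j => hxX 0 j (by simp)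
  have hy_mem : ∀ j, y j ∈ L.1 := fun j => hyX (Fin.last m) j (by simp)
  -- the pattern of the tail is `i ↦ i - 1`
  have hrlt : ∀ a b, r a = some b → b < a := by
    intro a b hab
    by_contra hle
    rw [not_lt, Fin.le_def] at hle
    let i : Fin m := ⟨m - 1 - b, by omega⟩
    have h2 := ((adj_iff hk).1 (hadj i)).2 (hxX i.castSucc a (by simp [i]; omega)) (y b)
      (hyX i.succ b (by simp [i]; omega))
    rw [hform, if_pos hab] at h2
    exact one_ne_zero h2
  have hperpL : ∀ i, r i = none → x i ∈ (X 1).1 ⊓ W.perp L.1 := by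
    intro i hi
    refine Submodule.mem_inf.2 ⟨hx_mem i, ?_⟩
    rw [hLeq, mem_perp_span]
    rintro _ (⟨j, rfl⟩ | ⟨j, rfl⟩)
    · rw [hform, hi]
      simp
    · exact (X 1).2.1.form_eq_zero (hx_mem i) (hwX 0 j)
  let i₀ : Fin m := ⟨0, hm⟩
  have hr0 : r i₀ = none := by
    rcases hr : r i₀ with _ | j
    · rfl
    · exact absurd (hrlt _ _ hr) (Nat.not_lt_zero _)
  have hoppL := opposite_iff_finrank.1 (opposite_comm.1 hopp)
  have hrank : finrank F ↥((X 1).1 ⊓ W.perp L.1) ≤ finrank F ↥((X 0).1 ⊓ L.1) + 1 := by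
    have h2 := finrank_inf_add_one_of_hyperplane (H := (X 0).1 ⊓ (X 1).1) (X := (X 1).1)
      (U := W.perp L.1) inf_le_right (by rw [h01.1, (X 1).2.2])
    have h3 : finrank F ↥((X 0).1 ⊓ (X 1).1 ⊓ W.perp L.1) ≤ finrank F ↥((X 0).1 ⊓ W.perp L.1) :=
      Submodule.finrank_mono (inf_le_inf_right _ inf_le_left)
    rw [inf_comm L.1] at hoppL
    omega
  have hx0C : x i₀ ∉ (X 0).1 ⊓ L.1 := by
    rw [← hC]
    intro hmem
    have h3 := hmem.2
    rw [hLeq] at h3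
    refine notMem_span_of_left hli (Set.notMem_empty i₀) (Submodule.span_mono ?_ h3)
    simp
  have hC_le' : (X 0).1 ⊓ L.1 ≤ (X 1).1 ⊓ W.perp L.1 := by
    rw [← hC]
    exact inf_le_inf_left _ (isTotallySingular_iff_le_perp.1 L.2.1).2
  have hrnone : ∀ i, r i = none → i = i₀ := by
    intro i hi
    by_contra hne
    have h2 : x i ∉ (X 0).1 ⊓ L.1 ⊔ Submodule.span F {x i₀} := by
      intro hmem
      refine notMem_span_of_left hli (s := {i₀}) (i := i) (by simpa using hne) ?_
      rw [← hC, hLeq] at hmem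
      refine sup_le (inf_le_right.trans (Submodule.span_mono ?_)) (Submodule.span_mono ?_) hmem
      · exact Set.union_subset_union_left _ Set.subset_union_right
      · simp
    have h3 : (X 0).1 ⊓ L.1 ⊔ Submodule.span F {x i₀} ⊔ Submodule.span F {x i} ≤
        (X 1).1 ⊓ W.perp L.1 :=
      sup_le (sup_le hC_le' ((Submodule.span_singleton_le_iff_mem _ _).2 (hperpL _ hr0)))
        ((Submodule.span_singleton_le_iff_mem _ _).2 (hperpL _ hi))
    have h4 := Submodule.finrank_mono h3
    rw [Submodule.finrank_sup_span_singleton h2, Submodule.finrank_sup_span_singleton hx0C] at h4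
    omega
  have hrpred : ∀ i j : Fin m, r i = some j ↔ (i : ℕ) = j + 1 := by
    have hstrong : ∀ n : ℕ, ∀ i : Fin m, (i : ℕ) = n → ∀ j, r i = some j → (i : ℕ) = j + 1 := by
      intro n
      induction n using Nat.strong_induction_on with
      | _ n ih =>
        intro i hi j hij
        have h2 := hrlt i j hij
        rw [Fin.lt_def] at h2
        by_contra hne
        -- otherwise `j + 1 < i` and both `i` and `j + 1` are mapped to `j`
        let i' : Fin m := ⟨j + 1, by omega⟩
        rcases hr : r i' with _ | j'
        · have := congrArg Fin.val (hrnone _ hr)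
          simp [i', i₀] at this
        · have h3 := ih (j + 1) (by omega) i' rfl j' hr
          have h4 : j' = j := Fin.ext (by simp only [i'] at h3; omega)
          have h5 := congrArg Fin.val (hinj _ _ _ hij (h4 ▸ hr))
          simp only [i'] at h5
          omega
    refine fun i j => ⟨hstrong i i rfl j, fun hij => ?_⟩
    rcases hr : r i with _ | j'
    · have := congrArg Fin.val (hrnone _ hr)
      simp only [i₀] at this
      omega
    · have := hstrong i i rfl j' hr
      exact congrArg some (Fin.ext (by omega))
  -- move the `x i` into `X 0`
  have hx0X0 : x i₀ ∉ (X 0).1 := by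
    intro hmem
    have h2 := Submodule.eq_of_le_of_finrank_eq (inf_le_inf_perp L (X 0)) hoppL.2.symm
    rw [inf_comm] at h2
    refine hx0C ?_
    rw [h2]
    exact ⟨hmem, (hperpL _ hr0).2⟩
  have hX1sup : (X 0).1 ⊓ (X 1).1 ⊔ Submodule.span F {x i₀} = (X 1).1 := by
    refine Submodule.eq_of_le_of_finrank_eq
      (sup_le inf_le_right ((Submodule.span_singleton_le_iff_mem _ _).2 (hx_mem _))) ?_
    rw [Submodule.finrank_sup_span_singleton
      fun h : x i₀ ∈ (X 0).1 ⊓ (X 1).1 => hx0X0 h.1, h01.1, (X 1).2.2]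
  have hcorr : ∀ i, ∃ c : F, x i - c • x i₀ ∈ (X 0).1 := by
    intro i
    have h2 := hx_mem i
    rw [← hX1sup] at h2
    obtain ⟨u, hu, v, hv, huv⟩ := Submodule.mem_sup.1 h2
    obtain ⟨c, rfl⟩ := Submodule.mem_span_singleton.1 hv
    exact ⟨c, by rw [← huv, add_sub_cancel_right]; exact hu.1⟩
  choose c hc using hcorr
  let x' : Fin m → V := fun i => if i = i₀ then x i₀ else x i - c i • x i₀
  have hx' : ∀ s, IsLowerSet s → Submodule.span F (x' '' s) = Submodule.span F (x '' s) := by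
    intro s hs
    refine span_image_eq_of_triangular (fun i => ⟨1, one_ne_zero, ?_⟩) hs
    simp only [x', one_smul]
    split_ifs with hi
    · simp [hi]
    · rw [sub_sub_cancel_left]
      refine Submodule.neg_mem _ (Submodule.smul_mem _ _ (Submodule.subset_span ⟨i₀, ?_, rfl⟩))
      have : (i : ℕ) ≠ 0 := fun h => hi (Fin.ext h)
      rw [Set.mem_Iio, Fin.lt_def]
      simp only [i₀]
      omega
  have hx'0 : ∀ i, i ≠ i₀ → x' i ∈ (X 0).1 := fun i hi => by
    simp only [x', if_neg hi]
    exact hc i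
  have hx'1 : ∀ i, x' i ∈ (X 1).1 := fun i => by
    simp only [x']
    split_ifs
    · exact hx_mem _
    · exact sub_mem (hx_mem _) (Submodule.smul_mem _ _ (hx_mem _))
  have hx'y : ∀ i j, W.form (x' i) (y j) = if (i : ℕ) = j + 1 then 1 else 0 := by
    intro i j
    have h2 : W.form (x i₀) (y j) = 0 := (hperpL _ hr0).2 _ (hy_mem j)
    have h3 : W.form (x i) (y j) = if (i : ℕ) = j + 1 then 1 else 0 := by
      simp only [hform, hrpred]
    simp only [x']
    split_ifs with hi hij hij
    · rw [hi] at hij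
      simp [i₀] at hij
    · exact h2
    · rw [form_sub_left, form_smul_left, h2, h3, if_pos hij, mul_zero, sub_zero]
    · rw [form_sub_left, form_smul_left, h2, h3, if_neg hij, mul_zero, sub_zero]
  have hli' : LinearIndependent F (Sum.elim (Sum.elim x' y) w) := by
    rw [linearIndependent_frame_iff] at hli ⊢
    rw [Submodule.span_union, Submodule.span_union] at hli ⊢
    rw [← hli]
    have := hx' Set.univ isLowerSet_univ
    rw [Set.image_univ, Set.image_univ] at this
    rw [this]
  -- the last vector `x m`
  let jl : Fin m := ⟨m - 1, by omega⟩
  have hyl : ∀ u ∈ (X 1).1, W.form u (y jl) = 0 := by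
    intro u hu
    refine (?_ : (X 1).1 ≤ W.perp (Submodule.span F {y jl})) hu _
      (Submodule.mem_span_singleton_self _)
    rw [h1eq, span_le_perp_span]
    rintro _ (⟨i, rfl⟩ | ⟨i, rfl⟩) _ rfl
    · rw [hform, if_neg]
      rw [hrpred]
      simp only [jl]
      omega
    · exact L.2.1.form_eq_zero (hwX (Fin.last m) i) (hy_mem _)
  obtain ⟨z, hz, hzy⟩ : ∃ z ∈ (X 0).1, ∀ j, W.form z (y j) = if j = jl then 1 else 0 := by
    have h2 : y jl ∉ Submodule.span F (Set.range x ∪ y '' {j | j ≠ jl} ∪ Set.range w) :=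
      notMem_span_of_right hli (by simp)
    obtain ⟨f, hf1, hf⟩ := Submodule.exists_le_ker_of_notMem h2
    obtain ⟨z, hz, hfz⟩ := exists_form_eq (W := W) (X := L.1) (Y := (X 0).1) f (by
      intro u hu
      have h3 : u ∈ (X 1).1 ⊓ L.1 := by
        rw [hC]
        exact ⟨(opposite_iff.1 hopp).2 hu, hu.1⟩
      have h4 := h3.1
      have h5 : L.1 ⊓ (X 1).1 ≤ Submodule.span F (Set.range w) := by
        rw [inf_comm]
        refine (Submodule.eq_of_le_of_finrank_le ?_ ?_).ge
        · rw [Submodule.span_le]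
          rintro _ ⟨j, rfl⟩
          exact hC ▸ hw_mem j
        · have hw : LinearIndependent F w := hli.comp Sum.inr Sum.inr_injective
          rw [finrank_span_eq_card hw, Fintype.card_fin, hC]
          omega
      exact hf (Submodule.span_mono Set.subset_union_right (h5 ⟨h3.2, h4⟩)))
    have hzy : ∀ j, W.form z (y j) = if j = jl then W.sgn * W.conj (f (y jl)) else 0 := by
      intro j
      rw [form_swap, hfz _ (hy_mem j)]
      split_ifs with hj
      · rw [hj]
      · have : f (y j) = 0 := hf (Submodule.subset_span (Or.inl (Or.inr ⟨j, hj, rfl⟩)))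
        rw [this, map_zero, mul_zero]
    have hne : W.sgn * W.conj (f (y jl)) ≠ 0 := mul_ne_zero W.sgn_ne_zero ((map_ne_zero _).2 hf1)
    refine ⟨(W.sgn * W.conj (f (y jl)))⁻¹ • z, Submodule.smul_mem _ _ hz, fun j => ?_⟩
    rw [form_smul_left, hzy]
    split_ifs
    · exact inv_mul_cancel₀ hne
    · exact mul_zero _
  have hz_not : z ∉ Submodule.span F (Set.range x' ∪ Set.range y ∪ Set.range w) := by
    intro hmem
    have h2 : Submodule.span F (Set.range x' ∪ Set.range y ∪ Set.range w) ≤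
        W.perp (Submodule.span F {y jl}) := by
      rw [Submodule.span_le]
      rintro _ ((⟨i, rfl⟩ | ⟨i, rfl⟩) | ⟨i, rfl⟩) <;> rw [SetLike.mem_coe, mem_perp_span] <;>
        rintro _ rfl
      · exact hyl _ (hx'1 i)
      · exact L.2.1.form_eq_zero (hy_mem _) (hy_mem _)
      · exact L.2.1.form_eq_zero (hw_mem _).2 (hy_mem _)
    have h3 := h2 hmem _ (Submodule.mem_span_singleton_self _)
    rw [hzy, if_pos rfl] at h3
    exact one_ne_zero h3
  have hrange : Set.range (Fin.snoc x' z : Fin (m + 1) → V) = Set.range x' ∪ {z} := by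
    rw [Fin.range_snoc, Set.union_singleton]
  have hsnoc : LinearIndependent F (Sum.elim (Sum.elim (Fin.snoc x' z : Fin (m + 1) → V) y) w) := by
    rw [linearIndependent_frame_iff] at hli' ⊢
    rw [hrange, show Set.range x' ∪ {z} ∪ Set.range y ∪ Set.range w =
      (Set.range x' ∪ Set.range y ∪ Set.range w) ∪ {z} by
        ext v; simp only [Set.mem_union]; tauto, Submodule.span_union,
      Submodule.finrank_sup_span_singleton hz_not, hli']
    omega
  refine ⟨Fin.snoc x' z, y, w, hsnoc, ?_, fun i => ?_, fun i j => ?_, fun i j => ?_⟩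
  · symm
    refine Submodule.eq_of_le_of_finrank_eq ?_ ?_
    · rw [Submodule.span_le]
      rintro _ (⟨i, hi, rfl⟩ | ⟨i, rfl⟩)
      · induction i using Fin.lastCases with
        | last => simpa using hz
        | cast i =>
          rw [Fin.snoc_castSucc]
          refine hx'0 i ?_
          rintro rfl
          exact hi rfl
      · exact (hw_mem i).1
    · have hli2 : LinearIndependent F
          (Sum.elim (Sum.elim ((Fin.snoc x' z : Fin (m + 1) → V) ∘ Fin.succ) y) w) := by
        have := hsnoc.comp (Sum.map (Sum.map Fin.succ id) id)
          (Sum.map_injective.2 ⟨Sum.map_injective.2 ⟨Fin.succ_injective m, fun _ _ => id⟩,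
            fun _ _ => id⟩)
        convert this using 1
        ext ((i | i) | i) <;> rfl
      have h2 := finrank_span_left hli2
      rw [Set.range_comp, Fin.range_succ] at h2
      rw [(X 0).2.2]
      refine h2.trans ?_
      omega
  · rw [hX i, Submodule.span_union, Submodule.span_union, Submodule.span_union,
      Submodule.span_union, ← hx']
    · congr 3
      ext v
      constructor
      · rintro ⟨j, hj, rfl⟩
        exact ⟨j.castSucc, hj, by rw [Fin.snoc_castSucc]⟩
      · rintro ⟨j, hj, rfl⟩
        have hj' : (j : ℕ) + i < m := hj
        have h2 : j = Fin.castSucc ⟨j, by omega⟩ := rfl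
        rw [h2, Fin.snoc_castSucc]
        exact ⟨_, hj, rfl⟩
    · intro j l hlj hj
      simp only [Set.mem_ofPred_eq] at hj ⊢
      have : (l : ℕ) ≤ j := hlj
      omega
  · induction i using Fin.lastCases with
    | last =>
      rw [Fin.snoc_last, hzy]
      refine if_congr ?_ rfl rfl
      simp only [Fin.ext_iff, jl, Fin.val_last, Fin.val_succ]
      omega
    | cast i =>
      rw [Fin.snoc_castSucc, hx'y]
      refine if_congr ?_ rfl rfl
      simp only [Fin.ext_iff, Fin.val_castSucc, Fin.val_succ]
  · have h2 : W.IsTotallySingular ((X 0).1 ⊔ (X 1).1) :=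
      isTotallySingular_sup_iff.2 ⟨(X 0).2.1, (X 1).2.1, h01.2⟩
    have h3 : ∀ i : Fin (m + 1), (Fin.snoc x' z : Fin (m + 1) → V) i ∈ (X 0).1 ⊔ (X 1).1 := by
      intro i
      induction i using Fin.lastCases with
      | last =>
        rw [Fin.snoc_last]
        exact Submodule.mem_sup_left hz
      | cast i =>
        rw [Fin.snoc_castSucc]
        exact Submodule.mem_sup_right (hx'1 i)
    exact h2.form_eq_zero (h3 i) (h3 j)

theorem isGeodesic_opposite_iff (hk : k < W.wittIndex) (hm : 1 ≤ m)
    {X : Fin (m + 2) → W.SingularSubspace k} :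
    (W.polarGrassmannGraph k).IsGeodesic X ∧ W.Opposite (X 0).1 (X (Fin.last (m + 1))).1 ↔
      W.HasOppositeForm k X :=
  ⟨fun h => exists_hasOppositeForm hk hm h.1 h.2, fun h => h.isGeodesic hk hm⟩

end PolarForm

/-! ### Orbits of the isometry group -/

namespace PolarForm

variable {F V : Type*} [Field F] [AddCommGroup V] [Module F V] {W : PolarForm F V} {k m : ℕ}

theorem IsIsometry.isTotallySingular_map {g : V ≃ₗ[F] V} (hg : W.IsIsometry g)
    {U : Submodule F V} :
    W.IsTotallySingular (U.map (g : V →ₗ[F] V)) ↔ W.IsTotallySingular U := by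
  simp only [isTotallySingular_iff, Submodule.mem_map, forall_exists_index, and_imp,
    forall_apply_eq_imp_iff₂, LinearEquiv.coe_coe, hg.form_map, hg.sing_map]

theorem finrank_map_eq (g : V ≃ₗ[F] V) (U : Submodule F V) :
    finrank F ↥(U.map (g : V →ₗ[F] V)) = finrank F U :=
  (LinearEquiv.finrank_eq (g.submoduleMap U)).symm

/-- The automorphism of the polar Grassmann graph induced by an isometry. -/
def isometryGraphIso (k : ℕ) {g : V ≃ₗ[F] V} (hg : W.IsIsometry g) :
    W.polarGrassmannGraph k ≃g W.polarGrassmannGraph k where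
  toFun U := ⟨U.1.map (g : V →ₗ[F] V), hg.isTotallySingular_map.2 U.2.1,
    (finrank_map_eq g U.1).trans U.2.2⟩
  invFun U := ⟨U.1.map (g.symm : V →ₗ[F] V), hg.symm.isTotallySingular_map.2 U.2.1,
    (finrank_map_eq g.symm U.1).trans U.2.2⟩
  left_inv U := Subtype.ext (by simp [← Submodule.map_comp])
  right_inv U := Subtype.ext (by simp [← Submodule.map_comp])
  map_rel_iff' := by
    intro U U'
    change (_ ∧ finrank F ↥(U.1.map (g : V →ₗ[F] V) ⊓ U'.1.map (g : V →ₗ[F] V)) + 1 = k) ∨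
      (_ ∧ W.IsTotallySingular (U.1.map (g : V →ₗ[F] V) ⊔ U'.1.map (g : V →ₗ[F] V)) ∧
        finrank F ↥(U.1.map (g : V →ₗ[F] V) ⊔ U'.1.map (g : V →ₗ[F] V)) = k + 1) ↔ _
    rw [← Submodule.map_sup, ← Submodule.map_inf _ (show Function.Injective (g : V →ₗ[F] V) from
      g.injective), hg.isTotallySingular_map, finrank_map_eq, finrank_map_eq]
    rfl

theorem isometryGraphIso_mem (k : ℕ) {g : V ≃ₗ[F] V} (hg : W.IsIsometry g) :
    isometryGraphIso k hg ∈ W.isometryAut k :=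
  ⟨g, hg, fun _ => rfl⟩

theorem IsIsometry.mem_perp_map {g : V ≃ₗ[F] V} (hg : W.IsIsometry g) {U : Submodule F V} {v : V} :
    g v ∈ W.perp (U.map (g : V →ₗ[F] V)) ↔ v ∈ W.perp U := by
  simp only [mem_perp, Submodule.mem_map, forall_exists_index, and_imp,
    forall_apply_eq_imp_iff₂, LinearEquiv.coe_coe, hg.form_map]

theorem opposite_iff_of_mem_isometryAut {φ : W.polarGrassmannGraph k ≃g W.polarGrassmannGraph k}
    (hφ : φ ∈ W.isometryAut k) (X Y : W.SingularSubspace k) :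
    W.Opposite (φ X).1 (φ Y).1 ↔ W.Opposite X.1 Y.1 := by
  obtain ⟨g, hg, hgφ⟩ := hφ
  rw [opposite_iff, opposite_iff, φ.injective.ne_iff, hgφ, hgφ]
  refine and_congr_right fun _ => ⟨fun h y hy => ?_, fun h y hy => ?_⟩
  · have h1 := h ⟨Submodule.mem_map_of_mem hy.1, hg.mem_perp_map.2 hy.2⟩
    simpa using h1
  · obtain ⟨⟨z, hz, rfl⟩, hy2⟩ := hy
    exact Submodule.mem_map_of_mem (h ⟨hz, hg.mem_perp_map.1 hy2⟩)

section Frames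

variable {a b c : ℕ}

/-- Witt's theorem for two totally singular families `x, w` and `y, w` with a prescribed matrix
of products `B(x i, y j)`. -/
theorem exists_isometry_of_frames [FiniteDimensional F V] {x x' : Fin a → V} {y y' : Fin b → V}
    {w w' : Fin c → V}
    (hli : LinearIndependent F (Sum.elim (Sum.elim x y) w))
    (hli' : LinearIndependent F (Sum.elim (Sum.elim x' y') w'))
    (hx : W.IsTotallySingular (Submodule.span F (Set.range x ∪ Set.range w)))
    (hy : W.IsTotallySingular (Submodule.span F (Set.range y ∪ Set.range w)))
    (hx' : W.IsTotallySingular (Submodule.span F (Set.range x' ∪ Set.range w')))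
    (hy' : W.IsTotallySingular (Submodule.span F (Set.range y' ∪ Set.range w')))
    (hform : ∀ i j, W.form (x i) (y j) = W.form (x' i) (y' j)) :
    ∃ g : V ≃ₗ[F] V, W.IsIsometry g ∧ (∀ i, g (x i) = x' i) ∧ (∀ i, g (y i) = y' i) ∧
      ∀ i, g (w i) = w' i := by
  have hrad : ∀ {x : Fin a → V} {y : Fin b → V} {w : Fin c → V},
      W.IsTotallySingular (Submodule.span F (Set.range x ∪ Set.range w)) →
      W.IsTotallySingular (Submodule.span F (Set.range y ∪ Set.range w)) →
      ∀ z ∈ Submodule.span F (Set.range (Sum.elim (Sum.elim x y) w)),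
        (∀ v, W.form z v = 0) → z = 0 := by
    intro x y w hx hy z hz h
    refine eq_zero_of_mem_sup hx hy ?_ h
    rw [← Submodule.span_union]
    rw [Set.Sum.elim_range, Set.Sum.elim_range] at hz
    refine Submodule.span_mono ?_ hz
    rintro v ((h | h) | h)
    · exact Or.inl (Or.inl h)
    · exact Or.inr (Or.inl h)
    · exact Or.inl (Or.inr h)
  have hr := hrad hx hy
  have hr' := hrad hx' hy'
  rw [isTotallySingular_span_iff] at hx hy hx' hy'
  have xm : ∀ {a : ℕ} (x : Fin a → V) (w : Fin c → V) i, x i ∈ Set.range x ∪ Set.range w :=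
    fun x w i => Or.inl ⟨i, rfl⟩
  have wm : ∀ {a : ℕ} (x : Fin a → V) (w : Fin c → V) i, w i ∈ Set.range x ∪ Set.range w :=
    fun x w i => Or.inr ⟨i, rfl⟩
  have hs : ∀ i, W.Sing (Sum.elim (Sum.elim x y) w i) := by
    rintro ((i | i) | i)
    · exact hx.1 _ (xm x w i)
    · exact hy.1 _ (xm y w i)
    · exact hx.1 _ (wm x w i)
  have hs' : ∀ i, W.Sing (Sum.elim (Sum.elim x' y') w' i) := by
    rintro ((i | i) | i)
    · exact hx'.1 _ (xm x' w' i)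
    · exact hy'.1 _ (xm y' w' i)
    · exact hx'.1 _ (wm x' w' i)
  have hgram : ∀ i j, W.form (Sum.elim (Sum.elim x y) w i) (Sum.elim (Sum.elim x y) w j) =
      W.form (Sum.elim (Sum.elim x' y') w' i) (Sum.elim (Sum.elim x' y') w' j) := by
    rintro ((i | i) | i) ((j | j) | j)
    · exact (hx.2 _ (xm x w i) _ (xm x w j)).trans (hx'.2 _ (xm x' w' i) _ (xm x' w' j)).symm
    · exact hform i j
    · exact (hx.2 _ (xm x w i) _ (wm x w j)).trans (hx'.2 _ (xm x' w' i) _ (wm x' w' j)).symm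
    · change W.form (y i) (x j) = W.form (y' i) (x' j)
      rw [W.form_swap, hform, ← W.form_swap]
    · exact (hy.2 _ (xm y w i) _ (xm y w j)).trans (hy'.2 _ (xm y' w' i) _ (xm y' w' j)).symm
    · exact (hy.2 _ (xm y w i) _ (wm y w j)).trans (hy'.2 _ (xm y' w' i) _ (wm y' w' j)).symm
    · exact (hx.2 _ (wm x w i) _ (xm x w j)).trans (hx'.2 _ (wm x' w' i) _ (xm x' w' j)).symm
    · exact (hy.2 _ (wm y w i) _ (xm y w j)).trans (hy'.2 _ (wm y' w' i) _ (xm y' w' j)).symm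
    · exact (hx.2 _ (wm x w i) _ (wm x w j)).trans (hx'.2 _ (wm x' w' i) _ (wm x' w' j)).symm
  obtain ⟨g, hg, hgu⟩ := exists_isometry_of_gram hli hli' hs hs' hgram hr hr'
  exact ⟨g, hg, fun i => hgu (Sum.inl (Sum.inl i)), fun i => hgu (Sum.inl (Sum.inr i)),
    fun i => hgu (Sum.inr i)⟩

theorem map_span_frame {x x' : Fin a → V} {y y' : Fin b → V} {w w' : Fin c → V} {g : V ≃ₗ[F] V}
    (hx : ∀ i, g (x i) = x' i) (hy : ∀ i, g (y i) = y' i) (hw : ∀ i, g (w i) = w' i)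
    (s : Set (Fin a)) (t : Set (Fin b)) :
    (Submodule.span F (x '' s ∪ y '' t ∪ Set.range w)).map (g : V →ₗ[F] V) =
      Submodule.span F (x' '' s ∪ y' '' t ∪ Set.range w') := by
  rw [Submodule.map_span, Set.image_union, Set.image_union, Set.image_image, Set.image_image,
    ← Set.range_comp]
  simp only [LinearEquiv.coe_coe, hx, hy, Function.comp_def, hw]

end Frames

/-- Two sequences of vertices in normal form with the same products lie in one orbit. -/
theorem exists_isometryAut_of_eq_span [FiniteDimensional F V] {x y x' y' : Fin m → V}
    {w w' : Fin (k - m) → V} {X X' : Fin (m + 1) → W.SingularSubspace k}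
    (hli : LinearIndependent F (Sum.elim (Sum.elim x y) w))
    (hli' : LinearIndependent F (Sum.elim (Sum.elim x' y') w'))
    (hX : ∀ i : Fin (m + 1), (X i).1 = Submodule.span F
      (x '' {j | (j : ℕ) + i < m} ∪ y '' {j | m ≤ (j : ℕ) + i} ∪ Set.range w))
    (hX' : ∀ i : Fin (m + 1), (X' i).1 = Submodule.span F
      (x' '' {j | (j : ℕ) + i < m} ∪ y' '' {j | m ≤ (j : ℕ) + i} ∪ Set.range w'))
    (hform : ∀ i j, W.form (x i) (y j) = W.form (x' i) (y' j)) :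
    ∃ φ ∈ W.isometryAut k, ∀ i, φ (X i) = X' i := by
  obtain ⟨h0, hl⟩ := ends_eq_span hX
  obtain ⟨h0', hl'⟩ := ends_eq_span hX'
  obtain ⟨g, hg, hgx, hgy, hgw⟩ := exists_isometry_of_frames hli hli' (h0 ▸ (X _).2.1)
    (hl ▸ (X _).2.1) (h0' ▸ (X' _).2.1) (hl' ▸ (X' _).2.1) hform
  refine ⟨isometryGraphIso k hg, isometryGraphIso_mem k hg, fun i => Subtype.ext ?_⟩
  change (X i).1.map (g : V →ₗ[F] V) = (X' i).1
  rw [hX, hX', map_span_frame hgx hgy hgw]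

theorem HasPattern.exists_isometryAut [FiniteDimensional F V] {r : Fin m → Option (Fin m)}
    {X X' : Fin (m + 1) → W.SingularSubspace k} (h : W.HasPattern k r X)
    (h' : W.HasPattern k r X') : ∃ φ ∈ W.isometryAut k, ∀ i, φ (X i) = X' i := by
  obtain ⟨x, y, w, hli, hX, hform⟩ := h
  obtain ⟨x', y', w', hli', hX', hform'⟩ := h'
  exact exists_isometryAut_of_eq_span hli hli' hX hX' fun i j => (hform i j).trans (hform' i j).symm

theorem HasOppositeForm.isTotallySingular {x : Fin (m + 1) → V} {y : Fin m → V}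
    {w : Fin (k - m) → V} {X : Fin (m + 2) → W.SingularSubspace k} (hm : 1 ≤ m)
    (h0 : (X 0).1 = Submodule.span F (x '' {j | j ≠ 0} ∪ Set.range w))
    (hX : ∀ i : Fin (m + 1), (X i.succ).1 = Submodule.span F
      (x '' {j | (j : ℕ) + i < m} ∪ y '' {j | m ≤ (j : ℕ) + i} ∪ Set.range w))
    (hxx : ∀ i j, W.form (x i) (x j) = 0) :
    W.IsTotallySingular (Submodule.span F (Set.range x ∪ Set.range w)) ∧
      W.IsTotallySingular (Submodule.span F (Set.range y ∪ Set.range w)) := by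
  have hx0 : x 0 ∈ (X (Fin.succ 0)).1 := by
    rw [hX]
    refine Submodule.subset_span (Or.inl (Or.inl ⟨0, ?_, rfl⟩))
    simp only [Set.mem_ofPred_eq, Fin.val_zero]
    omega
  have hxi : ∀ i, i ≠ 0 → x i ∈ (X 0).1 := fun i hi => by
    rw [h0]
    exact Submodule.subset_span (Or.inl ⟨i, hi, rfl⟩)
  have hw0 : ∀ i, w i ∈ (X 0).1 := fun i => by
    rw [h0]
    exact Submodule.subset_span (Or.inr ⟨i, rfl⟩)
  have hw : ∀ i j, w i ∈ (X (Fin.succ j)).1 := fun i j => by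
    rw [hX]
    exact Submodule.subset_span (Or.inr ⟨i, rfl⟩)
  have hxw : ∀ i j, W.form (x i) (w j) = 0 := by
    intro i j
    by_cases hi : i = 0
    · exact (X (Fin.succ 0)).2.1.form_eq_zero (hi ▸ hx0) (hw j 0)
    · exact (X 0).2.1.form_eq_zero (hxi i hi) (hw0 j)
  constructor
  · rw [isTotallySingular_span_iff]
    refine ⟨?_, ?_⟩
    · rintro _ (⟨i, rfl⟩ | ⟨i, rfl⟩)
      · by_cases hi : i = 0
        · exact (X (Fin.succ 0)).2.1.sing (hi ▸ hx0)
        · exact (X 0).2.1.sing (hxi i hi)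
      · exact (X 0).2.1.sing (hw0 i)
    · rintro _ (⟨i, rfl⟩ | ⟨i, rfl⟩) _ (⟨j, rfl⟩ | ⟨j, rfl⟩)
      · exact hxx i j
      · exact hxw i j
      · exact W.form_eq_zero_comm.1 (hxw j i)
      · exact (X 0).2.1.form_eq_zero (hw0 i) (hw0 j)
  · refine (X (Fin.last m).succ).2.1.mono (Submodule.span_le.2 ?_)
    rintro _ (⟨i, rfl⟩ | ⟨i, rfl⟩)
    · rw [hX]
      refine Submodule.subset_span (Or.inl (Or.inr ⟨i, ?_, rfl⟩))
      simp
    · exact hw i _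

theorem HasOppositeForm.exists_isometryAut [FiniteDimensional F V] (hm : 1 ≤ m)
    {X X' : Fin (m + 2) → W.SingularSubspace k} (h : W.HasOppositeForm k X)
    (h' : W.HasOppositeForm k X') : ∃ φ ∈ W.isometryAut k, ∀ i, φ (X i) = X' i := by
  obtain ⟨x, y, w, hli, h0, hX, hform, hxx⟩ := h
  obtain ⟨x', y', w', hli', h0', hX', hform', hxx'⟩ := h'
  obtain ⟨hP, hQ⟩ := HasOppositeForm.isTotallySingular hm h0 hX hxx
  obtain ⟨hP', hQ'⟩ := HasOppositeForm.isTotallySingular hm h0' hX' hxx'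
  obtain ⟨g, hg, hgx, hgy, hgw⟩ := exists_isometry_of_frames hli hli' hP hQ hP' hQ'
    fun i j => (hform i j).trans (hform' i j).symm
  refine ⟨isometryGraphIso k hg, isometryGraphIso_mem k hg, fun i => Subtype.ext ?_⟩
  change (X i).1.map (g : V →ₗ[F] V) = (X' i).1
  induction i using Fin.cases with
  | zero =>
    have := map_span_frame hgx hgy hgw {j | j ≠ 0} ∅
    rw [Set.image_empty, Set.image_empty, Set.union_empty, Set.union_empty] at this
    rw [h0, h0', this]
  | succ i => rw [hX, hX', map_span_frame hgx hgy hgw]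

/-! ### Existence of geodesics -/

theorem finrank_span_piecewise {x y : Fin m → V} {w : Fin (k - m) → V}
    (hli : LinearIndependent F (Sum.elim (Sum.elim x y) w)) (hmk : m ≤ k) (i : ℕ) :
    finrank F (Submodule.span F
      (x '' {j | (j : ℕ) + i < m} ∪ y '' {j | m ≤ (j : ℕ) + i} ∪ Set.range w)) = k := by
  let f : Fin m ⊕ Fin (k - m) → (Fin m ⊕ Fin m) ⊕ Fin (k - m) :=
    Sum.map (fun j => if (j : ℕ) + i < m then Sum.inl j else Sum.inr j) id
  have hf : Function.Injective f := by
    refine Sum.map_injective.2 ⟨fun j j' h => ?_, fun _ _ => id⟩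
    dsimp only at h
    split_ifs at h <;> simpa using h
  have h := finrank_span_eq_card (hli.comp f hf)
  have hr : Set.range (Sum.elim (Sum.elim x y) w ∘ f) =
      x '' {j | (j : ℕ) + i < m} ∪ y '' {j | m ≤ (j : ℕ) + i} ∪ Set.range w := by
    ext v
    constructor
    · rintro ⟨j | j, rfl⟩
      · by_cases hj : (j : ℕ) + i < m
        · exact Or.inl (Or.inl ⟨j, hj, by simp [f, hj]⟩)
        · exact Or.inl (Or.inr ⟨j, not_lt.1 hj, by simp [f, hj]⟩)
      · exact Or.inr ⟨j, rfl⟩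
    · rintro ((⟨j, hj, rfl⟩ | ⟨j, hj, rfl⟩) | ⟨j, rfl⟩)
      · have hj' : (j : ℕ) + i < m := hj
        exact ⟨Sum.inl j, by simp [f, hj']⟩
      · have hj' : ¬ (j : ℕ) + i < m := not_lt.2 hj
        exact ⟨Sum.inl j, by simp [f, hj']⟩
      · exact ⟨Sum.inr j, rfl⟩
  rw [hr] at h
  rw [h]
  simp
  omega

theorem card_unmatched {r : Fin m → Option (Fin m)}
    (hinj : ∀ i i' j, r i = some j → r i' = some j → i = i') :
    Fintype.card {j // ∀ i, r i ≠ some j} = Fintype.card {i // r i = none} := by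
  classical
  have h1 : Fintype.card {i // ¬ r i = none} = Fintype.card {j // ¬ ∀ i, r i ≠ some j} := by
    refine Fintype.card_congr (Equiv.ofBijective
      (fun i => ⟨(r i.1).get (Option.isSome_iff_ne_none.2 i.2), ?_⟩) ⟨fun i i' h => ?_, ?_⟩)
    · push Not
      exact ⟨i.1, (Option.some_get _).symm⟩
    · have h2 := congrArg (fun j => some j.1) h
      simp only [Option.some_get] at h2
      exact Subtype.ext (hinj _ _ ((r i.1).get (Option.isSome_iff_ne_none.2 i.2))
        (Option.some_get _).symm (by rw [Option.some_get, h2]))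
    · rintro ⟨j, hj⟩
      push Not at hj
      obtain ⟨i, hi⟩ := hj
      exact ⟨⟨i, by simp [hi]⟩, Subtype.ext (by simp [hi])⟩
  rw [Fintype.card_subtype_compl, Fintype.card_subtype_compl] at h1
  have h2 := Fintype.card_subtype_le fun i => r i = none
  have h3 := Fintype.card_subtype_le fun j => ∀ i, r i ≠ some j
  omega

/-- A pattern with at most `ω - k` undefined values is the pattern of some sequence. -/
theorem exists_hasPattern_of_card_le [FiniteDimensional F V] (hmk : m ≤ k) (hk : k ≤ W.wittIndex)
    {r : Fin m → Option (Fin m)} (hr : IsPattern r)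
    (hcard : Fintype.card {i // r i = none} ≤ W.wittIndex - k) :
    ∃ X : Fin (m + 1) → W.SingularSubspace k, W.HasPattern k r X := by
  classical
  obtain ⟨a, b, hab⟩ := W.exists_isHyperbolic_wittIndex
  rw [← card_unmatched hr.2] at hcard
  obtain ⟨e⟩ : Nonempty ({j // ∀ i, r i ≠ some j} ↪ Fin (W.wittIndex - k)) :=
    Function.Embedding.nonempty_of_card_le (by simpa using hcard)
  -- the position of `y j` in the hyperbolic system
  let yi : Fin m → Fin W.wittIndex ⊕ Fin W.wittIndex := fun j =>
    if h : ∃ i, r i = some j then Sum.inr ⟨h.choose, by omega⟩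
    else Sum.inl ⟨k + e ⟨j, not_exists.1 h⟩, by omega⟩
  have hyi1 : ∀ i j, r i = some j → yi j = Sum.inr ⟨i, by omega⟩ := by
    intro i j hij
    have h : ∃ i, r i = some j := ⟨i, hij⟩
    simp only [yi, dif_pos h]
    exact congrArg Sum.inr (Fin.ext (show (h.choose : ℕ) = i from
      congrArg Fin.val (hr.2 _ _ _ h.choose_spec hij)))
  have hyi2 : ∀ j (hj : ∀ i, r i ≠ some j), yi j = Sum.inl ⟨k + e ⟨j, hj⟩, by omega⟩ := by
    intro j hj
    simp only [yi, dif_neg (not_exists.2 hj)]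
  have hcases : ∀ j, (∃ i, r i = some j ∧ yi j = Sum.inr ⟨i, by omega⟩) ∨
      ∃ hj : ∀ i, r i ≠ some j, yi j = Sum.inl ⟨k + e ⟨j, hj⟩, by omega⟩ := by
    intro j
    by_cases h : ∃ i, r i = some j
    · obtain ⟨i, hi⟩ := h
      exact Or.inl ⟨i, hi, hyi1 i j hi⟩
    · exact Or.inr ⟨not_exists.1 h, hyi2 j (not_exists.1 h)⟩
  let f : (Fin m ⊕ Fin m) ⊕ Fin (k - m) → Fin W.wittIndex ⊕ Fin W.wittIndex :=
    Sum.elim (Sum.elim (fun i => Sum.inl ⟨i, by omega⟩) yi) fun j => Sum.inl ⟨m + j, by omega⟩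
  have hf : Function.Injective f := by
    rw [Sum.elim_injective, Sum.elim_injective]
    refine ⟨⟨fun i i' h => ?_, fun j j' h => ?_, fun i j h => ?_⟩, fun i i' h => ?_, ?_⟩
    · simpa [Fin.ext_iff] using h
    · rcases hcases j with ⟨i, hi, h1⟩ | ⟨hj, h1⟩ <;>
        rcases hcases j' with ⟨i', hi', h2⟩ | ⟨hj', h2⟩
      · rw [h1, h2, Sum.inr.injEq, Fin.mk.injEq, Fin.val_inj] at h
        rw [h, hi'] at hi
        exact (Option.some_inj.1 hi).symm
      · simp [h1, h2] at h
      · simp [h1, h2] at h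
      · rw [h1, h2, Sum.inl.injEq, Fin.mk.injEq, Nat.add_left_cancel_iff, Fin.val_inj,
          e.injective.eq_iff, Subtype.mk.injEq] at h
        exact h
    · rcases hcases j with ⟨i', hi, h1⟩ | ⟨hj, h1⟩
      · simp [h1] at h
      · simp only [h1, Sum.inl.injEq, Fin.mk.injEq] at h
        omega
    · simpa [Fin.ext_iff] using h
    · rintro (i | j) l h
      · simp only [Sum.elim_inl, Sum.inl.injEq, Fin.mk.injEq] at h
        omega
      · rcases hcases j with ⟨i', hi, h1⟩ | ⟨hj, h1⟩
        · simp [h1] at h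
        · simp only [Sum.elim_inr, h1, Sum.inl.injEq, Fin.mk.injEq] at h
          omega
  let x : Fin m → V := fun i => a ⟨i, by omega⟩
  let y : Fin m → V := fun j => Sum.elim a b (yi j)
  let w : Fin (k - m) → V := fun j => a ⟨m + j, by omega⟩
  have hli : LinearIndependent F (Sum.elim (Sum.elim x y) w) := by
    have := hab.linearIndependent.comp f hf
    convert this using 1
    ext ((i | i) | i) <;> rfl
  have hay : ∀ (i : Fin W.wittIndex) (j : Fin m), (i : ℕ) < k →
      W.form (a i) (y j) = if ∃ h : (i : ℕ) < m, r ⟨i, h⟩ = some j then 1 else 0 := by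
    intro i j hi
    rcases hcases j with ⟨i', hi', h1⟩ | ⟨hj, h1⟩
    · simp only [y, h1, Sum.elim_inr, hab.form_eq]
      refine if_congr ⟨fun h => ?_, fun ⟨h, h'⟩ => ?_⟩ rfl rfl
      · rw [h]
        exact ⟨i'.2, hi'⟩
      · have := hr.2 _ _ _ h' hi'
        exact Fin.ext (show (i : ℕ) = i' from congrArg Fin.val this)
    · simp only [y, h1, Sum.elim_inl, hab.form_left]
      rw [if_neg]
      rintro ⟨h, h'⟩
      exact hj _ h'
  have hxy : ∀ i j, W.form (x i) (y j) = if r i = some j then 1 else 0 := by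
    intro i j
    rw [hay _ _ (by simp; omega)]
    exact if_congr ⟨fun ⟨_, h⟩ => h, fun h => ⟨i.2, h⟩⟩ rfl rfl
  have hwy : ∀ i j, W.form (w i) (y j) = 0 := by
    intro i j
    rw [hay _ _ (by simp; omega), if_neg]
    rintro ⟨h, -⟩
    simp at h
  have hyy : ∀ i j, W.form (y i) (y j) = 0 := by
    intro i j
    rcases hcases i with ⟨i', hi, h1⟩ | ⟨hi, h1⟩ <;>
      rcases hcases j with ⟨j', hj, h2⟩ | ⟨hj, h2⟩ <;>
      simp only [y, h1, h2, Sum.elim_inl, Sum.elim_inr, hab.form_left, hab.form_right, hab.form_eq,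
        hab.form_eq', Fin.mk.injEq, ite_eq_right_iff] <;> intro h <;> omega
  have hys : ∀ i, W.Sing (y i) := by
    intro i
    rcases hcases i with ⟨i', hi, h1⟩ | ⟨hi, h1⟩ <;> simp only [y, h1, Sum.elim_inl, Sum.elim_inr]
    · exact hab.sing_right _
    · exact hab.sing_left _
  refine ⟨fun i => ⟨_, ?_, finrank_span_piecewise hli hmk i⟩, x, y, w, hli, fun i => rfl, hxy⟩
  have hxy0 : ∀ p q : Fin m, (p : ℕ) + i < m → m ≤ (q : ℕ) + i → W.form (x p) (y q) = 0 := by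
    intro p q hp hq
    rw [hxy, if_neg]
    intro h
    have := hr.1 _ _ h
    rw [Fin.lt_def] at this
    omega
  rw [isTotallySingular_span_iff]
  refine ⟨?_, ?_⟩
  · rintro _ ((⟨j, hj, rfl⟩ | ⟨j, hj, rfl⟩) | ⟨j, rfl⟩)
    · exact hab.sing_left _
    · exact hys j
    · exact hab.sing_left _
  · rintro _ ((⟨p, hp, rfl⟩ | ⟨p, hp, rfl⟩) | ⟨p, rfl⟩) _
      ((⟨q, hq, rfl⟩ | ⟨q, hq, rfl⟩) | ⟨q, rfl⟩)
    · exact hab.form_left _ _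
    · exact hxy0 p q hp hq
    · exact hab.form_left _ _
    · exact W.form_eq_zero_comm.1 (hxy0 q p hq hp)
    · exact hyy p q
    · exact W.form_eq_zero_comm.1 (hwy q p)
    · exact hab.form_left _ _
    · exact hwy p q
    · exact hab.form_left _ _

/-- The unmatched vectors `y` are orthogonal to the first term of the sequence, so they span a
totally singular subspace together with it. -/
theorem HasPattern.card_le [FiniteDimensional F V] {r : Fin m → Option (Fin m)} (hr : IsPattern r)
    {X : Fin (m + 1) → W.SingularSubspace k} (h : W.HasPattern k r X) :
    m ≤ k ∧ Fintype.card {i // r i = none} ≤ W.wittIndex - k := by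
  classical
  obtain ⟨x, y, w, hli, hX, hform⟩ := h
  obtain ⟨h0, hl⟩ := ends_eq_span hX
  obtain ⟨hxX, hyX, hwX⟩ := mem_of_eq_span hX
  have hmk := finrank_span_left hli
  rw [← h0, (X 0).2.2] at hmk
  refine ⟨by omega, ?_⟩
  rw [← card_unmatched hr.2]
  let y' : {j // ∀ i, r i ≠ some j} → V := fun j => y j
  have hli' : LinearIndependent F (Sum.elim (Sum.elim x y') w) := by
    have := hli.comp (Sum.map (Sum.map id
      (Subtype.val : {j // ∀ i, r i ≠ some j} → Fin m)) id) (Sum.map_injective.2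
      ⟨Sum.map_injective.2 ⟨fun _ _ => id, Subtype.val_injective⟩, fun _ _ => id⟩)
    convert this using 1
    ext ((i | i) | i) <;> rfl
  have hx : ∀ i, x i ∈ (X 0).1 := fun i => hxX 0 i (by simp)
  have hy : ∀ i, y i ∈ (X (Fin.last m)).1 := fun i => hyX _ i (by simp)
  have hxy : ∀ i (j : {j // ∀ i, r i ≠ some j}), W.form (x i) (y' j) = 0 := by
    intro i j
    rw [hform, if_neg (j.2 i)]
  have hts : W.IsTotallySingular (Submodule.span F (Set.range (Sum.elim (Sum.elim x y') w))) := by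
    rw [isTotallySingular_span_iff]
    refine ⟨?_, ?_⟩
    · rintro _ ⟨(i | i) | i, rfl⟩
      · exact (X 0).2.1.sing (hx i)
      · exact (X _).2.1.sing (hy i)
      · exact (X 0).2.1.sing (hwX 0 i)
    · rintro _ ⟨(i | i) | i, rfl⟩ _ ⟨(j | j) | j, rfl⟩
      · exact (X 0).2.1.form_eq_zero (hx i) (hx j)
      · exact hxy i j
      · exact (X 0).2.1.form_eq_zero (hx i) (hwX 0 j)
      · exact W.form_eq_zero_comm.1 (hxy j i)
      · exact (X _).2.1.form_eq_zero (hy i) (hy j)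
      · exact (X _).2.1.form_eq_zero (hy i) (hwX _ j)
      · exact (X 0).2.1.form_eq_zero (hwX 0 i) (hx j)
      · exact (X _).2.1.form_eq_zero (hwX _ i) (hy j)
      · exact (X 0).2.1.form_eq_zero (hwX 0 i) (hwX 0 j)
  have h1 := hts.finrank_le
  rw [finrank_span_eq_card hli'] at h1
  simp only [Fintype.card_sum, Fintype.card_fin] at h1
  omega

/-- A geodesic with opposite ends in normal form, made from any hyperbolic system. -/
theorem IsHyperbolic.exists_hasOppositeForm [FiniteDimensional F V] {a b : Fin W.wittIndex → V}
    (hab : W.IsHyperbolic a b) (hmk : m ≤ k) (hk : k < W.wittIndex) :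
    ∃ X : Fin (m + 2) → W.SingularSubspace k, W.HasOppositeForm k X ∧
      (∀ i : Fin W.wittIndex, (i : ℕ) < k → a i ∈ (X 0).1) ∧
      (∀ i : Fin W.wittIndex, (i : ℕ) < m → b i ∈ (X (Fin.last (m + 1))).1) ∧
      ∀ i : Fin W.wittIndex, m ≤ (i : ℕ) → (i : ℕ) < k → a i ∈ (X (Fin.last (m + 1))).1 := by
  let xi : Fin (m + 1) → Fin W.wittIndex :=
    Fin.cases ⟨k, hk⟩ fun i : Fin m => ⟨i, by omega⟩
  have hxi : Function.Injective xi := by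
    intro i j
    induction i using Fin.cases <;> induction j using Fin.cases <;> intro h <;>
      simp only [xi, Fin.cases_zero, Fin.cases_succ, Fin.ext_iff, Fin.val_zero,
        Fin.val_succ] at h ⊢ <;> omega
  let x : Fin (m + 1) → V := fun i => a (xi i)
  let y : Fin m → V := fun j => b ⟨j, by omega⟩
  let w : Fin (k - m) → V := fun j => a ⟨m + j, by omega⟩
  have hli : LinearIndependent F (Sum.elim (Sum.elim x y) w) := by
    have := hab.linearIndependent.comp (Sum.elim (Sum.elim (fun i => Sum.inl (xi i))
      fun j : Fin m => Sum.inr ⟨j, by omega⟩) fun j : Fin (k - m) => Sum.inl ⟨m + j, by omega⟩) (by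
        rw [Sum.elim_injective, Sum.elim_injective]
        refine ⟨⟨Sum.inl_injective.comp hxi, fun j j' h => ?_, fun i j h => ?_⟩,
          fun i i' h => ?_, ?_⟩
        · simpa [Fin.ext_iff] using h
        · simp at h
        · simpa [Fin.ext_iff] using h
        · rintro (i | j) l h
          · induction i using Fin.cases <;>
              simp only [xi, Fin.cases_zero, Fin.cases_succ, Sum.elim_inl, Sum.inl.injEq,
                Fin.mk.injEq] at h <;> omega
          · simp at h)
    convert this using 1
    ext ((i | i) | i) <;> rfl
  have hxy : ∀ i j, W.form (x i) (y j) = if i = j.succ then 1 else 0 := by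
    intro i j
    simp only [x, y, hab.form_eq]
    refine if_congr ?_ rfl rfl
    induction i using Fin.cases <;>
      simp only [xi, Fin.cases_zero, Fin.cases_succ, Fin.ext_iff, Fin.val_zero, Fin.val_succ]
    · omega
    · omega
  have hcs : LinearIndependent F (Sum.elim (Sum.elim (x ∘ Fin.castSucc) y) w) := by
    have := hli.comp (Sum.map (Sum.map Fin.castSucc id) id)
      (Sum.map_injective.2 ⟨Sum.map_injective.2 ⟨Fin.castSucc_injective m, fun _ _ => id⟩,
        fun _ _ => id⟩)
    convert this using 1
    ext ((i | i) | i) <;> rfl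
  have hs : LinearIndependent F (Sum.elim (Sum.elim (x ∘ Fin.succ) y) w) := by
    have := hli.comp (Sum.map (Sum.map Fin.succ id) id)
      (Sum.map_injective.2 ⟨Sum.map_injective.2 ⟨Fin.succ_injective m, fun _ _ => id⟩,
        fun _ _ => id⟩)
    convert this using 1
    ext ((i | i) | i) <;> rfl
  let X₀ : W.SingularSubspace k := ⟨Submodule.span F (x '' {j | j ≠ 0} ∪ Set.range w), by
    rw [isTotallySingular_span_iff]
    refine ⟨?_, ?_⟩
    · rintro _ (⟨i, -, rfl⟩ | ⟨i, rfl⟩) <;> exact hab.sing_left _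
    · rintro _ (⟨i, -, rfl⟩ | ⟨i, rfl⟩) _ (⟨j, -, rfl⟩ | ⟨j, rfl⟩) <;> exact hab.form_left _ _, by
    have h1 := finrank_span_left hs
    rw [Set.range_comp, Fin.range_succ] at h1
    refine h1.trans ?_
    omega⟩
  have hX : ∀ i : Fin (m + 1), ∃ Z : W.SingularSubspace k, Z.1 = Submodule.span F
      (x '' {j | (j : ℕ) + i < m} ∪ y '' {j | m ≤ (j : ℕ) + i} ∪ Set.range w) := by
    intro i
    have hxy0 : ∀ (p : Fin (m + 1)) (q : Fin m), (p : ℕ) + i < m → m ≤ (q : ℕ) + i →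
        W.form (x p) (y q) = 0 := by
      intro p q hp hq
      rw [hxy, if_neg]
      rintro rfl
      rw [Fin.val_succ] at hp
      omega
    have hwy : ∀ p q, W.form (w p) (y q) = 0 := by
      intro p q
      simp only [w, y, hab.form_eq, Fin.mk.injEq, ite_eq_right_iff]
      omega
    refine ⟨⟨Submodule.span F
      (x '' {j | (j : ℕ) + i < m} ∪ y '' {j | m ≤ (j : ℕ) + i} ∪ Set.range w), ?_, ?_⟩, rfl⟩
    · rw [isTotallySingular_span_iff]
      refine ⟨?_, ?_⟩
      · rintro _ ((⟨j, hj, rfl⟩ | ⟨j, hj, rfl⟩) | ⟨j, rfl⟩)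
        · exact hab.sing_left _
        · exact hab.sing_right _
        · exact hab.sing_left _
      · rintro _ ((⟨p, hp, rfl⟩ | ⟨p, hp, rfl⟩) | ⟨p, rfl⟩) _
          ((⟨q, hq, rfl⟩ | ⟨q, hq, rfl⟩) | ⟨q, rfl⟩)
        · exact hab.form_left _ _
        · exact hxy0 p q hp hq
        · exact hab.form_left _ _
        · exact W.form_eq_zero_comm.1 (hxy0 q p hq hp)
        · exact hab.form_right _ _
        · exact W.form_eq_zero_comm.1 (hwy q p)
        · exact hab.form_left _ _
        · exact hwy p q
        · exact hab.form_left _ _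
    · have h1 := finrank_span_piecewise hcs hmk i
      have h2 : x ∘ Fin.castSucc '' {j : Fin m | (j : ℕ) + i < m} =
          x '' {j | (j : ℕ) + i < m} := by
        ext v
        constructor
        · rintro ⟨j, hj, rfl⟩
          exact ⟨j.castSucc, hj, rfl⟩
        · rintro ⟨j, hj, rfl⟩
          have hj' : (j : ℕ) + i < m := hj
          exact ⟨⟨j, by omega⟩, hj, rfl⟩
      rwa [h2] at h1
  choose Z hZ using hX
  refine ⟨Fin.cons X₀ Z, ⟨x, y, w, hli, rfl, fun i => by rw [Fin.cons_succ, hZ], hxy,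
    fun i j => hab.form_left _ _⟩, fun i hi => ?_, fun i hi => ?_, fun i hi hik => ?_⟩
  · rw [Fin.cons_zero]
    by_cases him : (i : ℕ) < m
    · exact Submodule.subset_span (Or.inl ⟨Fin.succ ⟨i, him⟩, Fin.succ_ne_zero _, rfl⟩)
    · refine Submodule.subset_span (Or.inr ⟨⟨i - m, by omega⟩, ?_⟩)
      exact congrArg a (Fin.ext (show m + (i - m) = (i : ℕ) by omega))
  · rw [← Fin.succ_last, Fin.cons_succ, hZ]
    exact Submodule.subset_span (Or.inl (Or.inr ⟨⟨i, hi⟩, by simp, rfl⟩))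
  · rw [← Fin.succ_last, Fin.cons_succ, hZ]
    refine Submodule.subset_span (Or.inr ⟨⟨i - m, by omega⟩, ?_⟩)
    exact congrArg a (Fin.ext (show m + (i - m) = (i : ℕ) by omega))

end PolarForm

/-! ### Counting the neighbours that are closer -/

namespace PolarForm

variable {F V : Type*} [Field F] [AddCommGroup V] [Module F V]

/-- For non-opposite vertices `X`, `Y` with `D = Y ∩ X^⊥`, these are the subspaces spanned by a
hyperplane of `X` on `X ∩ Y` and a vector of `D` outside `X`; among them are all neighbours of `X`
that are closer to `Y`. -/
def closerSet (X Y D : Submodule F V) : Set (Submodule F V) :=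
  {Z | X ⊓ Y ≤ Z ∧ Z ≤ (Z ⊓ X) ⊔ (Z ⊓ Y) ∧ Z ⊓ Y ≤ D ∧
    finrank F ↥(Z ⊓ X) + 1 = finrank F X ∧ finrank F ↥(Z ⊓ Y) = finrank F ↥(X ⊓ Y) + 1}

theorem map_mem_closerSet (f : V ≃ₗ[F] V) {X Y D Z : Submodule F V} (hZ : Z ∈ closerSet X Y D) :
    Z.map (f : V →ₗ[F] V) ∈ closerSet (X.map (f : V →ₗ[F] V)) (Y.map (f : V →ₗ[F] V))
      (D.map (f : V →ₗ[F] V)) := by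
  obtain ⟨h1, h2, h3, h4, h5⟩ := hZ
  have hinj : Function.Injective (f : V →ₗ[F] V) := f.injective
  refine ⟨?_, ?_, ?_, ?_, ?_⟩
  · rw [← Submodule.map_inf _ hinj]
    exact Submodule.map_mono h1
  · rw [← Submodule.map_inf _ hinj, ← Submodule.map_inf _ hinj, ← Submodule.map_sup]
    exact Submodule.map_mono h2
  · rw [← Submodule.map_inf _ hinj]
    exact Submodule.map_mono h3
  · rwa [← Submodule.map_inf _ hinj, finrank_map_eq, finrank_map_eq]
  · rwa [← Submodule.map_inf _ hinj, ← Submodule.map_inf _ hinj, finrank_map_eq, finrank_map_eq]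

theorem ncard_closerSet_map_le [Finite V] (f : V ≃ₗ[F] V) (X Y D : Submodule F V) :
    (closerSet X Y D).ncard ≤ (closerSet (X.map (f : V →ₗ[F] V)) (Y.map (f : V →ₗ[F] V))
      (D.map (f : V →ₗ[F] V))).ncard := by
  rw [← Set.ncard_image_of_injective (closerSet X Y D)
    (Submodule.map_injective_of_injective (f := (f : V →ₗ[F] V)) f.injective)]
  refine Set.ncard_le_ncard ?_ (Set.toFinite _)
  rintro _ ⟨Z, hZ, rfl⟩
  exact map_mem_closerSet f hZ

theorem exists_linearEquiv_of_linearIndependent [FiniteDimensional F V] {ι : Type*} [Finite ι]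
    {u v : ι → V} (hu : LinearIndependent F u) (hv : LinearIndependent F v) :
    ∃ f : V ≃ₗ[F] V, ∀ i, f (u i) = v i := by
  have := Fintype.ofFinite ι
  obtain ⟨A, hA⟩ := Submodule.exists_isCompl (Submodule.span F (Set.range u))
  obtain ⟨B, hB⟩ := Submodule.exists_isCompl (Submodule.span F (Set.range v))
  have h1 := Submodule.finrank_add_eq_of_isCompl hA
  have h2 := Submodule.finrank_add_eq_of_isCompl hB
  rw [finrank_span_eq_card hu] at h1
  rw [finrank_span_eq_card hv] at h2
  obtain ⟨e⟩ : Nonempty (A ≃ₗ[F] B) := FiniteDimensional.nonempty_linearEquiv_of_finrank_eq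
    (by omega)
  let e' := (Basis.span hu).equiv (Basis.span hv) (Equiv.refl ι)
  refine ⟨(Submodule.prodEquivOfIsCompl _ _ hA).symm ≪≫ₗ (e'.prodCongr e) ≪≫ₗ
    Submodule.prodEquivOfIsCompl _ _ hB, fun i => ?_⟩
  have h3 : (Submodule.prodEquivOfIsCompl _ _ hA).symm (u i) = (Basis.span hu i, 0) := by
    rw [LinearEquiv.symm_apply_eq]
    simp [Basis.span_apply]
  simp only [LinearEquiv.trans_apply, h3, LinearEquiv.prodCongr_apply, map_zero, e',
    Basis.equiv_apply, Equiv.refl_apply]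
  simp [Basis.span_apply]

section Frame

variable {ι κ : Type*} {x y : ι → V} {w : κ → V}

theorem span_inf_span_frame (hli : LinearIndependent F (Sum.elim (Sum.elim x y) w)) :
    Submodule.span F (Set.range x ∪ Set.range w) ⊓ Submodule.span F (Set.range y ∪ Set.range w) =
      Submodule.span F (Set.range w) := by
  have hyw : Set.range (Sum.elim (Sum.elim x y) w ∘ Sum.map Sum.inr id) =
      Set.range y ∪ Set.range w := by
    rw [← Set.Sum.elim_range]
    congr 1
    ext (i | i) <;> rfl
  have h1 : Disjoint (Submodule.span F (Set.range x))
      (Submodule.span F (Set.range y ∪ Set.range w)) := by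
    have := hli.disjoint_span_image (s := Set.range (fun i => Sum.inl (Sum.inl i)))
      (t := Set.range (Sum.map Sum.inr id)) (by
        rw [Set.disjoint_left]
        rintro _ ⟨i, rfl⟩ ⟨(j | j), h⟩ <;> simp at h)
    rwa [← Set.range_comp, ← Set.range_comp, hyw] at this
  rw [Submodule.span_union (Set.range x), sup_comm, sup_inf_assoc_of_le _
    (Submodule.span_mono Set.subset_union_right), h1.eq_bot, sup_bot_eq]

theorem finrank_span_image_frame [Finite ι] [Finite κ]
    (hli : LinearIndependent F (Sum.elim (Sum.elim x y) w)) (U : Set ι) :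
    finrank F (Submodule.span F (y '' U ∪ Set.range w)) = U.ncard + Nat.card κ := by
  have := Fintype.ofFinite κ
  have := Fintype.ofFinite U
  have h1 : LinearIndependent F (Sum.elim (fun i : U => y i) w) := by
    have := hli.comp (Sum.map (fun i : U => Sum.inr i.1) id) (Sum.map_injective.2
      ⟨Sum.inr_injective.comp Subtype.val_injective, fun _ _ => id⟩)
    convert this using 1
    ext (i | i) <;> rfl
  have h2 := finrank_span_eq_card h1
  rw [Set.Sum.elim_range, ← Set.image_eq_range, Fintype.card_sum] at h2
  rw [h2, ← Nat.card_coe_set_eq, Nat.card_eq_fintype_card, Nat.card_eq_fintype_card]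

/-- The part of `⟨y, w⟩` orthogonal to `⟨x, w⟩` is spanned by `w` and the unmatched vectors `y`. -/
theorem span_inf_perp_frame [Finite ι] {W : PolarForm F V}
    (hy : W.IsTotallySingular (Submodule.span F (Set.range y ∪ Set.range w)))
    (hx : W.IsTotallySingular (Submodule.span F (Set.range x ∪ Set.range w)))
    (hmatch : ∀ i j j', W.form (x i) (y j) ≠ 0 → W.form (x i) (y j') ≠ 0 → j = j') :
    Submodule.span F (Set.range y ∪ Set.range w) ⊓
        W.perp (Submodule.span F (Set.range x ∪ Set.range w)) =
      Submodule.span F (y '' {j | ∀ i, W.form (x i) (y j) = 0} ∪ Set.range w) := by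
  have := Fintype.ofFinite ι
  have hwx : ∀ v ∈ Submodule.span F (Set.range w),
      v ∈ W.perp (Submodule.span F (Set.range x ∪ Set.range w)) := fun v hv =>
    (isTotallySingular_iff_le_perp.1 hx).2 (Submodule.span_mono Set.subset_union_right hv)
  refine le_antisymm ?_ (le_inf (Submodule.span_mono
    (Set.union_subset_union_left _ (Set.image_subset_range _ _))) ?_)
  · rintro v ⟨hv, hvx⟩
    rw [Submodule.span_union] at hv
    obtain ⟨u, hu, t, ht, rfl⟩ := Submodule.mem_sup.1 hv
    obtain ⟨c, rfl⟩ := Submodule.mem_span_range_iff_exists_fun F |>.1 hu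
    have hux := (W.perp _).sub_mem hvx (hwx t ht)
    rw [add_sub_cancel_right] at hux
    have hc : ∀ i j, W.form (x i) (y j) ≠ 0 → c j = 0 := by
      intro i j hij
      have h1 : W.form (∑ j, c j • y j) (x i) = 0 :=
        mem_perp.1 hux _ (Submodule.subset_span (Or.inl ⟨i, rfl⟩))
      have h2 : W.formLeft (x i) (∑ j, c j • y j) = 0 := h1
      rw [map_sum, Finset.sum_eq_single j] at h2
      · rw [map_smul, smul_eq_mul, formLeft_apply] at h2
        exact (mul_eq_zero.1 h2).resolve_right fun h => hij (W.form_eq_zero_comm.1 h)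
      · intro j' _ hj'
        rw [map_smul, formLeft_apply,
          W.form_eq_zero_comm.1 (by_contra fun h => hj' (hmatch i _ _ h hij)),
          smul_zero]
      · simp
    refine Submodule.add_mem _ (Submodule.sum_mem _ fun j _ => ?_)
      (Submodule.span_mono Set.subset_union_right ht)
    by_cases hj : ∀ i, W.form (x i) (y j) = 0
    · exact Submodule.smul_mem _ _ (Submodule.subset_span (Or.inl ⟨j, hj, rfl⟩))
    · push Not at hj
      obtain ⟨i, hi⟩ := hj
      rw [hc i j hi, zero_smul]
      exact Submodule.zero_mem _
  · rw [Submodule.span_union]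
    refine sup_le (Submodule.span_le.2 ?_) hwx
    rintro _ ⟨j, hj, rfl⟩
    rw [SetLike.mem_coe, mem_perp_span]
    rintro _ (⟨i, rfl⟩ | ⟨i, rfl⟩)
    · exact W.form_eq_zero_comm.1 (hj i)
    · exact hy.form_eq_zero (Submodule.subset_span (Or.inl ⟨j, rfl⟩))
        (Submodule.subset_span (Or.inr ⟨i, rfl⟩))

end Frame

section Strict

variable [FiniteDimensional F V] [Finite V]

theorem ncard_closerSet_lt {X Y D D' : Submodule F V} (h1 : X ⊓ Y ≤ D') (h2 : D' ≤ D)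
    (h3 : D ≤ Y) {z : V} (hzD : z ∈ D) (hz : z ∉ D') {x : V} (hx : x ∈ X) (hxY : x ∉ Y) :
    (closerSet X Y D').ncard < (closerSet X Y D).ncard := by
  refine Set.ncard_lt_ncard ⟨fun Z ⟨a, b, c, d⟩ => ⟨a, b, c.trans h2, d⟩, fun hsub => ?_⟩
    (Set.toFinite _)
  obtain ⟨H, hH1, hH2, -, hH3⟩ := exists_hyperplane (A := X ⊓ Y) inf_le_left hx
    fun h => hxY h.2
  have hzX : z ∉ X := fun h => hz (h1 ⟨h, h3 hzD⟩)
  have hinfX : (H ⊔ Submodule.span F {z}) ⊓ X = H := by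
    rw [inf_comm, inf_sup_span_singleton hH2 hzX]
  have hHY : H ⊓ Y = X ⊓ Y := le_antisymm (inf_le_inf_right _ hH2) (le_inf hH1 inf_le_right)
  have hinfY : (H ⊔ Submodule.span F {z}) ⊓ Y = X ⊓ Y ⊔ Submodule.span F {z} := by
    rw [sup_comm, sup_inf_assoc_of_le _ ((Submodule.span_singleton_le_iff_mem _ _).2 (h3 hzD)),
      hHY, sup_comm]
  have hmem : H ⊔ Submodule.span F {z} ∈ closerSet X Y D := by
    refine ⟨hH1.trans le_sup_left, ?_, ?_, ?_, ?_⟩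
    · rw [hinfX, hinfY]
      exact sup_le le_sup_left (le_sup_right.trans le_sup_right)
    · rw [hinfY]
      exact sup_le (h1.trans h2) ((Submodule.span_singleton_le_iff_mem _ _).2 hzD)
    · rw [hinfX, hH3]
    · rw [hinfY]
      exact Submodule.finrank_sup_span_singleton fun h => hzX h.1
  have h4 := (hsub hmem).2.2.1
  rw [hinfY] at h4
  exact hz (h4 (le_sup_right (a := X ⊓ Y) (Submodule.mem_span_singleton_self z)))

/-- Two frames: the second set of closer subspaces is larger if more of the vectors `y` are
admitted. -/
theorem ncard_closerSet_lt_of_card_lt {ι κ : Type*} [Fintype ι] [Finite κ] {x y x' y' : ι → V}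
    {w w' : κ → V}
    (hli : LinearIndependent F (Sum.elim (Sum.elim x y) w))
    (hli' : LinearIndependent F (Sum.elim (Sum.elim x' y') w')) {U U' : Set ι}
    (hcard : U'.ncard < U.ncard) :
    (closerSet (Submodule.span F (Set.range x' ∪ Set.range w'))
      (Submodule.span F (Set.range y' ∪ Set.range w'))
      (Submodule.span F (y' '' U' ∪ Set.range w'))).ncard <
    (closerSet (Submodule.span F (Set.range x ∪ Set.range w))
      (Submodule.span F (Set.range y ∪ Set.range w))
      (Submodule.span F (y '' U ∪ Set.range w))).ncard := by
  classical
  obtain ⟨U₁, hU₁, hU₁c⟩ := Set.exists_subset_card_eq hcard.le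
  obtain ⟨e⟩ : Nonempty (U' ≃ U₁) :=
    Finite.card_eq.1 hU₁c.symm
  let π : Equiv.Perm ι := e.extendSubtype
  have hπ : π '' U' = U₁ := by
    ext i
    constructor
    · rintro ⟨j, hj, rfl⟩
      exact e.extendSubtype_mem j hj
    · intro hi
      refine ⟨e.symm ⟨i, hi⟩, (e.symm ⟨i, hi⟩).2, ?_⟩
      rw [e.extendSubtype_apply_of_mem _ (e.symm ⟨i, hi⟩).2]
      simp
  have hliπ : LinearIndependent F (Sum.elim (Sum.elim x (y ∘ π)) w) := by
    have := hli.comp (Sum.map (Sum.map id π) id) (Sum.map_injective.2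
      ⟨Sum.map_injective.2 ⟨fun _ _ => id, π.injective⟩, fun _ _ => id⟩)
    convert this using 1
    ext ((i | i) | i) <;> rfl
  obtain ⟨f, hf⟩ := exists_linearEquiv_of_linearIndependent hli' hliπ
  have hfx : (f : V →ₗ[F] V) '' Set.range x' = Set.range x := by
    rw [← Set.range_comp]
    exact congrArg Set.range (funext fun i => hf (Sum.inl (Sum.inl i)))
  have hfw : (f : V →ₗ[F] V) '' Set.range w' = Set.range w := by
    rw [← Set.range_comp]
    exact congrArg Set.range (funext fun i => hf (Sum.inr i))
  have hfy : ∀ s : Set ι, (f : V →ₗ[F] V) '' (y' '' s) = y '' (π '' s) := by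
    intro s
    rw [Set.image_image, Set.image_image]
    exact Set.image_congr fun i _ => hf (Sum.inl (Sum.inr i))
  refine (ncard_closerSet_map_le f _ _ _).trans_lt ?_
  have hfy' := hfy Set.univ
  rw [Set.image_univ, Set.image_univ, π.surjective.range_eq, Set.image_univ] at hfy'
  rw [Submodule.map_span, Submodule.map_span, Submodule.map_span, Set.image_union,
    Set.image_union, Set.image_union, hfx, hfy', hfw, hfy, hπ]
  obtain ⟨u, huU, hu⟩ := Set.exists_mem_notMem_of_ncard_lt_ncard (hU₁c.trans_lt hcard)
  have hyu : ∀ s : Set ((ι ⊕ ι) ⊕ κ), Sum.inl (Sum.inr u) ∉ s →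
      y u ∉ Submodule.span F (Sum.elim (Sum.elim x y) w '' s) :=
    fun s hs => hli.notMem_span_image hs
  have hxu : x u ∉ Submodule.span F (Set.range y ∪ Set.range w) := by
    have := hli.notMem_span_image (s := Set.range (Sum.map Sum.inr id)) (x := Sum.inl (Sum.inl u))
      (by simp)
    rw [← Set.range_comp, show Set.range (Sum.elim (Sum.elim x y) w ∘ Sum.map Sum.inr id) =
      Set.range y ∪ Set.range w by
        rw [← Set.Sum.elim_range]
        congr 1
        ext (i | i) <;> rfl] at this
    exact this
  refine ncard_closerSet_lt (z := y u) (x := x u) ?_ (Submodule.span_mono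
    (Set.union_subset_union_left _ (Set.image_mono hU₁))) (Submodule.span_mono
    (Set.union_subset_union_left _ (Set.image_subset_range _ _)))
    (Submodule.subset_span (Or.inl ⟨u, huU, rfl⟩)) (fun h => ?_)
    (Submodule.subset_span (Or.inl ⟨u, rfl⟩)) hxu
  · rw [span_inf_span_frame hli]
    exact Submodule.span_mono Set.subset_union_right
  · refine hyu ((fun i => Sum.inl (Sum.inr i)) '' U₁ ∪ Set.range Sum.inr) (by simpa using hu) ?_
    convert h using 2
    rw [Set.image_union, Set.image_image, ← Set.range_comp]
    rfl

end Strict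

variable {W : PolarForm F V} {k m : ℕ}

theorem dist_map {α : Type*} {G : SimpleGraph α} (φ : G ≃g G) (x y : α) :
    G.dist (φ x) (φ y) = G.dist x y := by
  rw [SimpleGraph.dist_eq_sInf, SimpleGraph.dist_eq_sInf]
  congr 1
  ext n
  constructor
  · rintro ⟨p, rfl⟩
    exact ⟨(p.map φ.symm.toHom).copy (φ.symm_apply_apply x) (φ.symm_apply_apply y), by simp⟩
  · rintro ⟨p, rfl⟩
    exact ⟨p.map φ.toHom, by simp⟩

theorem ncard_closer_map (φ : W.polarGrassmannGraph k ≃g W.polarGrassmannGraph k)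
    (X Y : W.SingularSubspace k) :
    {Z | (W.polarGrassmannGraph k).Adj (φ X) Z ∧ (W.polarGrassmannGraph k).dist Z (φ Y) + 1 =
        (W.polarGrassmannGraph k).dist (φ X) (φ Y)}.ncard =
    {Z | (W.polarGrassmannGraph k).Adj X Z ∧
      (W.polarGrassmannGraph k).dist Z Y + 1 = (W.polarGrassmannGraph k).dist X Y}.ncard := by
  rw [← Set.ncard_image_of_injective {Z | (W.polarGrassmannGraph k).Adj X Z ∧ _} φ.injective]
  congr 1
  ext Z
  constructor
  · rintro ⟨h1, h2⟩
    obtain ⟨Z, rfl⟩ := φ.surjective Z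
    rw [dist_map, dist_map] at h2
    exact ⟨Z, ⟨φ.map_adj_iff.1 h1, h2⟩, rfl⟩
  · rintro ⟨Z, ⟨h1, h2⟩, rfl⟩
    exact ⟨φ.map_adj_iff.2 h1, by rw [dist_map, dist_map]; exact h2⟩

section Patterns

/-- The values in `[a, b)` that a pattern does not assume on `[0, b)` or, equivalently, on `[a, b)`,
as it takes these values only at larger indices. -/
def unmatchedIn (r : Fin m → Option (Fin m)) (a b : ℕ) : Set (Fin m) :=
  {q | a ≤ q ∧ (q : ℕ) < b ∧ ∀ p : Fin m, (p : ℕ) < b → r p ≠ some q}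

/-- Comparing the numbers for `[q, b)` and `[q + 1, b)` shows whether `q` is a value of the pattern
on `[0, b)`; varying `b`, this determines where the value `q` is taken. -/
theorem IsPattern.eq_of_ncard_unmatchedIn_eq {r r' : Fin m → Option (Fin m)} (hr : IsPattern r)
    (hr' : IsPattern r')
    (h : ∀ a b, a ≤ b → b ≤ m → (unmatchedIn r a b).ncard = (unmatchedIn r' a b).ncard) :
    r = r' := by
  classical
  have hstep : ∀ (r : Fin m → Option (Fin m)) (q : Fin m) (b : ℕ), (q : ℕ) < b →
      (unmatchedIn r q b).ncard = (unmatchedIn r (q + 1) b).ncard +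
        if ∀ p : Fin m, (p : ℕ) < b → r p ≠ some q then 1 else 0 := by
    intro r q b hqb
    split_ifs with hq
    · have h1 : unmatchedIn r q b = insert q (unmatchedIn r (q + 1) b) := by
        ext p
        simp only [unmatchedIn, Set.mem_insert_iff, Set.mem_ofPred_eq]
        constructor
        · rintro ⟨h1, h2, h3⟩
          by_cases hpq : p = q
          · exact Or.inl hpq
          · exact Or.inr ⟨by rw [Fin.ext_iff] at hpq; omega, h2, h3⟩
        · rintro (rfl | ⟨h1, h2, h3⟩)
          · exact ⟨le_rfl, hqb, hq⟩
          · exact ⟨by omega, h2, h3⟩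
      rw [h1, Set.ncard_insert_of_notMem (fun h => by have := h.1; omega) (Set.toFinite _)]
    · have h1 : unmatchedIn r q b = unmatchedIn r (q + 1) b := by
        ext p
        simp only [unmatchedIn, Set.mem_ofPred_eq]
        constructor
        · rintro ⟨h1, h2, h3⟩
          refine ⟨Nat.lt_of_le_of_ne h1 fun h => hq ?_, h2, h3⟩
          rwa [Fin.ext h]
        · rintro ⟨h1, h2, h3⟩
          exact ⟨by omega, h2, h3⟩
      rw [h1, add_zero]
  have key : ∀ (q : Fin m) (b : ℕ), b ≤ m → (∃ p : Fin m, (p : ℕ) < b ∧ r p = some q) →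
      ∃ p : Fin m, (p : ℕ) < b ∧ r' p = some q := by
    rintro q b hb ⟨p, hpb, hp⟩
    have hqb : (q : ℕ) < b := (Fin.lt_def.1 (hr.1 _ _ hp)).trans hpb
    have h1 := hstep r q b hqb
    have h2 := hstep r' q b hqb
    have h4 := h q b hqb.le hb
    have h5 := h (q + 1) b hqb hb
    rw [if_neg (fun h => h p hpb hp)] at h1
    split_ifs at h2 with h3
    · omega
    · push Not at h3
      exact h3
  have key' : ∀ (q : Fin m) (b : ℕ), b ≤ m → (∃ p : Fin m, (p : ℕ) < b ∧ r' p = some q) →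
      ∃ p : Fin m, (p : ℕ) < b ∧ r p = some q := by
    rintro q b hb ⟨p, hpb, hp⟩
    have hqb : (q : ℕ) < b := (Fin.lt_def.1 (hr'.1 _ _ hp)).trans hpb
    have h1 := hstep r q b hqb
    have h2 := hstep r' q b hqb
    have h4 := h q b hqb.le hb
    have h5 := h (q + 1) b hqb hb
    rw [if_neg (fun h => h p hpb hp)] at h2
    split_ifs at h1 with h3
    · omega
    · push Not at h3
      exact h3
  funext p
  refine Option.ext fun q => ⟨fun hp => ?_, fun hp => ?_⟩
  · obtain ⟨p', hp', h1⟩ := key q (p + 1) p.2 ⟨p, by omega, hp⟩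
    obtain ⟨p'', hp'', h2⟩ := key' q (p' + 1) p'.2 ⟨p', by omega, h1⟩
    obtain rfl := hr.2 _ _ _ hp h2
    rwa [show p = p' from Fin.ext (by omega)]
  · obtain ⟨p', hp', h1⟩ := key' q (p + 1) p.2 ⟨p, by omega, hp⟩
    obtain ⟨p'', hp'', h2⟩ := key q (p' + 1) p'.2 ⟨p', by omega, h1⟩
    obtain rfl := hr'.2 _ _ _ hp h2
    rwa [show p = p' from Fin.ext (by omega)]

end Patterns

/-- The frame for two members of a sequence in normal form. -/
theorem frame_of_eq_span {x y : Fin m → V} {w : Fin (k - m) → V}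
    {X : Fin (m + 1) → W.SingularSubspace k}
    (hli : LinearIndependent F (Sum.elim (Sum.elim x y) w))
    (hX : ∀ i : Fin (m + 1), (X i).1 = Submodule.span F
      (x '' {j | (j : ℕ) + i < m} ∪ y '' {j | m ≤ (j : ℕ) + i} ∪ Set.range w))
    {a b : ℕ} (hab : a ≤ b) (hb : b ≤ m) :
    ∃ w' : {p : Fin m // (p : ℕ) < a ∨ b ≤ p} ⊕ Fin (k - m) → V,
      LinearIndependent F (Sum.elim (Sum.elim (fun p : {p : Fin m // a ≤ p ∧ (p : ℕ) < b} => x p)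
        (fun p : {p : Fin m // a ≤ p ∧ (p : ℕ) < b} => y p)) w') ∧
      (X ⟨m - b, by omega⟩).1 = Submodule.span F
        (Set.range (fun p : {p : Fin m // a ≤ p ∧ (p : ℕ) < b} => x p) ∪ Set.range w') ∧
      (X ⟨m - a, by omega⟩).1 = Submodule.span F
        (Set.range (fun p : {p : Fin m // a ≤ p ∧ (p : ℕ) < b} => y p) ∪ Set.range w') := by
  classical
  let f : {p : Fin m // (p : ℕ) < a ∨ b ≤ p} → Fin m ⊕ Fin m := fun p =>
    if (p.1 : ℕ) < a then Sum.inl p.1 else Sum.inr p.1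
  have hf1 : ∀ p : {p : Fin m // (p : ℕ) < a ∨ b ≤ p}, (p.1 : ℕ) < a → f p = Sum.inl p.1 :=
    fun p hp => if_pos hp
  have hf2 : ∀ p : {p : Fin m // (p : ℕ) < a ∨ b ≤ p}, ¬ (p.1 : ℕ) < a → f p = Sum.inr p.1 :=
    fun p hp => if_neg hp
  refine ⟨Sum.elim (Sum.elim x y ∘ f) w, ?_, ?_, ?_⟩
  · have := hli.comp (Sum.elim (Sum.elim
      (fun p : {p : Fin m // a ≤ p ∧ (p : ℕ) < b} => Sum.inl (Sum.inl p.1))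
      (fun p : {p : Fin m // a ≤ p ∧ (p : ℕ) < b} => Sum.inl (Sum.inr p.1)))
      (Sum.elim (fun p => Sum.inl (f p)) Sum.inr)) ?_
    · convert this using 1
      ext ((i | i) | (i | i)) <;> rfl
    · rw [Sum.elim_injective, Sum.elim_injective, Sum.elim_injective]
      refine ⟨⟨fun p p' h => ?_, fun p p' h => ?_, fun p p' h => ?_⟩,
        ⟨fun p p' h => ?_, Sum.inr_injective, fun p p' h => ?_⟩, ?_⟩
      · simpa [Subtype.ext_iff] using h
      · simpa [Subtype.ext_iff] using h
      · simp at h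
      · have h' := Sum.inl_injective h
        by_cases h1 : (p.1 : ℕ) < a <;> by_cases h2 : (p'.1 : ℕ) < a
        · rw [hf1 _ h1, hf1 _ h2] at h'
          exact Subtype.ext (Sum.inl_injective h')
        · rw [hf1 _ h1, hf2 _ h2] at h'
          cases h'
        · rw [hf2 _ h1, hf1 _ h2] at h'
          cases h'
        · rw [hf2 _ h1, hf2 _ h2] at h'
          exact Subtype.ext (Sum.inr_injective h')
      · simp at h
      · rintro (p | p) (p' | p') h
        · have h' := Sum.inl_injective h
          by_cases h2 : (p'.1 : ℕ) < a
          · rw [hf1 _ h2] at h'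
            have h3 := congrArg Fin.val (Sum.inl_injective h')
            have := p.2
            omega
          · rw [hf2 _ h2] at h'
            cases h'
        · simp at h
        · have h' := Sum.inl_injective h
          by_cases h2 : (p'.1 : ℕ) < a
          · rw [hf1 _ h2] at h'
            cases h'
          · rw [hf2 _ h2] at h'
            have h3 := congrArg Fin.val (Sum.inr_injective h')
            have := p.2
            have := p'.2
            omega
        · simp at h
  · rw [hX, Set.Sum.elim_range, ← Set.union_assoc]
    congr 2
    ext v
    constructor
    · rintro (⟨p, hp, rfl⟩ | ⟨p, hp, rfl⟩)
      · simp only [Set.mem_ofPred_eq] at hp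
        by_cases h1 : (p : ℕ) < a
        · exact Or.inr ⟨⟨p, Or.inl h1⟩, by simp [hf1 ⟨p, Or.inl h1⟩ h1]⟩
        · exact Or.inl ⟨⟨p, by omega, by omega⟩, rfl⟩
      · simp only [Set.mem_ofPred_eq] at hp
        have h1 : b ≤ p := by omega
        refine Or.inr ⟨⟨p, Or.inr h1⟩, ?_⟩
        rw [Function.comp_apply, hf2 ⟨p, Or.inr h1⟩ (by simp only; omega), Sum.elim_inr]
    · rintro (⟨p, rfl⟩ | ⟨p, rfl⟩)
      · have := p.2
        exact Or.inl ⟨p.1, by simp only [Set.mem_ofPred_eq]; omega, rfl⟩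
      · have := p.2
        by_cases h1 : (p.1 : ℕ) < a
        · exact Or.inl ⟨p.1, by simp only [Set.mem_ofPred_eq]; omega, by simp [hf1 p h1]⟩
        · exact Or.inr ⟨p.1, by simp only [Set.mem_ofPred_eq]; omega, by simp [hf2 p h1]⟩
  · rw [hX, Set.Sum.elim_range, ← Set.union_assoc]
    congr 2
    ext v
    constructor
    · rintro (⟨p, hp, rfl⟩ | ⟨p, hp, rfl⟩)
      · simp only [Set.mem_ofPred_eq] at hp
        have h1 : (p : ℕ) < a := by omega
        exact Or.inr ⟨⟨p, Or.inl h1⟩, by simp [hf1 ⟨p, Or.inl h1⟩ h1]⟩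
      · simp only [Set.mem_ofPred_eq] at hp
        by_cases h1 : b ≤ p
        · refine Or.inr ⟨⟨p, Or.inr h1⟩, ?_⟩
          rw [Function.comp_apply, hf2 ⟨p, Or.inr h1⟩ (by simp only; omega), Sum.elim_inr]
        · exact Or.inl ⟨⟨p, by omega, by omega⟩, rfl⟩
    · rintro (⟨p, rfl⟩ | ⟨p, rfl⟩)
      · have := p.2
        exact Or.inr ⟨p.1, by simp only [Set.mem_ofPred_eq]; omega, rfl⟩
      · have := p.2
        by_cases h1 : (p.1 : ℕ) < a
        · exact Or.inl ⟨p.1, by simp only [Set.mem_ofPred_eq]; omega, by simp [hf1 p h1]⟩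
        · exact Or.inr ⟨p.1, by simp only [Set.mem_ofPred_eq]; omega, by simp [hf2 p h1]⟩

variable [FiniteDimensional F V]

/-- The intersection with `Y` increases by one dimension at each step of a shortest path to `Y`. -/
theorem mem_closerSet_of_adj (hk : k < W.wittIndex) {X Y Z : W.SingularSubspace k}
    (hXY : ¬ W.Opposite X.1 Y.1) (hXZ : (W.polarGrassmannGraph k).Adj X Z)
    (hd : (W.polarGrassmannGraph k).dist Z Y + 1 = (W.polarGrassmannGraph k).dist X Y) :
    Z.1 ∈ closerSet X.1 Y.1 (Y.1 ⊓ W.perp X.1) := by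
  have h1 := dist_of_not_opposite hk hXY
  obtain ⟨h2, h3⟩ := (adj_iff hk).1 hXZ
  have h4 := finrank_inf_add_finrank_inf_le X.1 Y.1 Z.1
  have h5 : finrank F ↥(X.1 ⊓ Z.1 ⊓ Y.1) ≤ finrank F ↥(X.1 ⊓ Y.1) :=
    Submodule.finrank_mono (inf_le_inf_right _ inf_le_left)
  rw [Z.2.2] at h4
  have h6 : finrank F ↥(Z.1 ⊓ Y.1) = finrank F ↥(X.1 ⊓ Y.1) + 1 := by
    by_cases hZY : W.Opposite Z.1 Y.1
    · have := hZY.dist_eq hk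
      omega
    · have := dist_of_not_opposite hk hZY
      omega
  have h7 : X.1 ⊓ Z.1 ⊓ Y.1 = X.1 ⊓ Y.1 :=
    Submodule.eq_of_le_of_finrank_le (inf_le_inf_right _ inf_le_left) (by omega)
  have h8 : (Z.1 ⊓ X.1) ⊔ (Z.1 ⊓ Y.1) = Z.1 := by
    refine Submodule.eq_of_le_of_finrank_le (sup_le inf_le_left inf_le_left) ?_
    have h9 := Submodule.finrank_sup_add_finrank_inf_eq (Z.1 ⊓ X.1) (Z.1 ⊓ Y.1)
    rw [← inf_inf_distrib_left, ← inf_assoc, inf_comm Z.1 X.1, h7] at h9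
    rw [Z.2.2, inf_comm Z.1 X.1]
    omega
  refine ⟨?_, h8.ge, le_inf inf_le_right (inf_le_left.trans (le_perp_comm.1 h3)), ?_, h6⟩
  · rw [← h7]
    exact inf_le_left.trans inf_le_right
  · rw [inf_comm, h2, X.2.2]

theorem exists_adj_of_mem_closerSet (hk : k < W.wittIndex) {X Y : W.SingularSubspace k}
    (hD : finrank F ↥(X.1 ⊓ Y.1) + 2 ≤ finrank F ↥(Y.1 ⊓ W.perp X.1)) {Z : Submodule F V}
    (hZ : Z ∈ closerSet X.1 Y.1 (Y.1 ⊓ W.perp X.1)) :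
    ∃ Z' : W.SingularSubspace k, Z'.1 = Z ∧ (W.polarGrassmannGraph k).Adj X Z' ∧
      (W.polarGrassmannGraph k).dist Z' Y + 1 = (W.polarGrassmannGraph k).dist X Y := by
  obtain ⟨h1, h2, h3, h4, h5⟩ := hZ
  have h6 : (Z ⊓ X.1) ⊔ (Z ⊓ Y.1) = Z := le_antisymm (sup_le inf_le_left inf_le_left) h2
  have h7 := Submodule.finrank_sup_add_finrank_inf_eq (Z ⊓ X.1) (Z ⊓ Y.1)
  rw [← inf_inf_distrib_left, inf_eq_right.2 h1, h6, h5] at h7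
  rw [X.2.2] at h4
  have hXperp := (isTotallySingular_iff_le_perp.1 X.2.1).2
  have hZX : Z ≤ W.perp X.1 := by
    rw [← h6]
    exact sup_le (inf_le_right.trans hXperp) (h3.trans inf_le_right)
  have hts : W.IsTotallySingular Z := by
    rw [← h6, isTotallySingular_sup_iff]
    refine ⟨X.2.1.mono inf_le_right, Y.2.1.mono inf_le_right, ?_⟩
    exact inf_le_right.trans (le_perp_comm.1 (h3.trans inf_le_right))
  let Z' : W.SingularSubspace k := ⟨Z, hts, by omega⟩
  have hadj : (W.polarGrassmannGraph k).Adj X Z' :=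
    (adj_iff hk).2 ⟨by rw [inf_comm]; exact h4, le_perp_comm.1 hZX⟩
  have hXY : ¬ W.Opposite X.1 Y.1 := fun h => by
    have := (opposite_iff_finrank.1 h).2
    omega
  have hZY : ¬ W.Opposite Z'.1 Y.1 := by
    intro h
    have h8 := (opposite_iff_finrank.1 h).2
    rw [finrank_inf_perp_comm'] at h8
    rw [finrank_inf_perp_comm'] at hD
    change finrank F ↥(Z ⊓ W.perp Y.1) = finrank F ↥(Z ⊓ Y.1) at h8
    -- `Z` meets `X ∩ Y^⊥` in a hyperplane at least
    have h9 := finrank_inf_add_finrank_inf_le Z (W.perp Y.1) X.1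
    have h10 : finrank F ↥(Z ⊓ X.1 ⊓ W.perp Y.1 ⊔ Z ⊓ Y.1) ≤ finrank F ↥(Z ⊓ W.perp Y.1) :=
      Submodule.finrank_mono (sup_le (inf_le_inf_right _ inf_le_left)
        (inf_le_inf_left _ (isTotallySingular_iff_le_perp.1 Y.2.1).2))
    have h11 := Submodule.finrank_sup_add_finrank_inf_eq (Z ⊓ X.1 ⊓ W.perp Y.1) (Z ⊓ Y.1)
    have h12 : finrank F ↥(Z ⊓ X.1 ⊓ W.perp Y.1 ⊓ (Z ⊓ Y.1)) ≤ finrank F ↥(X.1 ⊓ Y.1) :=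
      Submodule.finrank_mono (le_inf (inf_le_left.trans (inf_le_left.trans inf_le_right))
        (inf_le_right.trans inf_le_right))
    rw [X.2.2] at h9
    omega
  refine ⟨Z', rfl, hadj, ?_⟩
  have h13 := dist_of_not_opposite hk hXY
  have h14 := dist_of_not_opposite hk hZY
  change finrank F ↥(Z ⊓ Y.1) + _ = k at h14
  omega

theorem ncard_closer_le [Finite V] (hk : k < W.wittIndex) {X Y : W.SingularSubspace k}
    (hXY : ¬ W.Opposite X.1 Y.1) :
    {Z | (W.polarGrassmannGraph k).Adj X Z ∧
      (W.polarGrassmannGraph k).dist Z Y + 1 = (W.polarGrassmannGraph k).dist X Y}.ncard ≤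
    (closerSet X.1 Y.1 (Y.1 ⊓ W.perp X.1)).ncard := by
  rw [← Set.ncard_image_of_injective _ Subtype.val_injective]
  refine Set.ncard_le_ncard ?_ (Set.toFinite _)
  rintro _ ⟨Z, ⟨h1, h2⟩, rfl⟩
  exact mem_closerSet_of_adj hk hXY h1 h2

theorem le_ncard_closer [Finite V] (hk : k < W.wittIndex) {X Y : W.SingularSubspace k}
    (hD : finrank F ↥(X.1 ⊓ Y.1) + 2 ≤ finrank F ↥(Y.1 ⊓ W.perp X.1)) :
    (closerSet X.1 Y.1 (Y.1 ⊓ W.perp X.1)).ncard ≤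
    {Z | (W.polarGrassmannGraph k).Adj X Z ∧
      (W.polarGrassmannGraph k).dist Z Y + 1 = (W.polarGrassmannGraph k).dist X Y}.ncard := by
  rw [← Set.ncard_image_of_injective {Z | _} Subtype.val_injective]
  refine Set.ncard_le_ncard ?_ (Set.toFinite _)
  intro Z hZ
  obtain ⟨Z', rfl, h1, h2⟩ := exists_adj_of_mem_closerSet hk hD hZ
  exact ⟨Z', ⟨h1, h2⟩, rfl⟩

/-- An automorphism of the graph preserves the number of unmatched vectors of a frame. -/
theorem ncard_unmatched_le [Finite V] (hk : k < W.wittIndex) {ι κ : Type*} [Finite ι] [Finite κ]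
    {x y x' y' : ι → V} {w w' : κ → V}
    (hli : LinearIndependent F (Sum.elim (Sum.elim x y) w))
    (hli' : LinearIndependent F (Sum.elim (Sum.elim x' y') w'))
    (hmatch : ∀ i j j', W.form (x i) (y j) ≠ 0 → W.form (x i) (y j') ≠ 0 → j = j')
    (hmatch' : ∀ i j j', W.form (x' i) (y' j) ≠ 0 → W.form (x' i) (y' j') ≠ 0 → j = j')
    {X Y X' Y' : W.SingularSubspace k}
    (hX : X.1 = Submodule.span F (Set.range x ∪ Set.range w))
    (hY : Y.1 = Submodule.span F (Set.range y ∪ Set.range w))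
    (hX' : X'.1 = Submodule.span F (Set.range x' ∪ Set.range w'))
    (hY' : Y'.1 = Submodule.span F (Set.range y' ∪ Set.range w'))
    {φ : W.polarGrassmannGraph k ≃g W.polarGrassmannGraph k} (hφX : φ X = X') (hφY : φ Y = Y')
    (hpos : {j | ∀ i, W.form (x i) (y j) = 0}.Nonempty) :
    {j | ∀ i, W.form (x' i) (y' j) = 0}.ncard ≤ {j | ∀ i, W.form (x i) (y j) = 0}.ncard := by
  have := Fintype.ofFinite ι
  by_contra! hlt
  have hD := span_inf_perp_frame (hY ▸ Y.2.1) (hX ▸ X.2.1) hmatch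
  have hD' := span_inf_perp_frame (hY' ▸ Y'.2.1) (hX' ▸ X'.2.1) hmatch'
  rw [← hX, ← hY] at hD
  rw [← hX', ← hY'] at hD'
  have h1 := (Set.ncard_pos).2 hpos
  have h2 : finrank F ↥(X.1 ⊓ Y.1) = finrank F (Submodule.span F (Set.range w)) := by
    rw [hX, hY, span_inf_span_frame hli]
  have h2' : finrank F ↥(X'.1 ⊓ Y'.1) = finrank F (Submodule.span F (Set.range w')) := by
    rw [hX', hY', span_inf_span_frame hli']
  have h3 := finrank_span_image_frame hli ∅
  have h3' := finrank_span_image_frame hli' ∅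
  have h4 := finrank_span_image_frame hli {j | ∀ i, W.form (x i) (y j) = 0}
  have h4' := finrank_span_image_frame hli' {j | ∀ i, W.form (x' i) (y' j) = 0}
  rw [Set.image_empty, Set.empty_union, Set.ncard_empty, zero_add] at h3 h3'
  rw [← hD] at h4
  rw [← hD'] at h4'
  have hXY : ¬ W.Opposite X.1 Y.1 := fun h => by
    have := (opposite_iff_finrank.1 h).2
    omega
  have h5 := ncard_closerSet_lt_of_card_lt hli' hli hlt
  rw [← hX, ← hX', ← hY, ← hY', ← hD, ← hD'] at h5
  have h6 := ncard_closer_le hk hXY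
  have h7 := le_ncard_closer (W := W) (X := X') (Y := Y') hk (by omega)
  rw [← hφX, ← hφY, ncard_closer_map, hφX, hφY] at h7
  omega

/-- The indices in `[a, b)` give a frame of two terms of the geodesic, and the unmatched vectors of
this frame are those with index in `unmatchedIn r a b`. -/
theorem HasPattern.ncard_unmatchedIn_le [Finite V] (hk : k < W.wittIndex)
    {r r' : Fin m → Option (Fin m)} (hr : IsPattern r) (hr' : IsPattern r')
    {X X' : Fin (m + 1) → W.SingularSubspace k} (h : W.HasPattern k r X)
    (h' : W.HasPattern k r' X') {φ : W.polarGrassmannGraph k ≃g W.polarGrassmannGraph k}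
    (hφ : ∀ i, φ (X i) = X' i) {a b : ℕ} (hab : a ≤ b) (hb : b ≤ m) :
    (unmatchedIn r' a b).ncard ≤ (unmatchedIn r a b).ncard := by
  obtain ⟨x, y, w, hli, hX, hform⟩ := h
  obtain ⟨x', y', w', hli', hX', hform'⟩ := h'
  obtain ⟨v, h1, h2, h3⟩ := frame_of_eq_span hli hX hab hb
  obtain ⟨v', h1', h2', h3'⟩ := frame_of_eq_span hli' hX' hab hb
  have hU : ∀ {r : Fin m → Option (Fin m)} {x y : Fin m → V}, IsPattern r →
      (∀ i j, W.form (x i) (y j) = if r i = some j then 1 else 0) →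
      Subtype.val '' {q : {p : Fin m // a ≤ p ∧ (p : ℕ) < b} |
        ∀ p : {p : Fin m // a ≤ p ∧ (p : ℕ) < b}, W.form (x p) (y q) = 0} =
        unmatchedIn r a b := by
    intro r x y hr hform
    ext q
    simp only [hform, ite_eq_right_iff, one_ne_zero, imp_false]
    constructor
    · rintro ⟨q, hq, rfl⟩
      refine ⟨q.2.1, q.2.2, fun p hp h => hq ⟨p, ?_, hp⟩ h⟩
      have := Fin.lt_def.1 (hr.1 _ _ h)
      have := q.2
      omega
    · rintro ⟨h1, h2, h3⟩
      exact ⟨⟨q, h1, h2⟩, fun p => h3 p p.2.2, rfl⟩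
  have hm : ∀ {r : Fin m → Option (Fin m)} {x y : Fin m → V},
      (∀ i j, W.form (x i) (y j) = if r i = some j then 1 else 0) →
      ∀ i j j' : {p : Fin m // a ≤ p ∧ (p : ℕ) < b}, W.form (x i) (y j) ≠ 0 →
        W.form (x i) (y j') ≠ 0 → j = j' := by
    intro r x y hform i j j' hj hj'
    rw [hform, Ne, ite_eq_right_iff, Classical.not_imp] at hj hj'
    exact Subtype.ext (Option.some_injective _ (hj.1.symm.trans hj'.1))
  rw [← hU hr hform, ← hU hr' hform', Set.ncard_image_of_injective _ Subtype.val_injective,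
    Set.ncard_image_of_injective _ Subtype.val_injective]
  rcases hab.eq_or_lt with rfl | hlt
  · have : IsEmpty {p : Fin m // a ≤ p ∧ (p : ℕ) < a} := ⟨fun p => by have := p.2; omega⟩
    rw [Set.eq_empty_of_isEmpty {q : {p : Fin m // a ≤ p ∧ (p : ℕ) < a} | _}]
    simp
  · refine ncard_unmatched_le hk h1 h1' (hm hform) (hm hform') h2 h3 h2' h3' (hφ _) (hφ _)
      ⟨⟨⟨b - 1, by omega⟩, by simp only; omega⟩, fun p => ?_⟩
    rw [hform, if_neg]
    intro h
    have h4 : b - 1 < (p.1 : ℕ) := Fin.lt_def.1 (hr.1 _ _ h)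
    have := p.2
    omega

/-- Geodesics with non-opposite ends in one orbit of the automorphism group have the same
pattern. -/
theorem HasPattern.pattern_eq [Finite V] (hk : k < W.wittIndex)
    {r r' : Fin m → Option (Fin m)} (hr : IsPattern r) (hr' : IsPattern r')
    {X X' : Fin (m + 1) → W.SingularSubspace k} (h : W.HasPattern k r X)
    (h' : W.HasPattern k r' X') {φ : W.polarGrassmannGraph k ≃g W.polarGrassmannGraph k}
    (hφ : ∀ i, φ (X i) = X' i) : r = r' := by
  refine hr.eq_of_ncard_unmatchedIn_eq hr' fun a b hab hb => le_antisymm ?_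
    (h.ncard_unmatchedIn_le hk hr hr' h' hφ hab hb)
  refine h'.ncard_unmatchedIn_le (φ := φ.symm) hk hr' hr h (fun i => ?_) hab hb
  rw [← hφ]
  exact φ.symm_apply_apply _

end PolarForm

/-! ### Automorphisms preserve opposition -/

namespace PolarForm

theorem exists_isGeodesic {α : Type*} {G : SimpleGraph α} (hG : G.Connected) (x y : α) {l : ℕ}
    (hl : G.dist x y = l) :
    ∃ p : Fin (l + 1) → α, G.IsGeodesic p ∧ p 0 = x ∧ p (Fin.last l) = y := by
  obtain ⟨q, hq⟩ := hG.exists_walk_length_eq_dist x y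
  rw [hl] at hq
  subst hq
  have h0 : q.getVert ((0 : Fin (q.length + 1)) : ℕ) = x := q.getVert_zero
  have h1 : q.getVert ((Fin.last q.length : Fin (q.length + 1)) : ℕ) = y := q.getVert_length
  refine ⟨fun i => q.getVert i, ⟨fun i => q.adj_getVert_succ i.2, ?_⟩, h0, h1⟩
  change G.dist (q.getVert ((0 : Fin (q.length + 1)) : ℕ))
    (q.getVert ((Fin.last q.length : Fin (q.length + 1)) : ℕ)) = _
  rw [h0, h1, hl]

variable {F V : Type*} [Field F] [AddCommGroup V] [Module F V] {W : PolarForm F V} {k m : ℕ}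

theorem IsHyperbolic.map {N : ℕ} {a b : Fin N → V} (h : W.IsHyperbolic a b) {g : V ≃ₗ[F] V}
    (hg : W.IsIsometry g) : W.IsHyperbolic (g ∘ a) (g ∘ b) where
  sing_left i := hg.sing_map.2 (h.sing_left i)
  sing_right i := hg.sing_map.2 (h.sing_right i)
  form_left i j := (hg.form_map _ _).trans (h.form_left i j)
  form_right i j := (hg.form_map _ _).trans (h.form_right i j)
  form_eq i j := (hg.form_map _ _).trans (h.form_eq i j)

variable [FiniteDimensional F V]

theorem Opposite.two_le_dist (hk : k < W.wittIndex) {X Y : W.SingularSubspace k}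
    (h : W.Opposite X.1 Y.1) : 2 ≤ (W.polarGrassmannGraph k).dist X Y := by
  have h1 := h.dist_eq hk
  have h2 := finrank_inf_lt (opposite_iff.1 h).1
  omega

/-- Any two opposite vertices arise from a hyperbolic system. -/
theorem Opposite.exists_isHyperbolic (hk : k < W.wittIndex) {X Y : W.SingularSubspace k}
    (h : W.Opposite X.1 Y.1) (hm : finrank F ↥(X.1 ⊓ Y.1) + m = k) :
    ∃ a b : Fin W.wittIndex → V, W.IsHyperbolic a b ∧
      (∀ i : Fin W.wittIndex, (i : ℕ) < k → a i ∈ X.1) ∧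
      (∀ i : Fin W.wittIndex, (i : ℕ) < m → b i ∈ Y.1) ∧
      ∀ i : Fin W.wittIndex, m ≤ (i : ℕ) → (i : ℕ) < k → a i ∈ Y.1 := by
  have hdist := h.dist_eq hk
  have h2 := finrank_inf_lt (opposite_iff.1 h).1
  obtain ⟨p, hp, rfl, rfl⟩ := exists_isGeodesic (connected hk) X Y (l := m + 1) (by omega)
  obtain ⟨a, b, hab⟩ := W.exists_isHyperbolic_wittIndex
  obtain ⟨X', hX', h0, h1, h3⟩ := hab.exists_hasOppositeForm (k := k) (m := m) (by omega) hk
  obtain ⟨φ, ⟨g, hg, hφg⟩, hφ⟩ := hX'.exists_isometryAut (by omega)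
    (PolarForm.exists_hasOppositeForm hk (by omega) hp h)
  refine ⟨g ∘ a, g ∘ b, hab.map hg, fun i hi => ?_, fun i hi => ?_, fun i hi hi' => ?_⟩ <;>
    rw [← hφ, hφg]
  · exact Submodule.mem_map_of_mem (h0 i hi)
  · exact Submodule.mem_map_of_mem (h1 i hi)
  · exact Submodule.mem_map_of_mem (h3 i hi hi')

/-- A pair of non-opposite vertices at distance less than `k` can be extended to a pair of
non-opposite vertices at larger distance. -/
theorem exists_adj_not_opposite_of_dist_lt (hk : k < W.wittIndex) {X Y : W.SingularSubspace k}
    (h : ¬ W.Opposite X.1 Y.1) (hne : X ≠ Y) (hd : (W.polarGrassmannGraph k).dist X Y < k) :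
    ∃ Z, (W.polarGrassmannGraph k).Adj Y Z ∧ ¬ W.Opposite X.1 Z.1 ∧
      (W.polarGrassmannGraph k).dist X Z = (W.polarGrassmannGraph k).dist X Y + 1 := by
  have hdist := dist_of_not_opposite hk h
  obtain ⟨y₀, hy₀Y, hy₀, hy₀X⟩ := (not_opposite_iff.1 h).resolve_left hne
  obtain ⟨x₀, hx₀X, hx₀, hx₀Y⟩ :=
    (not_opposite_iff.1 (fun h' => h (opposite_comm.1 h') : ¬ W.Opposite Y.1 X.1)).resolve_left
      (Ne.symm hne)
  obtain ⟨u, hu, hu0⟩ := Submodule.exists_mem_ne_zero_of_ne_bot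
    (show X.1 ⊓ Y.1 ≠ ⊥ from fun h0 => by rw [h0, finrank_bot] at hdist; omega)
  have hu' : u ∉ Submodule.span F {y₀} := by
    intro hmem
    obtain ⟨c, rfl⟩ := Submodule.mem_span_singleton.1 hmem
    have hc : c ≠ 0 := fun hc => hu0 (by rw [hc, zero_smul])
    exact hy₀X ((Submodule.smul_mem_iff _ hc).1 hu.1)
  obtain ⟨H, hH1, hH2, huH, hH3⟩ := exists_hyperplane
    ((Submodule.span_singleton_le_iff_mem _ _).2 hy₀Y) hu.2 hu'
  rw [Y.2.2] at hH3
  rw [Submodule.span_singleton_le_iff_mem] at hH1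
  have hx₀s : W.Sing x₀ := X.2.1.sing hx₀X
  -- `x₀` is not in the span of `Y` and the radical
  have hrad : x₀ ∉ Y.1 ⊔ W.perp ⊤ := by
    intro hmem
    obtain ⟨y, hy, r, hr, hyr⟩ := Submodule.mem_sup.1 hmem
    have hr0 : r = 0 := by
      refine eq_zero_of_mem_sup Y.2.1 (isTotallySingular_span_singleton hx₀s) (z := r) ?_
        (mem_perp_top.1 hr)
      rw [show r = -y + x₀ by rw [← hyr]; abel]
      exact Submodule.add_mem_sup (Submodule.neg_mem _ hy) (Submodule.mem_span_singleton_self _)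
    rw [hr0, add_zero] at hyr
    exact hx₀Y (hyr ▸ hy)
  obtain ⟨z₀, hz₀, hz₀1⟩ := exists_mem_perp_form_eq_one hrad
  obtain ⟨t, ht⟩ := hx₀s.exists_add_smul (y := z₀) (by rw [hz₀1]; exact one_ne_zero)
  have hz : z₀ + t • x₀ ∈ W.perp Y.1 :=
    Submodule.add_mem _ hz₀ (Submodule.smul_mem _ _ hx₀)
  have hxz : W.form (z₀ + t • x₀) x₀ ≠ 0 := by
    rw [form_add_left, form_smul_left, hx₀s.form_self, mul_zero, add_zero]
    intro h0
    rw [W.form_eq_zero_comm, hz₀1] at h0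
    exact one_ne_zero h0
  have hzY : z₀ + t • x₀ ∉ Y.1 := fun hmem => hxz (W.form_eq_zero_comm.1 (mem_perp.1 hx₀ _ hmem))
  obtain ⟨Z, hZ, hYZ, hadj⟩ := exists_adj_vertex hk hH2 hH3 ht hz hzY
  have hXZ : X.1 ⊓ Z.1 ≤ X.1 ⊓ H := by
    rintro v ⟨hvX, hvZ⟩
    rw [SetLike.mem_coe, hZ] at hvZ
    obtain ⟨p, hp, q, hq, rfl⟩ := Submodule.mem_sup.1 hvZ
    obtain ⟨c, rfl⟩ := Submodule.mem_span_singleton.1 hq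
    have h1 := X.2.1.form_eq_zero hvX hx₀X
    rw [form_add_left, W.form_eq_zero_comm.1 (mem_perp.1 hx₀ p (hH2 hp)), zero_add,
      form_smul_left] at h1
    rw [(mul_eq_zero.1 h1).resolve_right hxz, zero_smul, add_zero] at hvX ⊢
    exact ⟨hvX, hp⟩
  have hlt : finrank F ↥(X.1 ⊓ Z.1) < finrank F ↥(X.1 ⊓ Y.1) := by
    refine Submodule.finrank_lt_finrank_of_lt (lt_of_le_of_ne
      (hXZ.trans (inf_le_inf_left _ hH2)) fun heq => huH ?_)
    exact (hXZ (heq ▸ hu)).2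
  have hy₀Z : y₀ ∈ Z.1 := hZ ▸ Submodule.mem_sup_left hH1
  have hopp : ¬ W.Opposite X.1 Z.1 := not_opposite_iff.2 (Or.inr ⟨y₀, hy₀Z, hy₀, hy₀X⟩)
  refine ⟨Z, hadj, hopp, ?_⟩
  have h1 := dist_of_not_opposite hk hopp
  have h2 := (connected hk).dist_triangle (u := X) (v := Y) (w := Z)
  rw [SimpleGraph.dist_eq_one_iff_adj.2 hadj] at h2
  omega

theorem Opposite.of_adj (hk : k < W.wittIndex) {X Y Z : W.SingularSubspace k}
    (h : W.Opposite X.1 Y.1) (hYZ : (W.polarGrassmannGraph k).Adj Y Z)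
    (hd : (W.polarGrassmannGraph k).dist X Z = (W.polarGrassmannGraph k).dist X Y + 1) :
    W.Opposite X.1 Z.1 := by
  by_contra hXZ
  have h1 := h.dist_eq hk
  have h2 := dist_of_not_opposite hk hXZ
  have h3 := finrank_inf_add_finrank_inf_le X.1 Z.1 Y.1
  have h4 := Adj.finrank_inf hYZ
  have h5 : finrank F ↥(X.1 ⊓ Y.1 ⊓ Z.1) ≤ finrank F ↥(X.1 ⊓ Z.1) :=
    Submodule.finrank_mono (inf_le_inf_right _ inf_le_left)
  rw [Y.2.2] at h3
  omega

/-! ### A graph property of the opposite pairs at distance `k` -/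

/-- The set of neighbours of `x` that are closer to `y`. -/
def closer {α : Type*} (G : SimpleGraph α) (x y : α) : Set α :=
  {z | G.Adj x z ∧ G.dist z y + 1 = G.dist x y}

/-- The set `C` of the neighbours of `x` that are closer to `y` has an element with three
neighbours in `C`, no two of which are adjacent, or contains two elements that are neither
adjacent nor have a common neighbour in `C`. Rook's graphs do not have this property. -/
def HasClawOrGap {α : Type*} (G : SimpleGraph α) (x y : α) : Prop :=
  (∃ z₀ ∈ closer G x y, ∃ z : Fin 3 → α, (∀ i, z i ∈ closer G x y ∧ G.Adj z₀ (z i)) ∧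
    ∀ i j, i ≠ j → z i ≠ z j ∧ ¬ G.Adj (z i) (z j)) ∨
  ∃ z₁ ∈ closer G x y, ∃ z₂ ∈ closer G x y, z₁ ≠ z₂ ∧ ¬ G.Adj z₁ z₂ ∧
    ∀ z ∈ closer G x y, ¬ (G.Adj z₁ z ∧ G.Adj z₂ z)

theorem mem_closer_map {α : Type*} {G : SimpleGraph α} (φ : G ≃g G) {x y z : α} :
    φ z ∈ closer G (φ x) (φ y) ↔ z ∈ closer G x y := by
  simp only [closer, Set.mem_ofPred_eq, φ.map_adj_iff, dist_map]

theorem HasClawOrGap.map {α : Type*} {G : SimpleGraph α} (φ : G ≃g G) {x y : α}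
    (h : HasClawOrGap G x y) : HasClawOrGap G (φ x) (φ y) := by
  rcases h with ⟨z₀, h0, z, hz, hzz⟩ | ⟨z₁, h1, z₂, h2, hne, hna, hz⟩
  · refine Or.inl ⟨φ z₀, (mem_closer_map φ).2 h0, φ ∘ z, fun i => ⟨(mem_closer_map φ).2 (hz i).1,
      φ.map_adj_iff.2 (hz i).2⟩, fun i j hij => ⟨φ.injective.ne (hzz i j hij).1,
      fun h => (hzz i j hij).2 (φ.map_adj_iff.1 h)⟩⟩
  · refine Or.inr ⟨φ z₁, (mem_closer_map φ).2 h1, φ z₂, (mem_closer_map φ).2 h2,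
      φ.injective.ne hne, fun h => hna (φ.map_adj_iff.1 h), fun z hz' => ?_⟩
    obtain ⟨z, rfl⟩ := φ.surjective z
    rw [φ.map_adj_iff, φ.map_adj_iff]
    exact hz z ((mem_closer_map φ).1 hz')

end PolarForm

namespace PolarForm

variable {F V : Type*} [Field F] [AddCommGroup V] [Module F V] {W : PolarForm F V} {k : ℕ}

theorem inf_perp_sup_span_singleton {x y : V} {U : Submodule F V} (hx : x ∈ U)
    (hxy : W.form x y ≠ 0) :
    U ⊓ W.perp (Submodule.span F {y}) ⊔ Submodule.span F {x} = U := by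
  refine le_antisymm (sup_le inf_le_left ((Submodule.span_singleton_le_iff_mem _ _).2 hx)) ?_
  intro u hu
  have h1 : u - (W.form u y / W.form x y) • x ∈ U ⊓ W.perp (Submodule.span F {y}) := by
    refine Submodule.mem_inf.2 ⟨Submodule.sub_mem _ hu (Submodule.smul_mem _ _ hx), ?_⟩
    rw [mem_perp_span]
    rintro _ rfl
    rw [form_sub_left, form_smul_left, div_mul_cancel₀ _ hxy, sub_self]
  rw [← sub_add_cancel u ((W.form u y / W.form x y) • x)]
  exact Submodule.add_mem_sup h1 (Submodule.smul_mem _ _ (Submodule.mem_span_singleton_self x))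

variable [FiniteDimensional F V]

theorem adj_of_le_finrank_inf (hk : k < W.wittIndex) {Z Z' : W.SingularSubspace k} (hne : Z ≠ Z')
    (hperp : Z.1 ≤ W.perp Z'.1) (h : k ≤ finrank F ↥(Z.1 ⊓ Z'.1) + 1) :
    (W.polarGrassmannGraph k).Adj Z Z' :=
  (adj_iff hk).2 ⟨by have := finrank_inf_lt hne; omega, hperp⟩

section NotOpposite

variable {X Y Z Z' : W.SingularSubspace k}

/-- Two squares in one row or one column of the rook's graph are adjacent. -/
theorem adj_of_mem_closer (hk : k < W.wittIndex) (hXY : ¬ W.Opposite X.1 Y.1)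
    (hinf : X.1 ⊓ Y.1 = ⊥) (hZ : Z ∈ closer (W.polarGrassmannGraph k) X Y)
    (hZ' : Z' ∈ closer (W.polarGrassmannGraph k) X Y) (hne : Z ≠ Z')
    (h : Z.1 ⊓ X.1 = Z'.1 ⊓ X.1 ∨ Z.1 ⊓ Y.1 = Z'.1 ⊓ Y.1) :
    (W.polarGrassmannGraph k).Adj Z Z' := by
  obtain ⟨-, h2, h3, h4, h5⟩ := mem_closerSet_of_adj hk hXY hZ.1 hZ.2
  obtain ⟨-, h2', h3', h4', h5'⟩ := mem_closerSet_of_adj hk hXY hZ'.1 hZ'.2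
  have hT : W.IsTotallySingular (X.1 ⊔ Y.1 ⊓ W.perp X.1) :=
    isTotallySingular_sup_iff.2 ⟨X.2.1, Y.2.1.mono inf_le_left, le_perp_comm.1 inf_le_right⟩
  have hZT : Z.1 ≤ X.1 ⊔ Y.1 ⊓ W.perp X.1 := h2.trans (sup_le_sup inf_le_right h3)
  have hZT' : Z'.1 ≤ X.1 ⊔ Y.1 ⊓ W.perp X.1 := h2'.trans (sup_le_sup inf_le_right h3')
  refine adj_of_le_finrank_inf hk hne (hZT.trans ((isTotallySingular_iff_le_perp.1 hT).2.trans
    (perp_anti hZT'))) ?_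
  rw [X.2.2] at h4 h4'
  rw [hinf, finrank_bot] at h5
  rcases h with h | h
  · have h6 : finrank F ↥(Z.1 ⊓ X.1) ≤ finrank F ↥(Z.1 ⊓ Z'.1) :=
      Submodule.finrank_mono (le_inf inf_le_left (h.le.trans inf_le_left))
    omega
  · have h6 := Submodule.finrank_sup_add_finrank_inf_eq (Z.1 ⊓ X.1) (Z'.1 ⊓ X.1)
    have h7 : finrank F ↥(Z.1 ⊓ X.1 ⊔ Z'.1 ⊓ X.1) ≤ finrank F X.1 :=
      Submodule.finrank_mono (sup_le inf_le_right inf_le_right)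
    have h8 := Submodule.finrank_sup_add_finrank_inf_eq (Z.1 ⊓ X.1 ⊓ (Z'.1 ⊓ X.1)) (Z.1 ⊓ Y.1)
    have h9 : Z.1 ⊓ X.1 ⊓ (Z'.1 ⊓ X.1) ⊓ (Z.1 ⊓ Y.1) = ⊥ := by
      rw [eq_bot_iff, ← hinf]
      exact le_inf (inf_le_left.trans (inf_le_left.trans inf_le_right))
        (inf_le_right.trans inf_le_right)
    rw [h9, finrank_bot] at h8
    have h10 : finrank F ↥(Z.1 ⊓ X.1 ⊓ (Z'.1 ⊓ X.1) ⊔ Z.1 ⊓ Y.1) ≤ finrank F ↥(Z.1 ⊓ Z'.1) :=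
      Submodule.finrank_mono (sup_le (inf_le_inf inf_le_left inf_le_left)
        (le_inf inf_le_left (h.le.trans inf_le_left)))
    rw [X.2.2] at h7
    omega

/-- Adjacent squares lie in one row or one column of the rook's graph. -/
theorem eq_or_eq_of_adj_of_mem_closer (hk : k < W.wittIndex) (hXY : ¬ W.Opposite X.1 Y.1)
    (hinf : X.1 ⊓ Y.1 = ⊥) (hZ : Z ∈ closer (W.polarGrassmannGraph k) X Y)
    (hZ' : Z' ∈ closer (W.polarGrassmannGraph k) X Y)
    (h : (W.polarGrassmannGraph k).Adj Z Z') :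
    Z.1 ⊓ X.1 = Z'.1 ⊓ X.1 ∨ Z.1 ⊓ Y.1 = Z'.1 ⊓ Y.1 := by
  obtain ⟨-, h2, -, h4, h5⟩ := mem_closerSet_of_adj hk hXY hZ.1 hZ.2
  obtain ⟨-, h2', -, h4', h5'⟩ := mem_closerSet_of_adj hk hXY hZ'.1 hZ'.2
  have h6 := Adj.finrank_inf h
  rw [X.2.2] at h4 h4'
  rw [hinf, finrank_bot] at h5 h5'
  by_contra! hcon
  have h7 : finrank F ↥(Z.1 ⊓ X.1 ⊓ (Z'.1 ⊓ X.1)) < finrank F ↥(Z.1 ⊓ X.1) := by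
    refine Submodule.finrank_lt_finrank_of_lt (lt_of_le_of_ne inf_le_left fun heq => hcon.1 ?_)
    exact Submodule.eq_of_le_of_finrank_eq (inf_eq_left.1 heq) (by omega)
  have h8 : finrank F ↥(Z.1 ⊓ Y.1 ⊓ (Z'.1 ⊓ Y.1)) < finrank F ↥(Z.1 ⊓ Y.1) := by
    refine Submodule.finrank_lt_finrank_of_lt (lt_of_le_of_ne inf_le_left fun heq => hcon.2 ?_)
    exact Submodule.eq_of_le_of_finrank_eq (inf_eq_left.1 heq) (by omega)
  have h9 : Z.1 ⊓ Z'.1 ≤ Z.1 ⊓ X.1 ⊓ (Z'.1 ⊓ X.1) ⊔ Z.1 ⊓ Y.1 ⊓ (Z'.1 ⊓ Y.1) := by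
    rintro v ⟨hv, hv'⟩
    obtain ⟨p, hp, q, hq, rfl⟩ := Submodule.mem_sup.1 (h2 hv)
    obtain ⟨p', hp', q', hq', heq⟩ := Submodule.mem_sup.1 (h2' hv')
    have h0 : p - p' ∈ X.1 ⊓ Y.1 := by
      refine ⟨Submodule.sub_mem _ hp.2 hp'.2, ?_⟩
      rw [show p - p' = q' - q by rw [sub_eq_sub_iff_add_eq_add, ← heq]; abel]
      exact Submodule.sub_mem _ hq'.2 hq.2
    rw [hinf, Submodule.mem_bot, sub_eq_zero] at h0
    subst h0
    obtain rfl := add_left_cancel heq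
    exact Submodule.add_mem_sup ⟨hp, hp'⟩ ⟨hq, hq'⟩
  have h10 := Submodule.finrank_mono h9
  have h11 := Submodule.finrank_add_le_finrank_add_finrank (Z.1 ⊓ X.1 ⊓ (Z'.1 ⊓ X.1))
    (Z.1 ⊓ Y.1 ⊓ (Z'.1 ⊓ Y.1))
  omega

/-- The square in the row of one square and the column of another is adjacent to both. -/
theorem exists_common_adj_of_mem_closer (hk : k < W.wittIndex) (hXY : ¬ W.Opposite X.1 Y.1)
    (hinf : X.1 ⊓ Y.1 = ⊥) (hZ : Z ∈ closer (W.polarGrassmannGraph k) X Y)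
    (hZ' : Z' ∈ closer (W.polarGrassmannGraph k) X Y) (hne : Z ≠ Z')
    (hadj : ¬ (W.polarGrassmannGraph k).Adj Z Z') :
    ∃ U ∈ closer (W.polarGrassmannGraph k) X Y, (W.polarGrassmannGraph k).Adj Z U ∧
      (W.polarGrassmannGraph k).Adj Z' U := by
  have hcon := not_or.1 fun h => hadj (adj_of_mem_closer hk hXY hinf hZ hZ' hne h)
  obtain ⟨-, h2, h3, h4, h5⟩ := mem_closerSet_of_adj hk hXY hZ.1 hZ.2
  obtain ⟨-, h2', h3', h4', h5'⟩ := mem_closerSet_of_adj hk hXY hZ'.1 hZ'.2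
  have hlt : Z.1 ⊓ Y.1 < Z.1 ⊓ Y.1 ⊔ Z'.1 ⊓ Y.1 := by
    refine lt_of_le_of_ne le_sup_left fun heq => hcon.2 ?_
    exact (Submodule.eq_of_le_of_finrank_eq (sup_eq_left.1 heq.symm) (by omega)).symm
  have h6 := Submodule.finrank_lt_finrank_of_lt hlt
  have h7 := Submodule.finrank_mono (sup_le h3 h3')
  have h8 : (Z.1 ⊓ X.1 ⊔ Z'.1 ⊓ Y.1) ⊓ X.1 = Z.1 ⊓ X.1 := by
    rw [sup_inf_assoc_of_le _ inf_le_right, inf_assoc, inf_comm Y.1, hinf, inf_bot_eq, sup_bot_eq]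
  have h9 : (Z.1 ⊓ X.1 ⊔ Z'.1 ⊓ Y.1) ⊓ Y.1 = Z'.1 ⊓ Y.1 := by
    rw [sup_comm, sup_inf_assoc_of_le _ inf_le_right, inf_assoc, hinf, inf_bot_eq, sup_bot_eq]
  have hmem : Z.1 ⊓ X.1 ⊔ Z'.1 ⊓ Y.1 ∈ closerSet X.1 Y.1 (Y.1 ⊓ W.perp X.1) := by
    refine ⟨hinf.le.trans bot_le, ?_, ?_, ?_, ?_⟩
    · rw [h8, h9]
    · rw [h9]
      exact h3'
    · rw [h8, h4]
    · rw [h9, h5']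
  obtain ⟨U, hU, hXU, hUY⟩ := exists_adj_of_mem_closerSet hk (by omega) hmem
  have hUc : U ∈ closer (W.polarGrassmannGraph k) X Y := ⟨hXU, hUY⟩
  rw [← hU] at h8 h9
  refine ⟨U, hUc, adj_of_mem_closer hk hXY hinf hZ hUc ?_ (Or.inl h8.symm),
    adj_of_mem_closer hk hXY hinf hZ' hUc ?_ (Or.inr h9.symm)⟩
  · rintro rfl
    exact hcon.2 h9
  · rintro rfl
    exact hcon.1 h8.symm

/-- For non-opposite ends without common nonzero vector, the closer neighbours form an induced
subgraph of the rook's graph on hyperplanes of `X` and points of `Y ∩ X^⊥`. -/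
theorem not_hasClawOrGap (hk : k < W.wittIndex) (hXY : ¬ W.Opposite X.1 Y.1)
    (hinf : X.1 ⊓ Y.1 = ⊥) : ¬ HasClawOrGap (W.polarGrassmannGraph k) X Y := by
  rintro (⟨Z₀, h0, Z, hZ, hZZ⟩ | ⟨Z₁, h1, Z₂, h2, hne, hna, h⟩)
  · have hside := fun i => eq_or_eq_of_adj_of_mem_closer hk hXY hinf h0 (hZ i).1 (hZ i).2
    have hcon : ∀ i j, i ≠ j → (Z i).1 ⊓ X.1 = (Z j).1 ⊓ X.1 ∨
        (Z i).1 ⊓ Y.1 = (Z j).1 ⊓ Y.1 → False := fun i j hij h =>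
      (hZZ i j hij).2 (adj_of_mem_closer hk hXY hinf (hZ i).1 (hZ j).1 (hZZ i j hij).1 h)
    rcases hside 0 with h0 | h0 <;> rcases hside 1 with h1 | h1 <;> rcases hside 2 with h2 | h2
    · exact hcon 0 1 (by decide) (Or.inl (h0.symm.trans h1))
    · exact hcon 0 1 (by decide) (Or.inl (h0.symm.trans h1))
    · exact hcon 0 2 (by decide) (Or.inl (h0.symm.trans h2))
    · exact hcon 1 2 (by decide) (Or.inr (h1.symm.trans h2))
    · exact hcon 1 2 (by decide) (Or.inl (h1.symm.trans h2))
    · exact hcon 0 2 (by decide) (Or.inr (h0.symm.trans h2))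
    · exact hcon 0 1 (by decide) (Or.inr (h0.symm.trans h1))
    · exact hcon 0 1 (by decide) (Or.inr (h0.symm.trans h1))
  · obtain ⟨U, hU, h3, h4⟩ := exists_common_adj_of_mem_closer hk hXY hinf h1 h2 hne hna
    exact h U hU ⟨h3, h4⟩

end NotOpposite

section Opposite

variable {X Y Z Z' : W.SingularSubspace k}

theorem finrank_inf_perp_singleton {x y : V} {U : Submodule F V} (hx : x ∈ U)
    (hxy : W.form x y ≠ 0) :
    finrank F ↥(U ⊓ W.perp (Submodule.span F {y})) + 1 = finrank F U := by
  have hxU : x ∉ U ⊓ W.perp (Submodule.span F {y}) := fun h =>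
    hxy (mem_perp.1 h.2 y (Submodule.mem_span_singleton_self y))
  rw [← Submodule.finrank_sup_span_singleton hxU, inf_perp_sup_span_singleton hx hxy]

theorem not_adj_of_form_ne_zero (hk : k < W.wittIndex) {p q : V} (hp : p ∈ Z.1) (hq : q ∈ Z'.1)
    (h : W.form p q ≠ 0) : Z ≠ Z' ∧ ¬ (W.polarGrassmannGraph k).Adj Z Z' := by
  refine ⟨?_, fun hadj => h (mem_perp.1 (((adj_iff hk).1 hadj).2 hp) q hq)⟩
  rintro rfl
  exact h (Z.2.1.form_eq_zero hp hq)

/-- Closer neighbours of `X` in an opposite pair: replace a vector of `X` by a singular vector `v`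
orthogonal to `X` and to a vector `y` of `Y`. -/
theorem Opposite.exists_mem_closer (hk : k < W.wittIndex) (h : W.Opposite X.1 Y.1)
    {x y v : V} (hx : x ∈ X.1) (hy : y ∈ Y.1) (hxy : W.form x y ≠ 0) (hv : W.Sing v)
    (hvX : v ∈ W.perp X.1) (hvX' : v ∉ X.1) (hyv : W.form y v = 0) :
    ∃ Z ∈ closer (W.polarGrassmannGraph k) X Y,
      Z.1 = X.1 ⊓ W.perp (Submodule.span F {y}) ⊔ Submodule.span F {v} := by
  have h1 := finrank_inf_perp_singleton hx hxy
  rw [X.2.2] at h1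
  have hXYy : X.1 ⊓ Y.1 ≤ X.1 ⊓ W.perp (Submodule.span F {y}) := by
    refine le_inf inf_le_left fun z hz => ?_
    rw [mem_perp_span]
    rintro _ rfl
    exact Y.2.1.form_eq_zero hz.2 hy
  have hyX : y ∉ X.1 := fun hyX => hxy (X.2.1.form_eq_zero hx hyX)
  have hyH : y ∈ W.perp (X.1 ⊓ W.perp (Submodule.span F {y})) :=
    mem_perp'.2 fun u hu => mem_perp.1 hu.2 y (Submodule.mem_span_singleton_self y)
  obtain ⟨Z, hZ, -, hadj, hopp, hinf⟩ := h.exists_adj_not_opposite hk hXYy inf_le_left h1 hy hyX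
    hyH hv hvX hvX' hyv
  refine ⟨Z, ⟨hadj, ?_⟩, hZ⟩
  have h2 := h.dist_eq hk
  have h3 := dist_of_not_opposite hk hopp
  rw [hinf] at h3
  omega

theorem adj_of_eq_sup_span (hk : k < W.wittIndex) {H H' : Submodule F V} {v v' : V}
    (hZ : Z.1 = H ⊔ Submodule.span F {v}) (hZ' : Z'.1 = H' ⊔ Submodule.span F {v'})
    (hH : W.IsTotallySingular (H ⊔ H')) (hv : v ∈ W.perp H') (hv' : v' ∈ W.perp H)
    (hvv' : W.form v v' = 0) (hne : Z ≠ Z') (hinf : k ≤ finrank F ↥(Z.1 ⊓ Z'.1) + 1) :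
    (W.polarGrassmannGraph k).Adj Z Z' := by
  refine adj_of_le_finrank_inf hk hne ?_ hinf
  rw [hZ, hZ', perp_sup]
  refine le_inf (sup_le ?_ ?_) (sup_le ?_ ?_)
  · exact (isTotallySingular_sup_iff.1 hH).2.2
  · rwa [Submodule.span_singleton_le_iff_mem]
  · rwa [le_perp_comm, Submodule.span_singleton_le_iff_mem]
  · rw [span_le_perp_span]
    rintro _ rfl _ rfl
    exact hvv'

theorem IsHyperbolic.mem_perp {a b : Fin W.wittIndex → V} (hab : W.IsHyperbolic a b)
    (hk : k ≤ W.wittIndex) (ha : ∀ i : Fin W.wittIndex, (i : ℕ) < k → a i ∈ X.1) {v : V}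
    (hv : ∀ i : Fin W.wittIndex, (i : ℕ) < k → W.form v (a i) = 0) : v ∈ W.perp X.1 := by
  have hli : LinearIndependent F (a ∘ Fin.castLE hk) :=
    (hab.linearIndependent.comp Sum.inl Sum.inl_injective).comp _ (Fin.castLE_injective hk)
  have hX : Submodule.span F (Set.range (a ∘ Fin.castLE hk)) = X.1 := by
    refine Submodule.eq_of_le_of_finrank_eq (Submodule.span_le.2 ?_) ?_
    · rintro _ ⟨i, rfl⟩
      exact ha _ i.2
    · rw [finrank_span_eq_card hli, Fintype.card_fin, X.2.2]
  rw [← hX, mem_perp_span]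
  rintro _ ⟨i, rfl⟩
  exact hv _ i.2

/-- A singular vector orthogonal to the first three hyperbolic pairs but to neither vector of the
fourth one. -/
theorem IsHyperbolic.exists_sing_form_ne_zero {a b : Fin W.wittIndex → V}
    (hab : W.IsHyperbolic a b) (hω : 4 ≤ W.wittIndex)
    (hex : ¬ (W.IsOrthogonal ∧ finrank F V = 8 ∧ W.wittIndex = 4)) :
    ∃ p, W.Sing p ∧ (∀ i : Fin W.wittIndex, (i : ℕ) < 3 →
      W.form p (a i) = 0 ∧ W.form p (b i) = 0) ∧
      W.form p (a ⟨3, hω⟩) ≠ 0 ∧ W.form p (b ⟨3, hω⟩) ≠ 0 := by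
  have h3 : ∀ i : Fin W.wittIndex, (i : ℕ) < 3 → i ≠ ⟨3, hω⟩ ∧ ⟨3, hω⟩ ≠ i := by
    rintro i hi
    exact ⟨fun h => by rw [h] at hi; simp at hi, fun h => by rw [← h] at hi; simp at hi⟩
  rcases hω.eq_or_lt with h4 | h5
  · -- the vector is `a + c b + v` with `v` orthogonal to the hyperbolic pairs
    suffices hs : ∃ (c : F) (v : V), c ≠ 0 ∧ W.Sing (a ⟨3, hω⟩ + c • b ⟨3, hω⟩ + v) ∧
        (∀ i, W.form v (a i) = 0) ∧ ∀ i, W.form v (b i) = 0 by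
      obtain ⟨c, v, hc, hs, hva, hvb⟩ := hs
      refine ⟨_, hs, fun i hi => ⟨?_, ?_⟩, ?_, ?_⟩
      · rw [form_add_left, form_add_left, form_smul_left, hab.form_left, hab.form_eq', hva,
          if_neg (h3 i hi).2]
        simp
      · rw [form_add_left, form_add_left, form_smul_left, hab.form_right, hab.form_eq, hvb,
          if_neg (h3 i hi).2]
        simp
      · rw [form_add_left, form_add_left, form_smul_left, hab.form_left, hab.form_eq', hva,
          if_pos rfl]
        simpa using ⟨hc, W.sgn_ne_zero⟩
      · rw [form_add_left, form_add_left, form_smul_left, hab.form_right, hab.form_eq, hvb,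
          if_pos rfl]
        simp
    generalize hi : (⟨3, hω⟩ : Fin W.wittIndex) = i₀
    have hdim := finrank_inf_perp_comm (W := W) (Submodule.span F (Set.range (Sum.elim a b))) ⊤
    rw [top_inf_eq, finrank_span_eq_card hab.linearIndependent, finrank_top] at hdim
    have hperp : ∀ v ∈ W.perp (Submodule.span F (Set.range (Sum.elim a b))),
        (∀ i, W.form v (a i) = 0) ∧ ∀ i, W.form v (b i) = 0 := fun v hv =>
      ⟨fun i => hv _ (Submodule.subset_span ⟨Sum.inl i, rfl⟩),
        fun i => hv _ (Submodule.subset_span ⟨Sum.inr i, rfl⟩)⟩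
    have hsum := (Submodule.span F (Set.range (Sum.elim a b))).finrank_le
    rw [finrank_span_eq_card hab.linearIndependent] at hsum
    simp only [Fintype.card_sum, Fintype.card_fin, ← h4] at hdim hsum
    have hne : finrank F V ≠ 8 → ∃ v ∈ W.perp (Submodule.span F (Set.range (Sum.elim a b))),
        v ≠ 0 := by
      intro h8
      refine Submodule.exists_mem_ne_zero_of_ne_bot fun h0 => ?_
      rw [h0, finrank_bot] at hdim
      omega
    -- such a vector is not singular, as the first halves of the pairs span a maximal subspace
    have hns : ∀ v ∈ W.perp (Submodule.span F (Set.range (Sum.elim a b))), v ≠ 0 →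
        ¬ W.Sing v := by
      intro v hv hv0 hvs
      have hva : v ∉ Submodule.span F (Set.range a) := by
        intro hmem
        obtain ⟨c, rfl⟩ := Submodule.mem_span_range_iff_exists_fun F |>.1 hmem
        refine hv0 (Finset.sum_eq_zero fun i _ => ?_)
        have h1 : W.formLeft (b i) (∑ j, c j • a j) = 0 := (hperp _ hv).2 i
        rw [map_sum, Finset.sum_eq_single i] at h1
        · rw [map_smul, formLeft_apply, hab.form_eq, if_pos rfl, smul_eq_mul, mul_one] at h1
          rw [h1, zero_smul]
        · intro j _ hj
          rw [map_smul, formLeft_apply, hab.form_eq, if_neg hj, smul_zero]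
        · simp
      have hts : W.IsTotallySingular (Submodule.span F (Set.range a)) := by
        rw [isTotallySingular_span_iff]
        refine ⟨?_, ?_⟩
        · rintro _ ⟨i, rfl⟩
          exact hab.sing_left i
        · rintro _ ⟨i, rfl⟩ _ ⟨j, rfl⟩
          exact hab.form_left i j
      have h1 := (hts.sup_span_singleton hvs (mem_perp_span.2 (by
        rintro _ ⟨i, rfl⟩
        exact (hperp v hv).1 i))).finrank_le
      have hli : LinearIndependent F a :=
        hab.linearIndependent.comp Sum.inl Sum.inl_injective
      rw [Submodule.finrank_sup_span_singleton hva, finrank_span_eq_card hli,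
        Fintype.card_fin] at h1
      omega
    clear hi h3
    cases W with
    | symplectic B alt _ =>
      exact ⟨1, 0, one_ne_zero, trivial, fun i => form_zero_left _ _, fun i => form_zero_left _ _⟩
    | unitary σ hσ hσσ B herm nondeg =>
      obtain ⟨s, hs⟩ : ∃ s, σ s ≠ s := by
        by_contra! h
        exact hσ (RingHom.ext h)
      refine ⟨s - σ s, 0, sub_ne_zero.2 hs.symm, ?_, fun i => form_zero_left _ _,
        fun i => form_zero_left _ _⟩
      have h1 : B (a i₀) (a i₀) = 0 := hab.form_left i₀ i₀
      have h2 : B (b i₀) (b i₀) = 0 := hab.form_right i₀ i₀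
      have h3 : B (a i₀) (b i₀) = 1 := (hab.form_eq i₀ i₀).trans (if_pos rfl)
      have h4 : B (b i₀) (a i₀) = 1 := by rw [herm, h3, map_one]
      change B _ _ = 0
      simp [h1, h2, h3, h4, hσσ]
    | orthogonal Q nondeg =>
      obtain ⟨v, hv, hv0⟩ := hne fun h8 => hex ⟨trivial, h8, h4.symm⟩
      have hQ : Q v ≠ 0 := hns v hv hv0
      refine ⟨-Q v, v, neg_ne_zero.2 hQ, ?_, hperp v hv⟩
      have h1 : Q (a i₀) = 0 := hab.sing_left i₀
      have h2 : Q (b i₀) = 0 := hab.sing_right i₀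
      have h3 : QuadraticMap.polar Q (a i₀) (b i₀) = 1 := (hab.form_eq i₀ i₀).trans (if_pos rfl)
      have h5 : QuadraticMap.polar Q (a i₀) v = 0 := by
        rw [QuadraticMap.polar_comm]
        exact (hperp v hv).1 i₀
      have h6 : QuadraticMap.polar Q (b i₀) v = 0 := by
        rw [QuadraticMap.polar_comm]
        exact (hperp v hv).2 i₀
      change Q _ = 0
      rw [QuadraticMap.map_add Q, QuadraticMap.map_add Q, QuadraticMap.polar_add_left,
        QuadraticMap.map_smul, QuadraticMap.polar_smul_left, QuadraticMap.polar_smul_right,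
        h1, h2, h3, h5, h6]
      simp
  · have h34 : (⟨4, h5⟩ : Fin W.wittIndex) ≠ ⟨3, hω⟩ := by simp
    have h4 : ∀ i : Fin W.wittIndex, (i : ℕ) < 3 → (⟨4, h5⟩ : Fin W.wittIndex) ≠ i := by
      rintro i hi rfl
      simp at hi
    have hs : W.form (b ⟨4, h5⟩) (a ⟨3, hω⟩ + b ⟨3, hω⟩ + a ⟨4, h5⟩) ≠ 0 := by
      rw [form_add_right, form_add_right, hab.form_eq', hab.form_right, hab.form_eq', if_neg h34,
        if_pos rfl]
      simpa using W.sgn_ne_zero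
    obtain ⟨t, ht⟩ := (hab.sing_right ⟨4, h5⟩).exists_add_smul hs
    refine ⟨_, ht, fun i hi => ⟨?_, ?_⟩, ?_, ?_⟩
    · simp [form_add_left, form_smul_left, hab.form_left, hab.form_eq', (h3 i hi).2, h4 i hi]
    · simp [form_add_left, form_smul_left, hab.form_right, hab.form_eq, (h3 i hi).2, h4 i hi]
    · simpa [form_add_left, form_smul_left, hab.form_left, hab.form_eq', h34] using W.sgn_ne_zero
    · simp [form_add_left, form_smul_left, hab.form_right, hab.form_eq, h34]

/-- The closer neighbours in an opposite pair at distance `k ≥ 2`. If `k = ω - 1`, two of them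
spanned by a hyperplane of `X` and either vector of a hyperbolic pair form a gap. Otherwise there is
room for a claw with centre spanned by a hyperplane `H` and a vector `a c`: two leaves replace `a c`
by the vectors of a further hyperbolic pair, and the third one either replaces `H`, if `k > 2`, or
replaces `a c` by a third singular vector, which is missing in the excluded case. -/
theorem Opposite.hasClawOrGap (hk : k < W.wittIndex) (hk2 : 2 ≤ k) (h : W.Opposite X.1 Y.1)
    (hd : (W.polarGrassmannGraph k).dist X Y = k)
    (hex : ¬ (W.IsOrthogonal ∧ finrank F V = 8 ∧ W.wittIndex = 4 ∧ k = 2)) :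
    HasClawOrGap (W.polarGrassmannGraph k) X Y := by
  have hdist := h.dist_eq hk
  obtain ⟨a, b, hab, haX, hbY, -⟩ := h.exists_isHyperbolic hk (m := k - 1) (by omega)
  have hperp : ∀ {v : V}, (∀ i : Fin W.wittIndex, (i : ℕ) < k → W.form v (a i) = 0) →
      v ∈ W.perp X.1 := hab.mem_perp hk.le haX
  have hnotMem : ∀ {v t : V}, t ∈ W.perp X.1 → W.form v t ≠ 0 → v ∉ X.1 := fun ht h hv =>
    h (mem_perp'.1 ht _ hv)
  have haP : ∀ i, a i ∈ W.perp X.1 := fun i => hperp fun j _ => hab.form_left i j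
  have hbP : ∀ i : Fin W.wittIndex, k ≤ i → b i ∈ W.perp X.1 := fun i hi => hperp fun j hj => by
    rw [hab.form_eq', if_neg]
    rintro rfl
    omega
  -- the neighbours of `X` obtained by replacing the vector `a j` by `v`
  have leaf : ∀ (j : Fin W.wittIndex) (v : V), (j : ℕ) < k - 1 → W.Sing v → v ∈ W.perp X.1 →
      v ∉ X.1 → W.form (b j) v = 0 → ∃ Z ∈ closer (W.polarGrassmannGraph k) X Y,
        Z.1 = X.1 ⊓ W.perp (Submodule.span F {b j}) ⊔ Submodule.span F {v} :=
    fun j v hj hv hvX hvX' hjv => h.exists_mem_closer hk (haX j (by omega)) (hbY j hj)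
      (by rw [hab.form_eq, if_pos rfl]; exact one_ne_zero) hv hvX hvX' hjv
  have hH : ∀ j : Fin W.wittIndex, (j : ℕ) < k - 1 →
      finrank F ↥(X.1 ⊓ W.perp (Submodule.span F {b j})) + 1 = k := fun j hj => by
    rw [finrank_inf_perp_singleton (haX j (by omega))
      (by rw [hab.form_eq, if_pos rfl]; exact one_ne_zero), X.2.2]
  let j₀ : Fin W.wittIndex := ⟨0, by omega⟩
  have hj₀ : (j₀ : ℕ) < k - 1 := by simp only [j₀]; omega
  let c : Fin W.wittIndex := ⟨k, hk⟩
  have hc : j₀ ≠ c := fun h => by simp only [j₀, c, Fin.mk.injEq] at h; omega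
  have hcX : a c ∉ X.1 := hnotMem (hbP c le_rfl) (by rw [hab.form_eq]; simp)
  obtain ⟨Z₀, hZ₀, hZ₀e⟩ := leaf j₀ (a c) hj₀ (hab.sing_left c) (haP c) hcX
    (by rw [hab.form_eq', if_neg hc])
  have hcZ₀ : a c ∈ Z₀.1 := hZ₀e ▸ Submodule.mem_sup_right (Submodule.mem_span_singleton_self _)
  rcases (Nat.succ_le_of_lt hk).eq_or_lt with hω | hω
  · -- a common neighbour would give a totally singular subspace that is too large
    obtain ⟨Z₁, hZ₁, hZ₁e⟩ := leaf j₀ (b c) hj₀ (hab.sing_right c) (hbP c le_rfl)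
      (hnotMem (haP c) (by rw [hab.form_eq']; simpa using W.sgn_ne_zero)) (hab.form_right _ _)
    have hcZ₁ : b c ∈ Z₁.1 :=
      hZ₁e ▸ Submodule.mem_sup_right (Submodule.mem_span_singleton_self _)
    obtain ⟨hne, hna⟩ := not_adj_of_form_ne_zero hk hcZ₀ hcZ₁ (by rw [hab.form_eq]; simp)
    refine Or.inr ⟨Z₀, hZ₀, Z₁, hZ₁, hne, hna, fun Z hZ ⟨h1, h2⟩ => ?_⟩
    obtain ⟨h3, h4⟩ := (adj_iff hk).1 hZ.1
    have hT : W.IsTotallySingular (X.1 ⊔ Z.1) := isTotallySingular_sup_iff.2 ⟨X.2.1, Z.2.1, h4⟩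
    have h5 := Submodule.finrank_sup_add_finrank_inf_eq X.1 Z.1
    rw [X.2.2, Z.2.2] at h5
    have haT : a c ∈ W.perp (X.1 ⊔ Z.1) := by
      rw [perp_sup]
      exact ⟨haP c, ((adj_iff hk).1 h1).2 hcZ₀⟩
    have hbT : b c ∈ W.perp (X.1 ⊔ Z.1) := by
      rw [perp_sup]
      exact ⟨hbP c le_rfl, ((adj_iff hk).1 h2).2 hcZ₁⟩
    have h6 := (hT.sup_span_singleton (hab.sing_left c) haT).finrank_le
    rw [Submodule.finrank_sup_span_singleton] at h6
    · omega
    · intro hmem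
      have := mem_perp'.1 hbT _ hmem
      rw [hab.form_eq] at this
      simp at this
  · let d : Fin W.wittIndex := ⟨k + 1, hω⟩
    have hcd : c ≠ d := fun h => by simp only [c, d, Fin.mk.injEq] at h; omega
    have hj₀d : j₀ ≠ d := fun h => by simp only [j₀, d, Fin.mk.injEq] at h; omega
    have hkd : k ≤ (d : ℕ) := Nat.le_succ k
    have hada : W.form (a d) (b d) ≠ 0 := by rw [hab.form_eq]; simp
    have hbda : W.form (b d) (a d) ≠ 0 := by rw [hab.form_eq']; simpa using W.sgn_ne_zero
    -- the centre `Z₀` is adjacent to its leaves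
    have hadj₀ : ∀ {Z : W.SingularSubspace k} {v t : V},
        Z.1 = X.1 ⊓ W.perp (Submodule.span F {b j₀}) ⊔ Submodule.span F {v} →
        v ∈ W.perp X.1 → t ∈ W.perp X.1 → W.form (a c) v = 0 → W.form (a c) t = 0 →
        W.form v t ≠ 0 → (W.polarGrassmannGraph k).Adj Z₀ Z := by
      intro Z v t hZ hv ht hcv hct hvt
      refine adj_of_eq_sup_span hk hZ₀e hZ (by rw [sup_idem]; exact X.2.1.mono inf_le_left)
        (perp_anti inf_le_left (haP c)) (perp_anti inf_le_left hv) hcv ?_ ?_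
      · rintro rfl
        refine hvt (mem_perp'.1 (?_ : t ∈ W.perp Z₀.1) v
          (hZ ▸ Submodule.mem_sup_right (Submodule.mem_span_singleton_self _)))
        rw [hZ₀e, perp_sup]
        refine ⟨perp_anti inf_le_left ht, mem_perp_span.2 ?_⟩
        rintro _ rfl
        exact W.form_eq_zero_comm.1 hct
      · refine (hH j₀ hj₀).ge.trans ?_
        exact Nat.add_le_add_right (Submodule.finrank_mono
          (le_inf (hZ₀e ▸ le_sup_left) (hZ ▸ le_sup_left))) 1
    obtain ⟨Z₁, hZ₁, hZ₁e⟩ := leaf j₀ (a d) hj₀ (hab.sing_left d) (haP d)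
      (hnotMem (hbP d hkd) hada) (by rw [hab.form_eq', if_neg hj₀d])
    obtain ⟨Z₂, hZ₂, hZ₂e⟩ := leaf j₀ (b d) hj₀ (hab.sing_right d) (hbP d hkd)
      (hnotMem (haP d) hbda) (hab.form_right _ _)
    have h01 := hadj₀ hZ₁e (haP d) (hbP d hkd) (hab.form_left _ _)
      (by rw [hab.form_eq, if_neg hcd]) hada
    have h02 := hadj₀ hZ₂e (hbP d hkd) (haP d) (by rw [hab.form_eq, if_neg hcd])
      (hab.form_left _ _) hbda
    have hdZ₁ : a d ∈ Z₁.1 :=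
      hZ₁e ▸ Submodule.mem_sup_right (Submodule.mem_span_singleton_self _)
    have hdZ₂ : b d ∈ Z₂.1 :=
      hZ₂e ▸ Submodule.mem_sup_right (Submodule.mem_span_singleton_self _)
    have h12 := not_adj_of_form_ne_zero hk hdZ₁ hdZ₂ hada
    suffices hs : ∃ Z₃ ∈ closer (W.polarGrassmannGraph k) X Y,
        (W.polarGrassmannGraph k).Adj Z₀ Z₃ ∧
        (Z₁ ≠ Z₃ ∧ ¬ (W.polarGrassmannGraph k).Adj Z₁ Z₃) ∧
        (Z₂ ≠ Z₃ ∧ ¬ (W.polarGrassmannGraph k).Adj Z₂ Z₃) by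
      obtain ⟨Z₃, hZ₃, h03, h13, h23⟩ := hs
      refine Or.inl ⟨Z₀, hZ₀, ![Z₁, Z₂, Z₃], fun i => ?_, fun i j hij => ?_⟩
      · fin_cases i
        · exact ⟨hZ₁, h01⟩
        · exact ⟨hZ₂, h02⟩
        · exact ⟨hZ₃, h03⟩
      · have hsymm : ∀ {A B : W.SingularSubspace k},
            A ≠ B ∧ ¬ (W.polarGrassmannGraph k).Adj A B →
            B ≠ A ∧ ¬ (W.polarGrassmannGraph k).Adj B A :=
          fun h => ⟨h.1.symm, fun h' => h.2 h'.symm⟩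
        fin_cases i <;> fin_cases j
        · exact absurd rfl hij
        · exact h12
        · exact h13
        · exact hsymm h12
        · exact absurd rfl hij
        · exact h23
        · exact hsymm h13
        · exact hsymm h23
        · exact absurd rfl hij
    rcases hk2.eq_or_lt with hk2 | hk3
    · subst hk2
      obtain ⟨p, hp, hpp, hpa, hpb⟩ := hab.exists_sing_form_ne_zero hω
        fun h => hex ⟨h.1, h.2.1, h.2.2, rfl⟩
      have hpX : p ∈ W.perp X.1 := hperp fun i hi => (hpp i (by omega)).1
      obtain ⟨Z₃, hZ₃, hZ₃e⟩ := leaf j₀ p hj₀ hp hpX (hnotMem (haP d) hpa)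
        (W.form_eq_zero_comm.1 (hpp j₀ (by simp [j₀])).2)
      have hpZ₃ : p ∈ Z₃.1 :=
        hZ₃e ▸ Submodule.mem_sup_right (Submodule.mem_span_singleton_self _)
      exact ⟨Z₃, hZ₃, hadj₀ hZ₃e hpX (haP d) (W.form_eq_zero_comm.1 (hpp c (by simp [c])).1)
        (hab.form_left _ _) hpa,
        not_adj_of_form_ne_zero hk hdZ₁ hpZ₃ fun h => hpa (W.form_eq_zero_comm.1 h),
        not_adj_of_form_ne_zero hk hdZ₂ hpZ₃ fun h => hpb (W.form_eq_zero_comm.1 h)⟩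
    · let j₁ : Fin W.wittIndex := ⟨1, by omega⟩
      have hj₁ : (j₁ : ℕ) < k - 1 := by simp only [j₁]; omega
      have hj₁c : j₁ ≠ c := fun h => by simp only [j₁, c, Fin.mk.injEq] at h; omega
      have hj₀₁ : j₀ ≠ j₁ := fun h => by simp [j₀, j₁] at h
      obtain ⟨Z₃, hZ₃, hZ₃e⟩ := leaf j₁ (a c) hj₁ (hab.sing_left c) (haP c) hcX
        (by rw [hab.form_eq', if_neg hj₁c])
      have hcZ₃ : a c ∈ Z₃.1 :=
        hZ₃e ▸ Submodule.mem_sup_right (Submodule.mem_span_singleton_self _)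
      have ha₀ : a j₀ ∈ Z₃.1 := by
        rw [hZ₃e]
        refine Submodule.mem_sup_left ⟨haX j₀ (by omega), mem_perp_span.2 ?_⟩
        rintro _ rfl
        rw [hab.form_eq, if_neg hj₀₁]
      have hXle : ∀ {Z : W.SingularSubspace k} {v : V},
          Z.1 = X.1 ⊓ W.perp (Submodule.span F {b j₀}) ⊔ Submodule.span F {v} →
          X.1 ≤ Z.1 ⊔ Z₃.1 := by
        intro Z v hZ
        conv_lhs => rw [← inf_perp_sup_span_singleton (W := W) (y := b j₀) (haX j₀ (by omega))
          (by rw [hab.form_eq]; simp)]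
        refine sup_le_sup (hZ ▸ le_sup_left) ?_
        rwa [Submodule.span_singleton_le_iff_mem]
      have hfar : ∀ {Z : W.SingularSubspace k} {v t : V},
          Z.1 = X.1 ⊓ W.perp (Submodule.span F {b j₀}) ⊔ Submodule.span F {v} →
          t ∈ W.perp X.1 → W.form (a c) t = 0 → W.form v t ≠ 0 →
          Z ≠ Z₃ ∧ ¬ (W.polarGrassmannGraph k).Adj Z Z₃ := by
        intro Z v t hZ ht hct hvt
        have h1 : X.1 ⊔ Submodule.span F {a c} ⊔ Submodule.span F {v} ≤ Z.1 ⊔ Z₃.1 := by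
          refine sup_le (sup_le (hXle hZ) ?_) ?_
          · rw [Submodule.span_singleton_le_iff_mem]
            exact Submodule.mem_sup_right hcZ₃
          · rw [hZ]
            exact le_sup_right.trans le_sup_left
        have hv : v ∉ X.1 ⊔ Submodule.span F {a c} := by
          intro hmem
          refine hvt (mem_perp'.1 (?_ : t ∈ W.perp (X.1 ⊔ Submodule.span F {a c})) v hmem)
          rw [perp_sup]
          refine ⟨ht, mem_perp_span.2 ?_⟩
          rintro _ rfl
          exact W.form_eq_zero_comm.1 hct
        have h2 := Submodule.finrank_mono h1
        rw [Submodule.finrank_sup_span_singleton hv, Submodule.finrank_sup_span_singleton hcX,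
          X.2.2] at h2
        have h3 := Submodule.finrank_sup_add_finrank_inf_eq Z.1 Z₃.1
        rw [Z.2.2, Z₃.2.2] at h3
        refine ⟨?_, fun hadj => ?_⟩
        · rintro rfl
          rw [inf_idem, Z.2.2] at h3
          omega
        · have := Adj.finrank_inf hadj
          omega
      refine ⟨Z₃, hZ₃, ?_, hfar hZ₁e (hbP d hkd) (by rw [hab.form_eq, if_neg hcd]) hada,
        hfar hZ₂e (haP d) (hab.form_left _ _) hbda⟩
      refine adj_of_eq_sup_span hk hZ₀e hZ₃e (X.2.1.mono (sup_le inf_le_left inf_le_left))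
        (perp_anti inf_le_left (haP c)) (perp_anti inf_le_left (haP c)) (hab.form_left _ _) ?_ ?_
      · rintro rfl
        have hb₀ : b j₀ ∈ W.perp Z₀.1 := by
          rw [hZ₀e, perp_sup]
          refine ⟨le_perp_comm.1 inf_le_right (Submodule.mem_span_singleton_self _),
            mem_perp_span.2 ?_⟩
          rintro _ rfl
          rw [hab.form_eq', if_neg hc]
        have := mem_perp'.1 hb₀ _ ha₀
        rw [hab.form_eq] at this
        simp at this
      · have h1 := Submodule.finrank_sup_add_finrank_inf_eq
          (X.1 ⊓ W.perp (Submodule.span F {b j₀})) (X.1 ⊓ W.perp (Submodule.span F {b j₁}))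
        have h2 : finrank F ↥(X.1 ⊓ W.perp (Submodule.span F {b j₀}) ⊔
            X.1 ⊓ W.perp (Submodule.span F {b j₁})) ≤ finrank F X.1 :=
          Submodule.finrank_mono (sup_le inf_le_left inf_le_left)
        have h3 : X.1 ⊓ W.perp (Submodule.span F {b j₀}) ⊓
            (X.1 ⊓ W.perp (Submodule.span F {b j₁})) ⊔ Submodule.span F {a c} ≤ Z₀.1 ⊓ Z₃.1 := by
          refine sup_le (le_inf ?_ ?_) ?_
          · rw [hZ₀e]
            exact inf_le_left.trans le_sup_left
          · rw [hZ₃e]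
            exact inf_le_right.trans le_sup_left
          · rw [Submodule.span_singleton_le_iff_mem]
            exact ⟨hcZ₀, hcZ₃⟩
        have h4 := Submodule.finrank_mono h3
        rw [Submodule.finrank_sup_span_singleton fun h => hcX
          ((inf_le_left.trans inf_le_left : X.1 ⊓ W.perp (Submodule.span F {b j₀}) ⊓
            (X.1 ⊓ W.perp (Submodule.span F {b j₁})) ≤ X.1) h)] at h4
        have h5 := hH j₀ hj₀
        have h6 := hH j₁ hj₁
        rw [X.2.2] at h2
        omega

end Opposite

/-- Automorphisms of the graph preserve opposition, if the orthogonal space of dimension `8` and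
Witt index `4` with `k = 2` is excluded. -/
theorem opposite_iff_map (hk : k < W.wittIndex)
    (hex : ¬ (W.IsOrthogonal ∧ finrank F V = 8 ∧ W.wittIndex = 4 ∧ k = 2))
    (φ : W.polarGrassmannGraph k ≃g W.polarGrassmannGraph k) (X Y : W.SingularSubspace k) :
    W.Opposite (φ X).1 (φ Y).1 ↔ W.Opposite X.1 Y.1 := by
  have key : ∀ (n : ℕ) (φ : W.polarGrassmannGraph k ≃g W.polarGrassmannGraph k)
      (X Y : W.SingularSubspace k), (W.polarGrassmannGraph k).dist X Y + n = k →
      ¬ W.Opposite X.1 Y.1 → ¬ W.Opposite (φ X).1 (φ Y).1 := by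
    intro n
    induction n with
    | zero =>
      intro φ X Y hd h hopp
      rw [add_zero] at hd
      have h1 := dist_of_not_opposite hk h
      have h2 := hopp.two_le_dist hk
      rw [dist_map] at h2
      have h3 := (hopp.hasClawOrGap hk (by omega) (by rw [dist_map, hd]) hex).map φ.symm
      rw [φ.symm_apply_apply, φ.symm_apply_apply] at h3
      exact not_hasClawOrGap hk h (Submodule.finrank_eq_zero.1 (by omega)) h3
    | succ n ih =>
      intro φ X Y hd h hopp
      have hne : X ≠ Y := by
        rintro rfl
        exact hopp.1 rfl
      obtain ⟨Z, hYZ, hXZ, hdZ⟩ := exists_adj_not_opposite_of_dist_lt hk h hne (by omega)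
      refine ih φ X Z (by omega) hXZ (hopp.of_adj hk (φ.map_adj_iff.2 hYZ) ?_)
      rw [dist_map, dist_map, hdZ]
  have key' : ∀ (φ : W.polarGrassmannGraph k ≃g W.polarGrassmannGraph k)
      (X Y : W.SingularSubspace k), ¬ W.Opposite X.1 Y.1 → ¬ W.Opposite (φ X).1 (φ Y).1 :=
    fun φ X Y h => key (finrank F ↥(X.1 ⊓ Y.1)) φ X Y
      (by rw [add_comm]; exact dist_of_not_opposite hk h) h
  refine ⟨fun h => by_contra fun h' => key' φ X Y h' h, fun h => by_contra fun h' => ?_⟩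
  have := key' φ.symm _ _ h'
  rw [φ.symm_apply_apply, φ.symm_apply_apply] at this
  exact this h

end PolarForm

/-! ### Stirling and Bell numbers -/

namespace Nat

theorem stirlingSecond_succ_succ_eq_sum (n t : ℕ) :
    stirlingSecond (n + 1) (t + 1) =
      ∑ i ∈ Finset.range (n + 1), n.choose i * stirlingSecond i t := by
  induction n generalizing t with
  | zero => cases t <;> simp [stirlingSecond]
  | succ n ih =>
    have h1 : ∑ i ∈ Finset.range (n + 2), (n + 1).choose i * stirlingSecond i t =
        ∑ i ∈ Finset.range (n + 1), n.choose i * stirlingSecond (i + 1) t +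
          stirlingSecond (n + 1) (t + 1) := by
      rw [Finset.sum_range_succ', ih t]
      simp only [Nat.choose_succ_succ, add_mul, Finset.sum_add_distrib, Nat.choose_zero_right]
      rw [add_assoc]
      congr 1
      rw [Finset.sum_range_succ, Nat.choose_succ_self, zero_mul, add_zero,
        Finset.sum_range_succ' _ n, Nat.choose_zero_right]
    rw [h1, stirlingSecond_succ_succ (n + 1) t]
    cases t with
    | zero => simp
    | succ t =>
      simp only [stirlingSecond_succ_succ _ t, mul_add, Finset.sum_add_distrib]
      rw [← ih t, ← stirlingSecond_succ_succ n t]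
      have h2 : ∑ i ∈ Finset.range (n + 1), n.choose i * ((t + 1) * stirlingSecond i (t + 1)) =
          (t + 1) * stirlingSecond (n + 1) (t + 1 + 1) := by
        rw [ih (t + 1), Finset.mul_sum]
        exact Finset.sum_congr rfl fun i _ => by ring
      rw [h2]
      ring

theorem sum_stirlingSecond_eq_bell (n N : ℕ) (h : n ≤ N) :
    ∑ t ∈ Finset.range (N + 1), stirlingSecond n t = Nat.bell n := by
  induction n using Nat.strong_induction_on generalizing N with
  | _ n ih =>
    cases n with
    | zero =>
      rw [Finset.sum_range_succ']
      simp
    | succ n =>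
      obtain ⟨M, rfl⟩ : ∃ M, N = M + 1 := ⟨N - 1, by omega⟩
      rw [Finset.sum_range_succ', stirlingSecond_succ_zero, add_zero]
      simp only [stirlingSecond_succ_succ_eq_sum]
      rw [Finset.sum_comm, Nat.bell_succ, ← Nat.range_succ_eq_Iic, ← Finset.sum_range_reflect]
      refine Finset.sum_congr rfl fun i hi => ?_
      have hi := Finset.mem_range.1 hi
      rw [← Finset.mul_sum, ih _ (by omega) M (by omega), Nat.choose_symm_of_eq_add (b := i)
        (by omega)]
      congr 2

end Nat

namespace PolarForm

/-! ### The number of patterns -/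

/-- The number of undefined values of a partial map. -/
def numNone {α : Type*} {n : ℕ} (r : Fin n → Option α) : ℕ :=
  ∑ i, if (r i).isNone then 1 else 0

theorem numNone_snoc {α : Type*} {n : ℕ} (r : Fin n → Option α) (o : Option α) :
    numNone (Fin.snoc r o : Fin (n + 1) → Option α) = numNone r + if o.isNone then 1 else 0 := by
  rw [numNone, Fin.sum_univ_castSucc]
  simp [numNone]

/-- The possible values at `n` that extend a pattern on `{0, …, n - 1}`. -/
def extensions {n : ℕ} (r : Fin n → Option ℕ) : Finset (Option ℕ) :=
  insert none ({j ∈ Finset.range n | ∀ i, r i ≠ some j}.map Function.Embedding.some)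

/-- The patterns on `{0, …, n - 1}`, built recursively. -/
def patterns : (n : ℕ) → Finset (Fin n → Option ℕ)
  | 0 => {Fin.elim0}
  | n + 1 => (patterns n).biUnion fun r =>
      (extensions r).image fun o => (Fin.snoc r o : Fin (n + 1) → Option ℕ)

theorem mem_extensions {n : ℕ} {r : Fin n → Option ℕ} {o : Option ℕ} :
    o ∈ extensions r ↔ ∀ j, o = some j → j < n ∧ ∀ i, r i ≠ some j := by
  cases o <;> simp [extensions]

theorem mem_patterns {n : ℕ} {r : Fin n → Option ℕ} :
    r ∈ patterns n ↔ (∀ i j, r i = some j → j < i) ∧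
      ∀ i i' j, r i = some j → r i' = some j → i = i' := by
  induction n with
  | zero => simp [patterns, Subsingleton.elim r Fin.elim0]
  | succ n ih =>
    induction r using Fin.snocCases with
    | snoc r o =>
      have h1 : (Fin.snoc r o : Fin (n + 1) → Option ℕ) ∈ patterns (n + 1) ↔
          r ∈ patterns n ∧ o ∈ extensions r := by
        simp only [patterns, Finset.mem_biUnion, Finset.mem_image]
        constructor
        · rintro ⟨r', hr', o', ho', h⟩
          obtain ⟨rfl, rfl⟩ := Fin.snoc_injective2 h
          exact ⟨hr', ho'⟩
        · rintro ⟨hr, ho⟩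
          exact ⟨r, hr, o, ho, rfl⟩
      rw [h1, ih]
      simp only [mem_extensions, Fin.forall_fin_succ', Fin.snoc_castSucc, Fin.snoc_last,
        Fin.val_castSucc, Fin.val_last, Fin.castSucc_inj, (Fin.castSucc_lt_last _).ne,
        (Fin.castSucc_lt_last _).ne']
      constructor
      · rintro ⟨⟨ha, hb⟩, ho⟩
        exact ⟨⟨ha, fun j hj => (ho j hj).1⟩, fun i => ⟨hb i, fun j hj hj' => (ho j hj').2 i hj⟩,
          fun i j hj hj' => (ho j hj).2 i hj', fun _ _ _ => trivial⟩
      · rintro ⟨⟨ha, hb⟩, hc, hd, -⟩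
        exact ⟨⟨ha, fun i => (hc i).1⟩, fun j hj => ⟨hb j hj, fun i hi => (hc i).2 j hi hj⟩⟩

theorem card_unused {n : ℕ} {r : Fin n → Option ℕ} (hr : r ∈ patterns n) :
    ({j ∈ Finset.range n | ∀ i, r i ≠ some j} : Finset ℕ).card = numNone r := by
  obtain ⟨h1, h2⟩ := mem_patterns.1 hr
  have h3 : ({j ∈ Finset.range n | ¬ ∀ i, r i ≠ some j} : Finset ℕ) =
      ({i | ¬ (r i).isNone} : Finset (Fin n)).image fun i => (r i).getD 0 := by
    ext j
    simp only [Finset.mem_filter, Finset.mem_range, Finset.mem_image, Finset.mem_univ, true_and]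
    push Not
    constructor
    · rintro ⟨-, i, hi⟩
      exact ⟨i, by simp [hi], by simp [hi]⟩
    · rintro ⟨i, hi, rfl⟩
      obtain ⟨j, hj⟩ := Option.ne_none_iff_exists'.1 (by simpa using hi : r i ≠ none)
      rw [hj, Option.getD_some]
      exact ⟨(h1 i j hj).trans i.2, i, hj⟩
  have h4 := Finset.card_filter_add_card_filter_not (s := Finset.range n)
    (fun j => ∀ i, r i ≠ some j)
  rw [h3, Finset.card_image_of_injOn, Finset.card_range] at h4
  · have h5 := Finset.card_filter_add_card_filter_not (s := (Finset.univ : Finset (Fin n)))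
      (fun i => (r i).isNone)
    rw [Finset.card_univ, Fintype.card_fin] at h5
    rw [numNone, ← Finset.card_filter]
    omega
  · intro i hi i' hi' h
    obtain ⟨j, hj⟩ := Option.ne_none_iff_exists'.1 (by simpa using hi : r i ≠ none)
    obtain ⟨j', hj'⟩ := Option.ne_none_iff_exists'.1 (by simpa using hi' : r i' ≠ none)
    simp only [hj, hj', Option.getD_some] at h
    subst h
    exact h2 i i' j hj hj'

/-- Patterns with `t` undefined values are counted by Stirling numbers. -/
theorem card_patterns (n t : ℕ) :
    ({r ∈ patterns n | numNone r = t} : Finset _).card = Nat.stirlingSecond n t := by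
  induction n generalizing t with
  | zero => cases t <;> simp [patterns, numNone, Nat.stirlingSecond]
  | succ n ih =>
    have h1 : ∀ r ∈ patterns n, (∑ o ∈ extensions r,
        if numNone (Fin.snoc r o : Fin (n + 1) → Option ℕ) = t then 1 else 0) =
        (if numNone r + 1 = t then 1 else 0) + if numNone r = t then t else 0 := by
      intro r hr
      rw [extensions, Finset.sum_insert (by simp), Finset.sum_map]
      simp only [numNone_snoc, Function.Embedding.some_apply, Option.isNone_none,
        Option.isNone_some,
        if_true, Bool.false_eq_true, if_false, add_zero]
      rw [Finset.sum_const, card_unused hr, smul_eq_mul]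
      split_ifs <;> simp_all
    have h2 : ({r ∈ patterns (n + 1) | numNone r = t} : Finset _).card =
        ∑ r ∈ patterns n, ∑ o ∈ extensions r,
          if numNone (Fin.snoc r o : Fin (n + 1) → Option ℕ) = t then 1 else 0 := by
      rw [Finset.card_filter, patterns, Finset.sum_biUnion]
      · refine Finset.sum_congr rfl fun r _ => Finset.sum_image fun o _ o' _ h => ?_
        exact (Fin.snoc_injective2 h).2
      · intro r _ r' _ hne
        rw [Function.onFun, Finset.disjoint_left]
        intro s hs hs'
        obtain ⟨o, -, rfl⟩ := Finset.mem_image.1 hs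
        obtain ⟨o', -, h⟩ := Finset.mem_image.1 hs'
        exact hne (Fin.snoc_injective2 h).1.symm
    rw [h2, Finset.sum_congr rfl h1, Finset.sum_add_distrib, ← Finset.card_filter,
      ← Finset.sum_filter, Finset.sum_const, ih, smul_eq_mul]
    cases t with
    | zero => simp
    | succ t =>
      simp only [Nat.add_right_cancel_iff]
      rw [ih, Nat.stirlingSecond_succ_succ]
      ring

theorem ncard_isPattern (m N : ℕ) :
    {r : Fin m → Option (Fin m) | IsPattern r ∧ Fintype.card {i // r i = none} ≤ N}.ncard =
      ∑ t ∈ Finset.range (N + 1), Nat.stirlingSecond m t := by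
  have hinj : Function.Injective fun (r : Fin m → Option (Fin m)) (i : Fin m) =>
      (r i).map Fin.val := fun r r' h => funext fun i =>
    Option.map_injective Fin.val_injective (congrFun h i)
  have hnone : ∀ r : Fin m → Option (Fin m),
      numNone (fun i => (r i).map Fin.val) = Fintype.card {i // r i = none} := by
    intro r
    rw [numNone, ← Finset.card_filter, Fintype.card_subtype]
    simp
  have h1 : (fun (r : Fin m → Option (Fin m)) (i : Fin m) => (r i).map Fin.val) ''
      {r | IsPattern r ∧ Fintype.card {i // r i = none} ≤ N} =
      ({r ∈ patterns m | numNone r ∈ Finset.range (N + 1)} : Finset _) := by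
    ext s
    simp only [Set.mem_image, Set.mem_ofPred_eq, Finset.coe_filter, mem_patterns, Finset.mem_range,
      Nat.lt_succ_iff]
    constructor
    · rintro ⟨r, ⟨⟨h1, h2⟩, h3⟩, rfl⟩
      rw [hnone]
      refine ⟨⟨fun i j hj => ?_, fun i i' j hj hj' => ?_⟩, h3⟩
      · obtain ⟨j, hj₁ : r i = some j, rfl⟩ := Option.map_eq_some_iff.1 hj
        exact h1 i j hj₁
      · obtain ⟨j, hj₁ : r i = some j, rfl⟩ := Option.map_eq_some_iff.1 hj
        obtain ⟨j', hj₂ : r i' = some j', h⟩ := Option.map_eq_some_iff.1 hj'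
        rw [Fin.ext h] at hj₂
        exact h2 i i' j hj₁ hj₂
    · rintro ⟨⟨h1, h2⟩, h3⟩
      have hs : (fun i => ((s i).bind fun j => if h : j < m then some (⟨j, h⟩ : Fin m) else
          none).map Fin.val) = s := by
        funext i
        cases h : s i with
        | none => rfl
        | some j => simp [(h1 i j h).trans i.2]
      refine ⟨fun i => (s i).bind fun j => if h : j < m then some (⟨j, h⟩ : Fin m) else none,
        ⟨⟨fun i j hj => ?_, fun i i' j hj hj' => ?_⟩, ?_⟩, hs⟩
      · exact h1 i j ((congrFun hs i).symm.trans (congrArg (Option.map Fin.val) hj))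
      · exact h2 i i' j ((congrFun hs i).symm.trans (congrArg (Option.map Fin.val) hj))
          ((congrFun hs i').symm.trans (congrArg (Option.map Fin.val) hj'))
      · rw [← hnone, hs]
        exact h3
  rw [← Set.ncard_image_of_injective _ hinj, h1, Set.ncard_coe_finset,
    Finset.card_eq_sum_card_fiberwise (t := Finset.range (N + 1)) (f := numNone)]
  · refine Finset.sum_congr rfl fun t ht => ?_
    rw [← card_patterns, Finset.filter_filter]
    congr 1
    refine Finset.filter_congr fun r _ => ⟨fun h => h.2, fun h => ⟨h ▸ ht, h⟩⟩
  · intro r hr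
    exact (Finset.mem_filter.1 hr).2

/-! ### The sum over the types -/

theorem snoc_mem_geodesicTypes {m N : ℕ} {s : Fin (m + 1) → ℕ} {t : ℕ} :
    (Fin.snoc s t : Fin (m + 2) → ℕ) ∈ geodesicTypes (m + 1) N ↔
      s ∈ geodesicTypes m N ∧ t ≤ N ∧ (t = s (Fin.last m) ∨ t = s (Fin.last m) + 1) := by
  have h0 : (Fin.snoc s t : Fin (m + 2) → ℕ) 0 = s 0 := by
    rw [← Fin.castSucc_zero, Fin.snoc_castSucc]
  rw [geodesicTypes, geodesicTypes, Finset.mem_filter, Finset.mem_filter, h0,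
    Fin.forall_fin_succ', Fintype.mem_piFinset, Fintype.mem_piFinset, Fin.forall_fin_succ']
  simp only [Fin.succ_castSucc, Fin.snoc_castSucc, Fin.succ_last, Fin.snoc_last,
    Finset.mem_range, Nat.lt_succ_iff]
  tauto

/-- All values `1, …, t` occur in a type with last term `t`, so the quotients in `typeSum` are
exact. -/
theorem factorial_dvd_prod {m N : ℕ} {s : Fin (m + 1) → ℕ} (hs : s ∈ geodesicTypes m N) :
    (s (Fin.last m)).factorial ∣ ∏ i, s i := by
  induction m with
  | zero =>
    have h1 : s 0 = 1 := (Finset.mem_filter.1 hs).2.1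
    simp [h1]
  | succ m ih =>
    induction s using Fin.snocCases with
    | snoc s t =>
      obtain ⟨hs', -, h⟩ := snoc_mem_geodesicTypes.1 hs
      rw [Fin.prod_snoc, Fin.snoc_last]
      rcases h with rfl | rfl
      · exact (ih hs').mul_right _
      · rw [Nat.factorial_succ, mul_comm]
        exact Nat.mul_dvd_mul (ih hs') dvd_rfl

theorem one_le_last_of_mem {m N : ℕ} {s : Fin (m + 1) → ℕ} (hs : s ∈ geodesicTypes m N) :
    1 ≤ s (Fin.last m) := by
  induction m with
  | zero => exact (Finset.mem_filter.1 hs).2.1.ge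
  | succ m ih =>
    induction s using Fin.snocCases with
    | snoc s t =>
      obtain ⟨hs', -, h⟩ := snoc_mem_geodesicTypes.1 hs
      have := ih hs'
      rw [Fin.snoc_last]
      omega

/-- The last term of a type is fixed in order to have a recursion: the type without its last term
ends in `t` or `t - 1`. -/
theorem sum_geodesicTypes (m N t : ℕ) (ht : t ≤ N) :
    ∑ s ∈ geodesicTypes m N with s (Fin.last m) = t, (∏ i, s i) / (s (Fin.last m)).factorial =
      Nat.stirlingSecond (m + 1) t := by
  induction m generalizing t with
  | zero =>
    have h1 : ∀ s, s ∈ ({s ∈ geodesicTypes 0 N | s (Fin.last 0) = t} : Finset _) ↔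
        t = 1 ∧ s = fun _ => 1 := by
      intro s
      simp only [geodesicTypes, Finset.mem_filter, Fintype.mem_piFinset, Finset.mem_range]
      constructor
      · rintro ⟨⟨-, h, -⟩, h'⟩
        exact ⟨h'.symm.trans h, funext fun i => by
          rw [show i = 0 from Fin.ext (by omega)]
          exact h⟩
      · rintro ⟨rfl, rfl⟩
        exact ⟨⟨fun _ => show 1 < N + 1 by omega, rfl, fun i => i.elim0⟩, rfl⟩
    rcases eq_or_ne t 1 with rfl | ht1
    · have h2 : ({s ∈ geodesicTypes 0 N | s (Fin.last 0) = 1} : Finset _) = {fun _ => 1} := by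
        ext s
        rw [h1, Finset.mem_singleton, and_iff_right rfl]
      rw [h2, Finset.sum_singleton]
      simp [Nat.stirlingSecond]
    · rw [Finset.eq_empty_of_forall_notMem fun s hs => ht1 ((h1 s).1 hs).1, Finset.sum_empty]
      rcases t with _ | _ | t
      · rfl
      · exact absurd rfl ht1
      · exact (Nat.stirlingSecond_eq_zero_of_lt (by omega)).symm
  | succ m ih =>
    cases t with
    | zero =>
      rw [Finset.filter_false_of_mem, Finset.sum_empty, Nat.stirlingSecond_succ_zero]
      intro s hs h0
      have h1 := one_le_last_of_mem hs
      omega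
    | succ t =>
      have h1 : ({s ∈ geodesicTypes (m + 1) N | s (Fin.last (m + 1)) = t + 1} : Finset _) =
          (({s ∈ geodesicTypes m N | s (Fin.last m) = t + 1} : Finset _) ∪
            ({s ∈ geodesicTypes m N | s (Fin.last m) = t} : Finset _)).image
          fun s => (Fin.snoc s (t + 1) : Fin (m + 2) → ℕ) := by
        ext s
        induction s using Fin.snocCases with
        | snoc s t' =>
          rw [Finset.mem_filter, snoc_mem_geodesicTypes, Fin.snoc_last, Finset.mem_image]
          constructor
          · rintro ⟨⟨hs, -, h⟩, rfl⟩
            refine ⟨s, ?_, rfl⟩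
            rw [Finset.mem_union, Finset.mem_filter, Finset.mem_filter]
            rcases h with h | h
            · exact Or.inl ⟨hs, h.symm⟩
            · exact Or.inr ⟨hs, by omega⟩
          · rintro ⟨s', hs', h⟩
            obtain ⟨rfl, rfl⟩ := Fin.snoc_injective2 h
            rw [Finset.mem_union, Finset.mem_filter, Finset.mem_filter] at hs'
            rcases hs' with ⟨hs, h⟩ | ⟨hs, h⟩
            · exact ⟨⟨hs, ht, Or.inl h.symm⟩, rfl⟩
            · exact ⟨⟨hs, ht, Or.inr (by rw [h])⟩, rfl⟩
      rw [h1, Finset.sum_image fun s _ s' _ h => (Fin.snoc_injective2 h).1, Finset.sum_union,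
        Nat.stirlingSecond_succ_succ, ← ih (t + 1) ht, ← ih t (by omega), Finset.mul_sum]
      · congr 1
        · refine Finset.sum_congr rfl fun s hs => ?_
          obtain ⟨hs, h⟩ := Finset.mem_filter.1 hs
          rw [Fin.prod_snoc, Fin.snoc_last, h, mul_comm, Nat.mul_div_assoc _
            (h ▸ factorial_dvd_prod hs)]
        · refine Finset.sum_congr rfl fun s hs => ?_
          obtain ⟨hs, h⟩ := Finset.mem_filter.1 hs
          rw [Fin.prod_snoc, Fin.snoc_last, h, mul_comm, Nat.factorial_succ,
            Nat.mul_div_mul_left _ _ t.succ_pos]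
      · rw [Finset.disjoint_filter]
        intro s _ h h'
        omega

theorem typeSum_eq (m N : ℕ) :
    typeSum m N = ∑ t ∈ Finset.range (N + 1), Nat.stirlingSecond (m + 1) t := by
  rw [typeSum, ← Finset.sum_fiberwise_of_maps_to (t := Finset.range (N + 1))
    (g := fun s => s (Fin.last m))]
  · exact Finset.sum_congr rfl fun t ht =>
      sum_geodesicTypes m N t (Nat.lt_succ_iff.1 (Finset.mem_range.1 ht))
  · intro s hs
    exact Fintype.mem_piFinset.1 (Finset.mem_filter.1 hs).1 _

end PolarForm

/-! ### Geodesic-transitive graphs are distance-regular -/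

namespace SimpleGraph

variable {α : Type*} {G : SimpleGraph α}

theorem Connected.exists_adj_dist_eq (hG : G.Connected) {x y : α} {n : ℕ}
    (h : G.dist x y = n + 1) : ∃ z, G.Adj x z ∧ G.dist z y = n := by
  obtain ⟨p, hp, rfl, rfl⟩ := PolarForm.exists_isGeodesic hG x y h
  obtain ⟨q, hq⟩ := PolarForm.dist_le_of_adj (p := fun i => p i.succ) fun i => by
    simpa using hp.1 i.succ
  refine ⟨p 1, hp.1 0, le_antisymm ((dist_le q).trans_eq hq) ?_⟩
  have h1 := hG.dist_triangle (u := p 0) (v := p 1) (w := p (Fin.last (n + 1)))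
  rw [h, show G.dist (p 0) (p 1) = 1 from dist_eq_one_iff_adj.2 (hp.1 0)] at h1
  omega

theorem Connected.exists_dist_eq [Finite α] (hG : G.Connected) {i : ℕ} (hi : i ≤ G.diam) :
    ∃ x y, G.dist x y = i := by
  have := hG.nonempty
  induction hi using Nat.decreasingInduction with
  | self => exact exists_dist_eq_diam
  | of_succ i _ ih =>
    obtain ⟨x, y, h⟩ := ih
    obtain ⟨z, -, hz⟩ := hG.exists_adj_dist_eq h
    exact ⟨z, y, hz⟩

theorem IsGeodesicTransitive.exists_iso (hG : G.IsGeodesicTransitive) {x y x' y' : α}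
    (h : G.dist x y = G.dist x' y') : ∃ φ : G ≃g G, φ x = x' ∧ φ y = y' := by
  obtain ⟨l, hl⟩ : ∃ l, G.dist x y = l := ⟨_, rfl⟩
  obtain ⟨p, hp, rfl, rfl⟩ := PolarForm.exists_isGeodesic hG.1 x y hl
  obtain ⟨p', hp', rfl, rfl⟩ := PolarForm.exists_isGeodesic hG.1 x' y' (h.symm.trans hl)
  obtain ⟨φ, hφ⟩ := hG.2 _ p p' hp hp'
  exact ⟨φ, hφ _, hφ _⟩

theorem IsGeodesicTransitive.exists_ncard (hG : G.IsGeodesicTransitive) (i j : ℕ) :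
    ∃ n, ∀ x y, G.dist x y = i → {z | G.Adj x z ∧ G.dist z y = j}.ncard = n := by
  by_cases h : ∃ x y, G.dist x y = i
  · obtain ⟨x, y, rfl⟩ := h
    refine ⟨{z | G.Adj x z ∧ G.dist z y = j}.ncard, fun x' y' h => ?_⟩
    obtain ⟨φ, rfl, rfl⟩ := hG.exists_iso h.symm
    symm
    rw [← Set.ncard_image_of_injective _ φ.injective]
    congr 1
    ext z
    obtain ⟨z, rfl⟩ := φ.surjective z
    simp only [φ.injective.mem_set_image, Set.mem_ofPred_eq, φ.map_adj_iff, PolarForm.dist_map]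
  · push Not at h
    exact ⟨0, fun x y hxy => absurd hxy (h x y)⟩

theorem IsGeodesicTransitive.isDistanceRegular [Finite α] (hG : G.IsGeodesicTransitive) :
    G.IsDistanceRegular := by
  choose n hn using hG.exists_ncard
  refine ⟨hG.1, fun i => n i (i + 1), fun i => n i (i - 1), fun i hi => ⟨?_, hn i _⟩,
    fun i hi hi' => ⟨?_, hn i _⟩⟩
  · obtain ⟨x, y, h⟩ := hG.1.exists_dist_eq hi
    obtain ⟨z, hz, hzy⟩ := hG.1.exists_adj_dist_eq h
    have hpos : 0 < {z' | G.Adj z z' ∧ G.dist z' y = i + 1}.ncard :=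
      (Set.ncard_pos (Set.toFinite _)).2 ⟨x, hz.symm, h⟩
    exact hpos.trans_eq (hn i _ z y hzy)
  · obtain ⟨x, y, h⟩ := hG.1.exists_dist_eq hi'
    obtain ⟨z, hz, hzy⟩ := hG.1.exists_adj_dist_eq (x := x) (y := y) (n := i - 1) (by omega)
    have hpos : 0 < {z | G.Adj x z ∧ G.dist z y = i - 1}.ncard :=
      (Set.ncard_pos (Set.toFinite _)).2 ⟨z, hz, hzy⟩
    exact hpos.trans_eq (hn i _ x y h)

end SimpleGraph

namespace PolarForm

variable {F V : Type*} [Field F] [AddCommGroup V] [Module F V] {W : PolarForm F V} {k m : ℕ}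

/-! ### The orbits on the geodesics -/

theorem mem_orbit_iff {H : Subgroup (W.polarGrassmannGraph k ≃g W.polarGrassmannGraph k)}
    {l : ℕ} {X X' : Fin l → W.SingularSubspace k} :
    X' ∈ MulAction.orbit H X ↔ ∃ φ ∈ H, ∀ i, φ (X i) = X' i :=
  ⟨fun ⟨φ, h⟩ => ⟨φ.1, φ.2, fun i => congrFun h i⟩, fun ⟨φ, hφ, h⟩ => ⟨⟨φ, hφ⟩, funext h⟩⟩

theorem isGeodesic_map {α : Type*} {G : SimpleGraph α} {l : ℕ} {p p' : Fin (l + 1) → α}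
    (hp : G.IsGeodesic p) {φ : G ≃g G} (hφ : ∀ i, φ (p i) = p' i) : G.IsGeodesic p' := by
  obtain rfl : (fun i => φ (p i)) = p' := funext hφ
  exact ⟨fun i => φ.map_adj_iff.2 (hp.1 i), (dist_map φ _ _).trans hp.2⟩

variable [FiniteDimensional F V]

/-- The pattern of a geodesic is an invariant of its orbit under any group of automorphisms that
contains the isometries; each pattern that leaves at most `ω - k` indices undefined occurs. -/
theorem ncard_orbits [Finite V] (hk : k < W.wittIndex) (hmk : m ≤ k)
    {H : Subgroup (W.polarGrassmannGraph k ≃g W.polarGrassmannGraph k)}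
    (hH : W.isometryAut k ≤ H) :
    {O | ∃ X : Fin (m + 1) → W.SingularSubspace k, (W.polarGrassmannGraph k).IsGeodesic X ∧
      ¬ W.Opposite (X 0).1 (X (Fin.last m)).1 ∧ O = MulAction.orbit H X}.ncard =
    {r : Fin m → Option (Fin m) | IsPattern r ∧
      Fintype.card {i // r i = none} ≤ W.wittIndex - k}.ncard := by
  have hex : ∀ r ∈ {r : Fin m → Option (Fin m) | IsPattern r ∧
      Fintype.card {i // r i = none} ≤ W.wittIndex - k},
      ∃ X : Fin (m + 1) → W.SingularSubspace k, W.HasPattern k r X :=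
    fun r hr => exists_hasPattern_of_card_le hmk hk.le hr.1 hr.2
  choose X hX using hex
  refine (Set.ncard_congr (fun r hr => MulAction.orbit H (X r hr)) (fun r hr => ?_)
    (fun r r' hr hr' h => ?_) ?_).symm
  · obtain ⟨h1, h2⟩ := (hX r hr).isGeodesic hk hr.1
    exact ⟨_, h1, h2, rfl⟩
  · obtain ⟨φ, -, hφ⟩ := mem_orbit_iff.1 (MulAction.orbit_eq_iff.1 h)
    exact ((hX r' hr').pattern_eq hk hr'.1 hr.1 (hX r hr) hφ).symm
  · rintro _ ⟨Y, hY, hopp, rfl⟩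
    obtain ⟨r, hr, hYr⟩ := exists_hasPattern hk hY hopp
    refine ⟨r, ⟨hr, (hYr.card_le hr).2⟩, MulAction.orbit_eq_iff.2 (mem_orbit_iff.2 ?_)⟩
    obtain ⟨φ, h, hφ⟩ := hYr.exists_isometryAut (hX r ⟨hr, (hYr.card_le hr).2⟩)
    exact ⟨φ, hH h, hφ⟩

/-- Apart from containing the isometries, all that is needed of `H` is that it preserves
opposition. -/
theorem orbitDescription [Finite V] (hk : k < W.wittIndex)
    {H : Subgroup (W.polarGrassmannGraph k ≃g W.polarGrassmannGraph k)}
    (hH : W.isometryAut k ≤ H)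
    (hopp : ∀ φ ∈ H, ∀ X Y, W.Opposite (φ X).1 (φ Y).1 ↔ W.Opposite X.1 Y.1) :
    W.OrbitDescription k H := by
  refine ⟨fun l hl hlk => ?_, fun m hm hmk r r' hr hr' X X' hX hX' => ?_, fun m hm => ?_⟩
  · obtain ⟨m, rfl⟩ : ∃ m, l = m + 1 := ⟨l - 1, by omega⟩
    obtain ⟨a, b, hab⟩ := W.exists_isHyperbolic_wittIndex
    obtain ⟨X, hX, -⟩ := hab.exists_hasOppositeForm (k := k) (m := m) (by omega) hk
    obtain ⟨h1, h2⟩ := hX.isGeodesic hk (by omega)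
    refine ⟨X, Set.ext fun Y => mem_orbit_iff.trans ⟨?_, fun hY => ?_⟩⟩
    · rintro ⟨φ, hφ, h⟩
      refine ⟨isGeodesic_map h1 h, ?_⟩
      rw [← h, ← h]
      exact (hopp φ hφ _ _).2 h2
    · obtain ⟨φ, hφ, h⟩ := hX.exists_isometryAut (by omega)
        (PolarForm.exists_hasOppositeForm hk (by omega) hY.1 hY.2)
      exact ⟨φ, hH hφ, h⟩
  · rw [mem_orbit_iff]
    constructor
    · rintro ⟨φ, -, hφ⟩
      exact hX.pattern_eq hk hr hr' hX' hφ
    · rintro rfl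
      obtain ⟨φ, h, hφ⟩ := hX.exists_isometryAut hX'
      exact ⟨φ, hH h, hφ⟩
  · rw [ncard_orbits hk hm hH, ncard_isPattern, typeSum_eq]
    exact ⟨rfl, Nat.sum_stirlingSecond_eq_bell _ _⟩

/-! ### The diameter -/

theorem diam_eq [Finite V] (hk : k < W.wittIndex) (hk1 : 1 ≤ k) :
    (W.polarGrassmannGraph k).diam = k + 1 := by
  have := nonempty_singularSubspace hk.le
  have htop := SimpleGraph.connected_iff_ediam_ne_top.1 (connected (W := W) hk)
  refine le_antisymm ?_ ?_
  · obtain ⟨X, Y, h⟩ := (W.polarGrassmannGraph k).exists_dist_eq_diam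
    rw [← h]
    by_cases hXY : W.Opposite X.1 Y.1
    · have := hXY.dist_eq hk
      omega
    · have := dist_of_not_opposite hk hXY
      omega
  · obtain ⟨a, b, hab⟩ := W.exists_isHyperbolic_wittIndex
    obtain ⟨X, hX, -⟩ := hab.exists_hasOppositeForm (k := k) (m := k) le_rfl hk
    exact (hX.isGeodesic hk hk1).1.2.ge.trans (SimpleGraph.dist_le_diam htop)

/-! ### Grassmann graphs that are not distance-regular -/

/-- Two vertices at distance two such that the radical of their sum has codimension two in the sum
have at most one common neighbour. -/
theorem eq_of_adj_of_adj (hk : k < W.wittIndex) {X Y Z Z' : W.SingularSubspace k}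
    (hinf : finrank F ↥(X.1 ⊓ Y.1) + 2 = k) (hperp : finrank F ↥(Y.1 ⊓ W.perp X.1) + 1 = k)
    (hXZ : (W.polarGrassmannGraph k).Adj X Z) (hZY : (W.polarGrassmannGraph k).Adj Z Y)
    (hXZ' : (W.polarGrassmannGraph k).Adj X Z') (hZY' : (W.polarGrassmannGraph k).Adj Z' Y) :
    Z = Z' := by
  have key : ∀ Z : W.SingularSubspace k, (W.polarGrassmannGraph k).Adj X Z →
      (W.polarGrassmannGraph k).Adj Z Y → (X.1 ⊓ W.perp Y.1) ⊔ (Y.1 ⊓ W.perp X.1) = Z.1 := by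
    intro Z h h'
    obtain ⟨h1, h2⟩ := (adj_iff hk).1 h
    obtain ⟨h3, h4⟩ := (adj_iff hk).1 h'
    have h5 := finrank_inf_perp_comm' (W := W) X Y
    have h6 : X.1 ⊓ Z.1 = X.1 ⊓ W.perp Y.1 :=
      Submodule.eq_of_le_of_finrank_le (le_inf inf_le_left (inf_le_right.trans h4)) (by omega)
    have h7 : Z.1 ⊓ Y.1 = Y.1 ⊓ W.perp X.1 :=
      Submodule.eq_of_le_of_finrank_le
        (le_inf inf_le_right (inf_le_left.trans (le_perp_comm.1 h2))) (by omega)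
    refine Submodule.eq_of_le_of_finrank_le ?_ ?_
    · rw [← h6, ← h7]
      exact sup_le inf_le_right inf_le_left
    · have h8 := Submodule.finrank_sup_add_finrank_inf_eq (X.1 ⊓ W.perp Y.1) (Y.1 ⊓ W.perp X.1)
      have h9 : finrank F ↥((X.1 ⊓ W.perp Y.1) ⊓ (Y.1 ⊓ W.perp X.1)) ≤ finrank F ↥(X.1 ⊓ Y.1) :=
        Submodule.finrank_mono (inf_le_inf inf_le_left inf_le_left)
      rw [Z.2.2]
      omega
  exact Subtype.ext ((key Z hXZ hZY).symm.trans (key Z' hXZ' hZY'))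

/-- The ends of a geodesic with the pattern `1 ↦ 0` have at most one common neighbour. -/
theorem exists_ncard_le_one [Finite V] (hk : k < W.wittIndex) (hk2 : 2 ≤ k) :
    ∃ X Y : W.SingularSubspace k, (W.polarGrassmannGraph k).dist X Y = 2 ∧
      {Z | (W.polarGrassmannGraph k).Adj X Z ∧
        (W.polarGrassmannGraph k).dist Z Y = 1}.ncard ≤ 1 := by
  let r : Fin 2 → Option (Fin 2) := ![none, some 0]
  have hr : IsPattern r := by unfold IsPattern; decide
  have hcard : Fintype.card {i // r i = none} = 1 := by decide
  obtain ⟨X, hX⟩ := exists_hasPattern_of_card_le hk2 hk.le hr (by omega)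
  obtain ⟨hgeo, hopp⟩ := hX.isGeodesic hk hr
  refine ⟨X 0, X (Fin.last 2), hgeo.2, (Set.ncard_le_one_iff (Set.toFinite _)).2 fun hZ hZ' => ?_⟩
  have hinf := dist_of_not_opposite hk hopp
  rw [hgeo.2] at hinf
  obtain ⟨x, y, w, hli, hspan, hform⟩ := hX
  obtain ⟨hxX, hyX, hwX⟩ := mem_of_eq_span hspan
  have h1 : (X (Fin.last 2)).1 ⊓ W.perp (X 0).1 < (X (Fin.last 2)).1 := by
    refine lt_of_le_of_ne inf_le_left fun h => ?_
    have h2 := (inf_eq_left.1 h) (hyX (Fin.last 2) 0 (by simp)) (x 1) (hxX 0 1 (by simp))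
    rw [form_eq_zero_comm, hform] at h2
    simp [r] at h2
  have h2 := Submodule.finrank_lt_finrank_of_lt h1
  rw [(X (Fin.last 2)).2.2] at h2
  have h3 : finrank F ↥((X 0).1 ⊓ (X (Fin.last 2)).1) ≠
      finrank F ↥((X (Fin.last 2)).1 ⊓ W.perp (X 0).1) := fun h3 =>
    hopp (opposite_iff_finrank.2 ⟨fun h => by
      have := hgeo.2
      rw [h, SimpleGraph.dist_self] at this
      omega, h3.symm⟩)
  have h4 := Submodule.finrank_mono (inf_le_inf_perp (X 0) (X (Fin.last 2)))
  exact eq_of_adj_of_adj hk hinf (by omega) hZ.1 (SimpleGraph.dist_eq_one_iff_adj.1 hZ.2)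
    hZ'.1 (SimpleGraph.dist_eq_one_iff_adj.1 hZ'.2)

/-- Opposite vertices at distance two: both vectors of a hyperbolic pair orthogonal to the ends give
a common neighbour. -/
theorem exists_two_le_ncard [Finite V] (hk : k < W.wittIndex) (hk1 : 1 ≤ k) :
    ∃ X Y : W.SingularSubspace k, (W.polarGrassmannGraph k).dist X Y = 2 ∧
      2 ≤ {Z | (W.polarGrassmannGraph k).Adj X Z ∧
        (W.polarGrassmannGraph k).dist Z Y = 1}.ncard := by
  obtain ⟨a, b, hab⟩ := W.exists_isHyperbolic_wittIndex
  obtain ⟨X, hX, haX, hbX, -⟩ := hab.exists_hasOppositeForm (k := k) (m := 1) hk1 hk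
  obtain ⟨hgeo, hopp⟩ := hX.isGeodesic hk le_rfl
  refine ⟨X 0, X (Fin.last 2), hgeo.2, ?_⟩
  have hab0 : W.form (a ⟨0, by omega⟩) (b ⟨0, by omega⟩) ≠ 0 := by
    rw [hab.form_eq, if_pos rfl]
    exact one_ne_zero
  have habk : W.form (a ⟨k, hk⟩) (b ⟨k, hk⟩) ≠ 0 := by
    rw [hab.form_eq, if_pos rfl]
    exact one_ne_zero
  have hne : ∀ i : Fin W.wittIndex, (i : ℕ) < k → i ≠ ⟨k, hk⟩ := by
    rintro i hi rfl
    exact hi.false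
  have hba : ∀ i : Fin W.wittIndex, (i : ℕ) < k → W.form (b ⟨k, hk⟩) (a i) = 0 := fun i hi => by
    rw [form_eq_zero_comm, hab.form_eq, if_neg (hne i hi)]
  have hba0 : W.form (b ⟨0, by omega⟩) (a ⟨k, hk⟩) = 0 := by
    rw [form_eq_zero_comm, hab.form_eq, if_neg (hne ⟨0, by omega⟩ hk1).symm]
  have haX0 := haX ⟨0, by omega⟩ hk1
  -- The common neighbours spanned by a hyperplane of `X 0` and `a k` or `b k`.
  obtain ⟨Z, hZ, hZeq⟩ := hopp.exists_mem_closer hk haX0 (hbX ⟨0, by omega⟩ Nat.one_pos) hab0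
    (hab.sing_left ⟨k, hk⟩) (hab.mem_perp hk.le haX fun i _ => hab.form_left _ i)
    (fun h => habk (W.form_eq_zero_comm.1
      (hab.mem_perp hk.le haX hba _ h))) hba0
  obtain ⟨Z', hZ', hZeq'⟩ := hopp.exists_mem_closer hk haX0 (hbX ⟨0, by omega⟩ Nat.one_pos) hab0
    (hab.sing_right ⟨k, hk⟩) (hab.mem_perp hk.le haX hba)
    (fun h => habk (hab.mem_perp hk.le haX (fun i _ => hab.form_left _ i) _ h))
    (hab.form_right _ _)
  refine (Set.one_lt_ncard).2 ⟨Z, ⟨hZ.1, ?_⟩, Z', ⟨hZ'.1, ?_⟩, fun h => habk ?_⟩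
  · exact Nat.succ_injective (hZ.2.trans hgeo.2)
  · exact Nat.succ_injective (hZ'.2.trans hgeo.2)
  · refine Z.2.1.form_eq_zero (hZeq.ge ?_) (h ▸ hZeq'.ge ?_) <;>
      exact Submodule.mem_sup_right (Submodule.mem_span_singleton_self _)

/-- The number `c 2` would have two different values. -/
theorem not_isDistanceRegular [Finite V] (hk : k < W.wittIndex) (hk2 : 2 ≤ k) :
    ¬ (W.polarGrassmannGraph k).IsDistanceRegular := by
  rintro ⟨-, b, c, -, h⟩
  obtain ⟨X, Y, hXY, h1⟩ := exists_ncard_le_one hk hk2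
  obtain ⟨X', Y', hXY', h2⟩ := exists_two_le_ncard (W := W) hk (by omega)
  have h3 := (h 2 one_le_two (by rw [diam_eq hk (by omega)]; omega)).2
  have h4 := h3 X Y hXY
  have h5 := h3 X' Y' hXY'
  rw [show 2 - 1 = 1 from rfl] at h4 h5
  omega

/-! ### Polar graphs and dual polar graphs are geodesic-transitive -/

/-- In a polar graph, geodesics with opposite ends have length two, and the other ones have length
at most one and hence a pattern that is nowhere defined. -/
theorem isGeodesicTransitive_one (hW : 1 < W.wittIndex) :
    (W.polarGrassmannGraph 1).IsGeodesicTransitive := by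
  refine ⟨connected hW, fun l p p' hp hp' => ?_⟩
  have key : ∀ q : Fin (l + 1) → W.SingularSubspace 1, (W.polarGrassmannGraph 1).IsGeodesic q →
      (W.Opposite (q 0).1 (q (Fin.last l)).1 ↔ l = 2) := by
    intro q hq
    constructor
    · intro h
      have h1 := h.two_le_dist hW
      have h2 := h.dist_eq hW
      rw [hq.2] at h1 h2
      omega
    · rintro rfl
      by_contra h
      have h2 := dist_of_not_opposite hW h
      rw [hq.2] at h2
      omega
  by_cases hl : l = 2
  · subst hl
    obtain ⟨φ, -, hφ⟩ := (PolarForm.exists_hasOppositeForm hW le_rfl hp ((key p hp).2 rfl))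
      |>.exists_isometryAut le_rfl
      (PolarForm.exists_hasOppositeForm hW le_rfl hp' ((key p' hp').2 rfl))
    exact ⟨φ, hφ⟩
  · obtain ⟨r, hr, h⟩ := exists_hasPattern hW hp fun h => hl ((key p hp).1 h)
    obtain ⟨r', hr', h'⟩ := exists_hasPattern hW hp' fun h => hl ((key p' hp').1 h)
    have hl1 := (h.card_le hr).1
    have hnone : ∀ r : Fin l → Option (Fin l), IsPattern r → ∀ i, r i = none := by
      intro r hr i
      refine Option.eq_none_iff_forall_ne_some.2 fun j hj => ?_
      have := hr.1 i j hj
      omega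
    obtain rfl : r = r' := funext fun i => (hnone r hr i).trans (hnone r' hr' i).symm
    obtain ⟨φ, -, hφ⟩ := h.exists_isometryAut h'
    exact ⟨φ, hφ⟩

/-- Totally singular subspaces of dimension `ω` are maximal. -/
theorem mem_of_mem_perp (hk : k = W.wittIndex) {X : W.SingularSubspace k} {v : V}
    (hv : W.Sing v) (hvX : v ∈ W.perp X.1) : v ∈ X.1 := by
  have h1 := X.2.1.sup_span_singleton hv hvX
  have h2 : X.1 = X.1 ⊔ Submodule.span F {v} :=
    Submodule.eq_of_le_of_finrank_le le_sup_left 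
      (h1.finrank_le.trans (hk.symm.trans X.2.2.symm).le)
  rw [h2]
  exact Submodule.mem_sup_right (Submodule.mem_span_singleton_self v)

/-- In a dual polar graph, a geodesic has a matched basis with `B(x_i, y_j) = δ_{ij}`: since its
ends are maximal, no `x_i` is orthogonal to all `y_j`. -/
theorem exists_dual_basis (hk : k = W.wittIndex) {X : Fin (m + 1) → W.SingularSubspace k}
    (h : (W.polarGrassmannGraph k).IsGeodesic X) :
    ∃ (x y : Fin m → V) (w : Fin (k - m) → V),
      LinearIndependent F (Sum.elim (Sum.elim x y) w) ∧
      (∀ i : Fin (m + 1), (X i).1 = Submodule.span F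
        (x '' {j | (j : ℕ) + i < m} ∪ y '' {j | m ≤ (j : ℕ) + i} ∪ Set.range w)) ∧
      ∀ i j, W.form (x i) (y j) = if i = j then 1 else 0 := by
  have h1 := dist_of_eq hk (X 0) (X (Fin.last m))
  rw [h.2] at h1
  obtain ⟨x, y, w, r, hli, hX, hinj, hform⟩ := exists_matched_basis h.1 h1.le
  obtain ⟨hxX, hyX, hwX⟩ := mem_of_eq_span hX
  obtain ⟨h0, hl⟩ := ends_eq_span hX
  have hle : ∀ i j, r i = some j → j ≤ i := by
    intro i j hij
    by_contra hlt
    rw [not_le, Fin.lt_def] at hlt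
    -- Here `x i` and `y j` would lie in the same term of the geodesic.
    have h2 := (X ⟨m - j, by omega⟩).2.1.form_eq_zero (hxX _ i (by simp; omega))
      (hyX _ j (by simp))
    rw [hform, if_pos hij] at h2
    exact one_ne_zero h2
  have hsome : ∀ i, ∃ j, r i = some j := by
    intro i
    by_contra hcon
    push Not at hcon
    have hxl : x i ∈ (X (Fin.last m)).1 := by
      refine mem_of_mem_perp hk ((W.isTotallySingular_iff.1 (X 0).2.1).1 _ (hxX 0 i (by simp))) ?_
      rw [hl, mem_perp_span]
      rintro _ (⟨j, rfl⟩ | ⟨j, rfl⟩)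
      · rw [hform, if_neg (hcon j)]
      · exact (X 0).2.1.form_eq_zero (hxX 0 i (by simp)) (hwX 0 j)
    rw [hl] at hxl
    refine notMem_span_of_left hli (Set.notMem_empty i) ?_
    rwa [Set.image_empty, Set.empty_union]
  have hself : ∀ n, ∀ i : Fin m, (i : ℕ) = n → r i = some i := by
    intro n
    induction n using Nat.strong_induction_on with
    | h n ih =>
      rintro i rfl
      obtain ⟨j, hj⟩ := hsome i
      rcases (hle i j hj).lt_or_eq with hlt | rfl
      · exact absurd (hinj i j j hj (ih j hlt j rfl)) hlt.ne'
      · exact hj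
  refine ⟨x, y, w, hli, hX, fun i j => ?_⟩
  simp only [hform, hself i i rfl, Option.some_inj]

theorem isGeodesicTransitive_of_eq (hk : k = W.wittIndex) :
    (W.polarGrassmannGraph k).IsGeodesicTransitive := by
  refine ⟨connected_of_eq hk, fun l p p' hp hp' => ?_⟩
  obtain ⟨x, y, w, hli, hX, hform⟩ := exists_dual_basis hk hp
  obtain ⟨x', y', w', hli', hX', hform'⟩ := exists_dual_basis hk hp'
  obtain ⟨φ, -, hφ⟩ := exists_isometryAut_of_eq_span hli hli' hX hX' fun i j =>
    (hform i j).trans (hform' i j).symm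
  exact ⟨φ, hφ⟩

end PolarForm

theorem theorem1p2 {F V : Type*} [Field F] [Finite F] [AddCommGroup V] [Module F V]
    [FiniteDimensional F V] (W : PolarForm F V) (hW : 2 ≤ W.wittIndex)
    (k : ℕ) (hk : 1 ≤ k) (hkW : k ≤ W.wittIndex) :
    -- The equivalence.
    [(W.polarGrassmannGraph k).IsGeodesicTransitive,
      (W.polarGrassmannGraph k).IsDistanceRegular,
      k = 1 ∨ k = W.wittIndex].TFAE ∧
    (k < W.wittIndex →
      -- Distances, the diameter, and the geodesics.
      (∀ X Y : W.SingularSubspace k, X ≠ Y →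
        (¬ W.Opposite X.1 Y.1 →
          (W.polarGrassmannGraph k).dist X Y = k - Module.finrank F ↥(X.1 ⊓ Y.1)) ∧
        (W.Opposite X.1 Y.1 →
          (W.polarGrassmannGraph k).dist X Y = k - Module.finrank F ↥(X.1 ⊓ Y.1) + 1)) ∧
      (W.polarGrassmannGraph k).diam = k + 1 ∧
      (∀ m, 1 ≤ m → ∀ X : Fin (m + 1) → W.SingularSubspace k,
        (W.polarGrassmannGraph k).IsGeodesic X ∧ ¬ W.Opposite (X 0).1 (X (Fin.last m)).1 ↔
          ∃ r, PolarForm.IsPattern r ∧ W.HasPattern k r X) ∧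
      (∀ m, 1 ≤ m → ∀ X : Fin (m + 2) → W.SingularSubspace k,
        (W.polarGrassmannGraph k).IsGeodesic X ∧ W.Opposite (X 0).1 (X (Fin.last (m + 1))).1 ↔
          W.HasOppositeForm k X) ∧
      -- The orbits of the isometry group and of the full automorphism group on the geodesics.
      W.OrbitDescription k (W.isometryAut k) ∧
      (¬ (W.IsOrthogonal ∧ Module.finrank F V = 8 ∧ W.wittIndex = 4 ∧ k = 2) →
        W.OrbitDescription k ⊤)) := by
  have : Finite V := Module.finite_of_finite F
  refine ⟨?_, fun hkω => ⟨fun X Y hXY => ⟨fun h => ?_, fun h => ?_⟩, PolarForm.diam_eq hkω hk,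
    fun m _ X => PolarForm.isGeodesic_not_opposite_iff hkω,
    fun m hm X => PolarForm.isGeodesic_opposite_iff hkω hm,
    PolarForm.orbitDescription hkω le_rfl fun φ hφ X Y =>
      PolarForm.opposite_iff_of_mem_isometryAut hφ X Y,
    fun hex => PolarForm.orbitDescription hkω le_top fun φ _ X Y =>
      PolarForm.opposite_iff_map hkω hex φ X Y⟩⟩
  · tfae_have 1 → 2 := fun h => h.isDistanceRegular
    tfae_have 2 → 3 := fun h => by
      by_contra hcon
      rw [not_or] at hcon
      exact PolarForm.not_isDistanceRegular (lt_of_le_of_ne hkW hcon.2) (by omega) h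
    tfae_have 3 → 1 := by
      rintro (rfl | h)
      · exact PolarForm.isGeodesicTransitive_one hW
      · exact PolarForm.isGeodesicTransitive_of_eq h
    tfae_finish
  · have := PolarForm.dist_of_not_opposite hkω h
    omega
  · have h1 := h.dist_eq hkω
    have h2 := PolarForm.finrank_inf_lt hXY
    omega
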